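/- **Setting.** Let $2<s<3$, let $n$ be a natural number with $n>2s$, and put $b:=5-2s\in(-1,1)$. Points of $\mathbb R^{n+1}_+=\{y>0\}$ are written $X=(x,y)$, $x\in\mathbb R^n$, and $\Delta_b w:=\Delta w+\frac by\,\partial_y w=y^{-b}\operatorname{div}(y^b\nabla w)$. Let $\kappa=C_{n,s}>0$ be a constant. Let $u_e$ be a solution of the extension problem of $(-\Delta)^s u=|u|^{p-1}u$ in $\mathbb R^n$: $$\Delta_b^3u_e=0\ \text{ in }\mathbb R^{n+1}_+,\qquad \lim_{y\to0}y^b\partial_yu_e=0,\quad \lim_{y\to0}y^b\partial_y\Delta_bu_e=0,\quad \lim_{y\to0}y^b\partial_y\Delta_b^2u_e=-C_{n,s}|u_e|^{p-1}u_e\ \text{ on }\partial\mathbb R^{n+1}_+,$$ understood classically: $u_e\in C^6(\mathbb R^{n+1}_+)\cap C(\overline{\mathbb R^{n+1}_+})$, and for $j\in\{0,1,2\}$ and tangential multi-indices $\alpha$ the functions $\partial_x^\alpha\Delta_b^ju_e$ ($|\alpha|+2j\le5$) and $y^b\partial_y\partial_x^\alpha\Delta_b^ju_e$ ($|\alpha|+2j+1\le5$)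 extend continuously to $\overline{\mathbb R^{n+1}_+}$. **Energy.** For $x_0\in\mathbb R^n$ and $\lambda>0$ put $u_e^\lambda(X)=\lambda^{\frac{2s}{p-1}}u_e((x_0,0)+\lambda X)$. Let $\nabla_{S^n}$ be the tangential gradient on the unit sphere, $\theta_1=y/r$ with $r=|X|$, and $\Delta_{S^n}f:=\theta_1^{-b}\operatorname{div}_{S^n}(\theta_1^b\nabla_{S^n}f)$. For real coefficients $C^1_{i,j},C^2_{i,j},C^3_{i,j}$ let $$\begin{aligned}E^c(\lambda,x_0,u_e)=&\int_{\mathbb R^{n+1}_+\cap B_1}\tfrac12y^b|\nabla\Delta_bu_e^\lambda|^2-\frac{C_{n,s}}{p+1}\int_{\partial\mathbb R^{n+1}_+\cap B_1}|u_e^\lambda|^{p+1}+\Big(\frac s{p-1}+1\Big)\int_{\mathbb R^{n+1}_+\cap\partial B_1}\theta_1^b(\Delta_bu_e^\lambda)^2\\&+\sum_{0\le i,j\le4,\ i+j\le5}C^1_{i,j}\int_{\mathbb R^{n+1}_+\cap\partial B_1}\theta_1^b\lambda^{i+j}\frac{d^iu_e^\lambda}{d\lambda^i}\frac{d^ju_e^\lambda}{d\lambda^j}\\&+\sum_{0\le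 i,j\le2,\ i+j\le3}C^2_{i,j}\int_{\mathbb R^{n+1}_+\cap\partial B_1}\theta_1^b\lambda^{i+j}\,\nabla_{S^n}\frac{d^iu_e^\lambda}{d\lambda^i}\cdot\nabla_{S^n}\frac{d^ju_e^\lambda}{d\lambda^j}\\&+\sum_{0\le i,j\le1,\ i+j\le1}C^3_{i,j}\int_{\mathbb R^{n+1}_+\cap\partial B_1}\theta_1^b\lambda^{i+j}\,\Delta_{S^n}\frac{d^iu_e^\lambda}{d\lambda^i}\,\Delta_{S^n}\frac{d^ju_e^\lambda}{d\lambda^j}.\end{aligned}$$ **Exponent.** Let $$p_m(n):=\begin{cases}+\infty&\text{if }n\le2s+6+\sqrt{73},\\[2pt]\dfrac{5n+10s-\sqrt{15(n-2s)^2+120(n-2s)+370}}{5n-10s-\sqrt{15(n-2s)^2+120(n-2s)+370}}&\text{if }n>2s+6+\sqrt{73}.\end{cases}$$ **Theorem 2.3.** Assume $\frac{n+2s}{n-2s}<p<p_m(n)$. Then there are coefficients $C^1_{i,j},C^2_{i,j},C^3_{i,j}$ and a constant $C(n,s,p)>0$, all depending only on $n,s,p$, such that for every $C_{n,s}>0$,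 every such $u_e$ and every $x_0\in\mathbb R^n$ the function $\lambda\mapsto E^c(\lambda,x_0,u_e)$ is nondecreasing on $(0,\infty)$. Moreover, for every $\lambda>0$ all integrals in $E^c$ converge absolutely, $E^c$ is differentiable at $\lambda$, and $$\frac{dE^c(\lambda,x_0,u_e)}{d\lambda}\ \ge\ C(n,s,p)\,\lambda^{2s\frac{p+1}{p-1}-6-n}\int_{\mathbb R^{n+1}_+\cap\partial B_\lambda(x_0)}y^b\Big(\frac{2s}{p-1}u_e+\lambda\,\partial_ru_e\Big)^2,$$ where $\partial_r$ is the radial derivative about $(x_0,0)$ and the integral on the right converges. -/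

import Mathlib

noncomputable section

namespace LaneEmden

/-- Points `X = (x, y)` of `ℝⁿ⁺¹ = ℝⁿ × ℝ`; the last coordinate is the extension variable `y`. -/
abbrev Space (n : ℕ) : Type := EuclideanSpace ℝ (Fin (n + 1))

/-- The extension variable `y` of `X = (x, y)`. -/
def height {n : ℕ} (X : Space n) : ℝ := X (Fin.last n)

/-- The open upper half space `ℝⁿ⁺¹₊ = {y > 0}`. -/
def upperHalf (n : ℕ) : Set (Space n) := {X | 0 < height X}

/-- The closed upper half space `{y ≥ 0}`. -/
def closedUpperHalf (n : ℕ) : Set (Space n) := {X | 0 ≤ height X}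

/-- The point `(x, y)` of `ℝⁿ⁺¹`. -/
def point {n : ℕ} (x : EuclideanSpace ℝ (Fin n)) (y : ℝ) : Space n :=
  WithLp.toLp 2 (Fin.snoc (α := fun _ => ℝ) (fun i => x i) y)

/-- The derivative `∂_y f`. -/
def partialY {n : ℕ} (f : Space n → ℝ) (X : Space n) : ℝ :=
  fderiv ℝ f X (EuclideanSpace.single (Fin.last n) 1)

/-- The derivative `∂_{x_i} f`. -/
def partialX {n : ℕ} (i : Fin n) (f : Space n → ℝ) (X : Space n) : ℝ :=
  fderiv ℝ f X (EuclideanSpace.single i.castSucc 1)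

/-- The iterated tangential derivative `∂_{x_{i₁}} ⋯ ∂_{x_{iₘ}} f` for `α = [i₁, …, iₘ]`. -/
def iterPartialX {n : ℕ} (α : List (Fin n)) (f : Space n → ℝ) : Space n → ℝ :=
  α.foldr partialX f

/-- `Δ_b f = Δ f + (b / y) ∂_y f = y⁻ᵇ div (yᵇ ∇ f)`. -/
def weightedLaplacian {n : ℕ} (b : ℝ) (f : Space n → ℝ) (X : Space n) : ℝ :=
  Laplacian.laplacian f X + b / height X * partialY f X

/-- `f`, given on the open upper half space, has a continuous extension to the closed one
(it is a function on all of `ℝⁿ⁺¹`, but only its values on `{y > 0}` are used). -/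
def ExtendsContinuously {n : ℕ} (f : Space n → ℝ) : Prop :=
  ∃ g : Space n → ℝ, ContinuousOn g (closedUpperHalf n) ∧ Set.EqOn g f (upperHalf n)

/-- `u` is a classical solution, regular up to the boundary, of the extension problem of
`(-Δ)ˢ u = |u|ᵖ⁻¹ u` for `2 < s < 3`, with weight exponent `b = 5 - 2 s` and normalizing
constant `κ = C_{n,s}`.  Only the values of `u` on `{y ≥ 0}` are used. -/
structure IsExtensionSolution {n : ℕ} (s p κ : ℝ) (u : Space n → ℝ) : Prop where
  /-- interior regularity: the equation is of sixth order -/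
  contDiffOn : ContDiffOn ℝ 6 u (upperHalf n)
  /-- the trace `u(x, 0)` is attained continuously -/
  continuousOn : ContinuousOn u (closedUpperHalf n)
  /-- regularity up to the boundary of `∂_x^α Δ_b^j u`, of total order at most five -/
  tangential : ∀ (j : ℕ) (α : List (Fin n)), j ≤ 2 → α.length + 2 * j ≤ 5 →
    ExtendsContinuously (iterPartialX α ((weightedLaplacian (5 - 2 * s))^[j] u))
  /-- regularity up to the boundary of `yᵇ ∂_y ∂_x^α Δ_b^j u`, of total order at most five -/
  conormal : ∀ (j : ℕ) (α : List (Fin n)), j ≤ 2 → α.length + 2 * j + 1 ≤ 5 →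
    ExtendsContinuously (fun X => height X ^ (5 - 2 * s) *
      partialY (iterPartialX α ((weightedLaplacian (5 - 2 * s))^[j] u)) X)
  /-- `Δ_b³ u = 0` in the upper half space -/
  equation : ∀ X ∈ upperHalf n, (weightedLaplacian (5 - 2 * s))^[3] u X = 0
  /-- `lim_{y → 0} yᵇ ∂_y u = 0` -/
  boundary_zero : ∀ x : EuclideanSpace ℝ (Fin n),
    Filter.Tendsto (fun y : ℝ => y ^ (5 - 2 * s) * partialY u (point x y))
      (nhdsWithin 0 (Set.Ioi 0)) (nhds 0)
  /-- `lim_{y → 0} yᵇ ∂_y Δ_b u = 0` -/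
  boundary_one : ∀ x : EuclideanSpace ℝ (Fin n),
    Filter.Tendsto
      (fun y : ℝ => y ^ (5 - 2 * s) * partialY (weightedLaplacian (5 - 2 * s) u) (point x y))
      (nhdsWithin 0 (Set.Ioi 0)) (nhds 0)
  /-- `lim_{y → 0} yᵇ ∂_y Δ_b² u = - κ |u|ᵖ⁻¹ u` -/
  boundary_two : ∀ x : EuclideanSpace ℝ (Fin n),
    Filter.Tendsto
      (fun y : ℝ =>
        y ^ (5 - 2 * s) * partialY ((weightedLaplacian (5 - 2 * s))^[2] u) (point x y))
      (nhdsWithin 0 (Set.Ioi 0))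
      (nhds (-κ * (|u (point x 0)| ^ (p - 1) * u (point x 0))))

/-- The rescaling `u^λ(X) = λ^{2s/(p-1)} u((x₀, 0) + λ X)` about the boundary point `(x₀, 0)`. -/
def rescale {n : ℕ} (s p : ℝ) (x₀ : EuclideanSpace ℝ (Fin n)) (u : Space n → ℝ)
    (l : ℝ) (X : Space n) : ℝ :=
  l ^ (2 * s / (p - 1)) * u (point x₀ 0 + l • X)

/-- `d^i u^λ / dλ^i` as a function of `X`, at `λ = l`. -/
def rescaleDeriv {n : ℕ} (s p : ℝ) (x₀ : EuclideanSpace ℝ (Fin n)) (u : Space n → ℝ)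
    (i : ℕ) (l : ℝ) (X : Space n) : ℝ :=
  iteratedDeriv i (fun t => rescale s p x₀ u t X) l

/-- The open upper half `ℝⁿ⁺¹₊ ∩ ∂B₁` of the unit sphere. -/
def upperSphere (n : ℕ) : Set (Metric.sphere (0 : Space n) 1) :=
  {ω | 0 < height (ω : Space n)}

/-- The surface measure of `ℝⁿ⁺¹₊ ∩ ∂B₁`. -/
def upperSphereMeasure (n : ℕ) : MeasureTheory.Measure (Metric.sphere (0 : Space n) 1) :=
  ((MeasureTheory.volume : MeasureTheory.Measure (Space n)).toSphere).restrict (upperSphere n)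

/-- The open upper half `ℝⁿ⁺¹₊ ∩ B₁` of the unit ball. -/
def upperBall (n : ℕ) : Set (Space n) := upperHalf n ∩ Metric.ball 0 1

/-- The tangential gradient `∇_{Sⁿ} f = ∇ f - (∂_r f) ω` at a point `ω` of the unit sphere. -/
def sphereGradient {n : ℕ} (f : Space n → ℝ) (ω : Space n) : Space n :=
  gradient f ω - (inner ℝ (gradient f ω) ω) • ω

/-- The weighted spherical Laplacian `θ₁⁻ᵇ div_{Sⁿ} (θ₁ᵇ ∇_{Sⁿ} f)` at a point `ω` of the unit
sphere, that is, the spherical part of `Δ_b` in polar coordinates: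
`Δ_b f = ∂_rr f + (n + b) / r ∂_r f + r⁻² Δ_{Sⁿ} f`. -/
def sphereLaplacian {n : ℕ} (b : ℝ) (f : Space n → ℝ) (ω : Space n) : ℝ :=
  weightedLaplacian b f ω - iteratedDeriv 2 (fun r : ℝ => f (r • ω)) 1
    - ((n : ℝ) + b) * deriv (fun r : ℝ => f (r • ω)) 1

/-- The integrand `θ₁ᵇ λ^{i+j} (d^i u^λ/dλ^i) (d^j u^λ/dλ^j)`; on the unit sphere `θ₁ = y`. -/
def term₁ {n : ℕ} (s p : ℝ) (x₀ : EuclideanSpace ℝ (Fin n)) (u : Space n → ℝ) (l : ℝ)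
    (i j : ℕ) (ω : Space n) : ℝ :=
  height ω ^ (5 - 2 * s) *
    (l ^ (i + j) * (rescaleDeriv s p x₀ u i l ω * rescaleDeriv s p x₀ u j l ω))

/-- The integrand `θ₁ᵇ λ^{i+j} ∇_{Sⁿ} (d^i u^λ/dλ^i) · ∇_{Sⁿ} (d^j u^λ/dλ^j)`. -/
def term₂ {n : ℕ} (s p : ℝ) (x₀ : EuclideanSpace ℝ (Fin n)) (u : Space n → ℝ) (l : ℝ)
    (i j : ℕ) (ω : Space n) : ℝ :=
  height ω ^ (5 - 2 * s) *
    (l ^ (i + j) * inner ℝ (sphereGradient (rescaleDeriv s p x₀ u i l) ω)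
      (sphereGradient (rescaleDeriv s p x₀ u j l) ω))

/-- The integrand `θ₁ᵇ λ^{i+j} Δ_{Sⁿ} (d^i u^λ/dλ^i) Δ_{Sⁿ} (d^j u^λ/dλ^j)`. -/
def term₃ {n : ℕ} (s p : ℝ) (x₀ : EuclideanSpace ℝ (Fin n)) (u : Space n → ℝ) (l : ℝ)
    (i j : ℕ) (ω : Space n) : ℝ :=
  height ω ^ (5 - 2 * s) *
    (l ^ (i + j) * (sphereLaplacian (5 - 2 * s) (rescaleDeriv s p x₀ u i l) ω *
      sphereLaplacian (5 - 2 * s) (rescaleDeriv s p x₀ u j l) ω))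

/-- The integrand `θ₁ᵇ (Δ_b u^λ)²`. -/
def term₄ {n : ℕ} (s p : ℝ) (x₀ : EuclideanSpace ℝ (Fin n)) (u : Space n → ℝ) (l : ℝ)
    (ω : Space n) : ℝ :=
  height ω ^ (5 - 2 * s) * weightedLaplacian (5 - 2 * s) (rescale s p x₀ u l) ω ^ 2

/-- The integrand `½ yᵇ |∇ Δ_b u^λ|²` of the bulk energy. -/
def bulkDensity {n : ℕ} (s p : ℝ) (x₀ : EuclideanSpace ℝ (Fin n)) (u : Space n → ℝ) (l : ℝ)
    (X : Space n) : ℝ :=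
  1 / 2 * (height X ^ (5 - 2 * s) *
    ‖gradient (weightedLaplacian (5 - 2 * s) (rescale s p x₀ u l)) X‖ ^ 2)

/-- The integrand `|u^λ(x, 0)|^{p+1}` of the potential energy. -/
def potentialDensity {n : ℕ} (s p : ℝ) (x₀ : EuclideanSpace ℝ (Fin n)) (u : Space n → ℝ)
    (l : ℝ) (x : EuclideanSpace ℝ (Fin n)) : ℝ :=
  |rescale s p x₀ u l (point x 0)| ^ (p + 1)

/-- The energy `E(λ, x₀, u)` with coefficients `c₁ = C¹`, `c₂ = C²`, `c₃ = C³` in its boundary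
terms.  The modified energy `Eᶜ` is this functional for a suitable choice of `c₁`, `c₂`, `c₃`. -/
def energy {n : ℕ} (s p κ : ℝ) (c₁ c₂ c₃ : ℕ → ℕ → ℝ) (x₀ : EuclideanSpace ℝ (Fin n))
    (u : Space n → ℝ) (l : ℝ) : ℝ :=
  (∫ X in upperBall n, bulkDensity s p x₀ u l X)
    - κ / (p + 1) * (∫ x in Metric.ball (0 : EuclideanSpace ℝ (Fin n)) 1,
        potentialDensity s p x₀ u l x)
    + (∑ i ∈ Finset.range 5, ∑ j ∈ Finset.range 5, if i + j ≤ 5 then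
        c₁ i j * ∫ ω, term₁ s p x₀ u l i j ω ∂(upperSphereMeasure n) else 0)
    + (∑ i ∈ Finset.range 3, ∑ j ∈ Finset.range 3, if i + j ≤ 3 then
        c₂ i j * ∫ ω, term₂ s p x₀ u l i j ω ∂(upperSphereMeasure n) else 0)
    + (∑ i ∈ Finset.range 2, ∑ j ∈ Finset.range 2, if i + j ≤ 1 then
        c₃ i j * ∫ ω, term₃ s p x₀ u l i j ω ∂(upperSphereMeasure n) else 0)
    + (s / (p - 1) + 1) * ∫ ω, term₄ s p x₀ u l ω ∂(upperSphereMeasure n)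

/-- All the integrals in the energy `E(λ, x₀, u)` converge absolutely. -/
def EnergyConverges {n : ℕ} (s p : ℝ) (x₀ : EuclideanSpace ℝ (Fin n)) (u : Space n → ℝ)
    (l : ℝ) : Prop :=
  MeasureTheory.IntegrableOn (bulkDensity s p x₀ u l) (upperBall n) ∧
  MeasureTheory.IntegrableOn (potentialDensity s p x₀ u l)
    (Metric.ball (0 : EuclideanSpace ℝ (Fin n)) 1) ∧
  (∀ i j : ℕ, i ≤ 4 → j ≤ 4 → i + j ≤ 5 → MeasureTheory.Integrable
    (fun ω : Metric.sphere (0 : Space n) 1 => term₁ s p x₀ u l i j ω) (upperSphereMeasure n)) ∧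
  (∀ i j : ℕ, i ≤ 2 → j ≤ 2 → i + j ≤ 3 → MeasureTheory.Integrable
    (fun ω : Metric.sphere (0 : Space n) 1 => term₂ s p x₀ u l i j ω) (upperSphereMeasure n)) ∧
  (∀ i j : ℕ, i ≤ 1 → j ≤ 1 → i + j ≤ 1 → MeasureTheory.Integrable
    (fun ω : Metric.sphere (0 : Space n) 1 => term₃ s p x₀ u l i j ω) (upperSphereMeasure n)) ∧
  MeasureTheory.Integrable
    (fun ω : Metric.sphere (0 : Space n) 1 => term₄ s p x₀ u l ω) (upperSphereMeasure n)

/-- The radial derivative `∂_r f` about the boundary point `(x₀, 0)`. -/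
def radialDeriv {n : ℕ} (x₀ : EuclideanSpace ℝ (Fin n)) (f : Space n → ℝ) (X : Space n) : ℝ :=
  fderiv ℝ f X (‖X - point x₀ 0‖⁻¹ • (X - point x₀ 0))

/-- The integrand `yᵇ (2s/(p-1) u + λ ∂_r u)²`. -/
def defect {n : ℕ} (s p : ℝ) (x₀ : EuclideanSpace ℝ (Fin n)) (u : Space n → ℝ) (l : ℝ)
    (X : Space n) : ℝ :=
  height X ^ (5 - 2 * s) * (2 * s / (p - 1) * u X + l * radialDeriv x₀ u X) ^ 2

/-- The surface integral `∫_{ℝⁿ⁺¹₊ ∩ ∂B_r(x₀)} g`, pulled back to the unit sphere. -/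
def halfSphereIntegral {n : ℕ} (x₀ : EuclideanSpace ℝ (Fin n)) (r : ℝ) (g : Space n → ℝ) : ℝ :=
  r ^ n * ∫ ω, g (point x₀ 0 + r • (ω : Space n)) ∂(upperSphereMeasure n)

/-- Absolute convergence of `∫_{ℝⁿ⁺¹₊ ∩ ∂B_r(x₀)} g`. -/
def HalfSphereIntegrable {n : ℕ} (x₀ : EuclideanSpace ℝ (Fin n)) (r : ℝ) (g : Space n → ℝ) :
    Prop :=
  MeasureTheory.Integrable
    (fun ω : Metric.sphere (0 : Space n) 1 => g (point x₀ 0 + r • (ω : Space n)))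
    (upperSphereMeasure n)

open Classical in
/-- The upper bound `p_m(n)`.  At `n = 2s + 6 + √73` the denominator of the quotient vanishes and
its numerator is positive; the value there is `+∞`. -/
def upperExponent (n : ℕ) (s : ℝ) : EReal :=
  if (n : ℝ) ≤ 2 * s + 6 + √73 then ⊤
  else (((5 * n + 10 * s - √(15 * (n - 2 * s) ^ 2 + 120 * (n - 2 * s) + 370)) /
    (5 * n - 10 * s - √(15 * (n - 2 * s) ^ 2 + 120 * (n - 2 * s) + 370)) : ℝ) : EReal)

end LaneEmden

end

/-! ### Calculus in the half space: directional derivatives, the Euler operator, `Δ_b`. -/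

noncomputable section

namespace LaneEmden

open Set Filter Topology

variable {n : ℕ}

/-! Write U for the solution translated by (x₀, 0), k = 2s/(p-1) and D = X · ∇ + k. Since λ d/dλ of
u^λ is λ^k times the dilate of D U, every term of the energy is a power of λ times an integral, over
a half ball, a ball or a half sphere, of an expression in U and its derivatives. Differentiation in
λ becomes the action of D, and everything is computed for U alone.

Bulk term. Since Δ_b D = (D + 2) Δ_b, the derivative of the bulk energy is an integral of y^b ∇w ·
∇g, where v = D U, w = Δ_b v, g = Δ_b U. With h = Δ_b² U and Δ_b h = 0, this integrand is the
divergence of y^b (w ∇g - h ∇v + v ∇h). By the boundary conditions the flux through {y = 0} is a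
multiple of |U|^{p-1} U · D U, and it cancels the derivative of the potential energy
(`integral_gradDot_halfBall`, `hasDerivAt_potentialEnergy`). Only the flux through the half sphere
is left.

Half sphere. There |X|² Δ_b = D² + α D + β + Δ_S, where Δ_S commutes with D and is symmetric on the
half sphere for functions with vanishing conormal derivative (`sphereMean_integration_by_parts`).
Expanding the flux and integrating by parts shows that it is an exact λ-derivative plus the
quadratic form 3 |D³U|² + c₂ |D²U|² + c₁ |DU|² + 6 |∇_S D²U|² + c_g |∇_S DU|² + 3 |Δ_S DU|²
(`boundaryForm_dissipation`). The spherical terms of the energy are chosen to remove the exact part,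
so the derivative of the energy is this form divided by λ (`hasDerivAt_eulerEnergy`).

Signs. Supercriticality is 2k < n - 2s and gives c₁ > 0 and c_g ≥ 0; the bound p < p_m(n) gives c₂ ≥
0. Dropping all terms but c₁ |DU|², and noting that D U = k U + r ∂_r U, yields the theorem with C =
c₁.

Regularity. Up to {y = 0} only tangential derivatives and conormal derivatives y^b ∂_y are
controlled, in total order five. The class `Generated` of functions controlled in this way is stable
under X · ∇, and |b| < 1 makes the remaining singularities O(y^{-|b|}) integrable (`Tame`), which
justifies all differentiations and integrations by parts. -/

lemma hasFDerivAt_height (X : Space n) :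
    HasFDerivAt (height : Space n → ℝ)
      (EuclideanSpace.proj (Fin.last n) : Space n →L[ℝ] ℝ) X :=
  (EuclideanSpace.proj (Fin.last n) : Space n →L[ℝ] ℝ).hasFDerivAt

lemma contDiff_height {m : WithTop ℕ∞} : ContDiff ℝ m (height : Space n → ℝ) :=
  (EuclideanSpace.proj (Fin.last n) : Space n →L[ℝ] ℝ).contDiff

lemma continuous_height : Continuous (height : Space n → ℝ) :=
  (EuclideanSpace.proj (Fin.last n) : Space n →L[ℝ] ℝ).continuous

lemma height_smul (t : ℝ) (X : Space n) : height (t • X) = t * height X := rfl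

lemma height_add (X Y : Space n) : height (X + Y) = height X + height Y := rfl

lemma isOpen_upperHalf : IsOpen (upperHalf n) := isOpen_lt continuous_const continuous_height

lemma isClosed_closedUpperHalf : IsClosed (closedUpperHalf n) :=
  isClosed_le continuous_const continuous_height

lemma upperHalf_subset : upperHalf n ⊆ closedUpperHalf n := fun _ hX => le_of_lt (show 0 < height _ from hX)

lemma smul_mem_upperHalf {t : ℝ} (ht : 0 < t) {X : Space n} (hX : X ∈ upperHalf n) :
    t • X ∈ upperHalf n := by
  show 0 < height (t • X)
  rw [height_smul]
  exact mul_pos ht hX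

lemma upperHalf_mem_nhds {X : Space n} (hX : X ∈ upperHalf n) : upperHalf n ∈ 𝓝 X :=
  isOpen_upperHalf.mem_nhds hX

/-- The directional derivative `∂_v f`. -/
def dir (v : Space n) (f : Space n → ℝ) (X : Space n) : ℝ := fderiv ℝ f X v

/-- The Euler operator `X · ∇ f`. -/
def euler (f : Space n → ℝ) (X : Space n) : ℝ := fderiv ℝ f X X

/-- The standard basis vectors. -/
abbrev basisVec (i : Fin (n + 1)) : Space n := EuclideanSpace.single i 1

lemma partialY_eq_dir (f : Space n → ℝ) : partialY f = dir (basisVec (Fin.last n)) f := rfl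

lemma partialX_eq_dir (i : Fin n) (f : Space n → ℝ) : partialX i f = dir (basisVec i.castSucc) f :=
  rfl

lemma eventuallyEq_of_eqOn {f g : Space n → ℝ} (h : EqOn f g (upperHalf n)) {X : Space n}
    (hX : X ∈ upperHalf n) : f =ᶠ[𝓝 X] g :=
  Filter.eventuallyEq_of_mem (upperHalf_mem_nhds hX) h

lemma dir_congr {f g : Space n → ℝ} (h : EqOn f g (upperHalf n)) (v : Space n) :
    EqOn (dir v f) (dir v g) (upperHalf n) := fun X hX => by
  simp only [dir, (eventuallyEq_of_eqOn h hX).fderiv_eq]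

lemma euler_congr {f g : Space n → ℝ} (h : EqOn f g (upperHalf n)) :
    EqOn (euler f) (euler g) (upperHalf n) := fun X hX => by
  simp only [euler, (eventuallyEq_of_eqOn h hX).fderiv_eq]

/-- `f` is of class `Cᵐ` in the open upper half space. -/
def SmoothUpper (m : ℕ) (f : Space n → ℝ) : Prop :=
  ContDiffOn ℝ (m : WithTop ℕ∞) f (upperHalf n)

namespace SmoothUpper

variable {m : ℕ} {f g : Space n → ℝ}

lemma mono {m' : ℕ} (hf : SmoothUpper m f) (h : m' ≤ m) : SmoothUpper m' f :=
  ContDiffOn.of_le hf (by exact_mod_cast h)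

lemma congr (hf : SmoothUpper m f) (h : EqOn g f (upperHalf n)) : SmoothUpper m g :=
  ContDiffOn.congr hf h

lemma continuousOn (hf : SmoothUpper m f) : ContinuousOn f (upperHalf n) :=
  ContDiffOn.continuousOn hf

lemma contDiffAt (hf : SmoothUpper m f) {X : Space n} (hX : X ∈ upperHalf n) :
    ContDiffAt ℝ (m : WithTop ℕ∞) f X :=
  ContDiffOn.contDiffAt hf (upperHalf_mem_nhds hX)

lemma differentiableAt (hf : SmoothUpper m f) (hm : 1 ≤ m) {X : Space n} (hX : X ∈ upperHalf n) :
    DifferentiableAt ℝ f X :=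
  (hf.contDiffAt hX).differentiableAt (by exact_mod_cast (by omega : m ≠ 0))

lemma fderiv (hf : SmoothUpper (m + 1) f) :
    ContDiffOn ℝ (m : WithTop ℕ∞) (fderiv ℝ f) (upperHalf n) :=
  ContDiffOn.fderiv_of_isOpen hf isOpen_upperHalf (by exact_mod_cast le_rfl)

lemma differentiableAt_fderiv (hf : SmoothUpper m f) (hm : 2 ≤ m) {X : Space n}
    (hX : X ∈ upperHalf n) : DifferentiableAt ℝ (_root_.fderiv ℝ f) X :=
  (((hf.mono hm : SmoothUpper 2 f).fderiv (m := 1)).contDiffAt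
    (upperHalf_mem_nhds hX)).differentiableAt (by norm_num)

lemma dir (hf : SmoothUpper (m + 1) f) (v : Space n) : SmoothUpper m (dir v f) :=
  ContDiffOn.clm_apply hf.fderiv contDiffOn_const

lemma euler (hf : SmoothUpper (m + 1) f) : SmoothUpper m (euler f) :=
  ContDiffOn.clm_apply hf.fderiv contDiffOn_id

lemma add (hf : SmoothUpper m f) (hg : SmoothUpper m g) : SmoothUpper m (fun X => f X + g X) :=
  ContDiffOn.add hf hg

lemma sub (hf : SmoothUpper m f) (hg : SmoothUpper m g) : SmoothUpper m (fun X => f X - g X) :=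
  ContDiffOn.sub hf hg

lemma mul (hf : SmoothUpper m f) (hg : SmoothUpper m g) : SmoothUpper m (fun X => f X * g X) :=
  ContDiffOn.mul hf hg

lemma const_mul (c : ℝ) (hf : SmoothUpper m f) : SmoothUpper m (fun X => c * f X) :=
  ContDiffOn.mul contDiffOn_const hf

lemma sum {ι : Type*} (s : Finset ι) {F : ι → Space n → ℝ} (hF : ∀ i ∈ s, SmoothUpper m (F i)) :
    SmoothUpper m (fun X => ∑ i ∈ s, F i X) :=
  ContDiffOn.sum hF

lemma of_contDiff (hf : ContDiff ℝ (m : WithTop ℕ∞) f) : SmoothUpper m f := hf.contDiffOn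

end SmoothUpper

lemma smoothUpper_height_rpow (m : ℕ) (δ : ℝ) :
    SmoothUpper m (fun X : Space n => height X ^ δ) :=
  ContDiffOn.rpow_const_of_ne contDiff_height.contDiffOn fun _ hX => ne_of_gt hX

lemma smoothUpper_height_inv (m : ℕ) (b : ℝ) :
    SmoothUpper m (fun X : Space n => b / height X) :=
  ContDiffOn.div contDiffOn_const contDiff_height.contDiffOn fun _ hX => ne_of_gt hX

lemma smoothUpper_normSq (m : ℕ) : SmoothUpper m (fun X : Space n => ‖X‖ ^ 2) :=
  (contDiff_norm_sq ℝ).contDiffOn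

lemma fderiv_dir {f : Space n → ℝ} (hf : SmoothUpper 2 f) {X : Space n} (hX : X ∈ upperHalf n)
    (v w : Space n) : fderiv ℝ (dir v f) X w = fderiv ℝ (fderiv ℝ f) X w v := by
  have h := (hf.differentiableAt_fderiv le_rfl hX).hasFDerivAt.clm_apply (hasFDerivAt_const v X)
  have h' : HasFDerivAt (dir v f) _ X := h
  rw [h'.fderiv]
  simp

lemma fderiv_euler {f : Space n → ℝ} (hf : SmoothUpper 2 f) {X : Space n} (hX : X ∈ upperHalf n)
    (w : Space n) :
    fderiv ℝ (euler f) X w = fderiv ℝ (fderiv ℝ f) X w X + fderiv ℝ f X w := by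
  have h := (hf.differentiableAt_fderiv le_rfl hX).hasFDerivAt.clm_apply (hasFDerivAt_id X)
  have h' : HasFDerivAt (euler f) _ X := h
  rw [h'.fderiv]
  simp [add_comm]

lemma fderiv_fderiv_symm {f : Space n → ℝ} (hf : SmoothUpper 2 f) {X : Space n}
    (hX : X ∈ upperHalf n) (v w : Space n) :
    fderiv ℝ (fderiv ℝ f) X v w = fderiv ℝ (fderiv ℝ f) X w v :=
  ((hf.contDiffAt hX).isSymmSndFDerivAt (by simp)).eq v w

lemma dir_comm {f : Space n → ℝ} (hf : SmoothUpper 2 f) (v w : Space n) :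
    EqOn (dir v (dir w f)) (dir w (dir v f)) (upperHalf n) := fun X hX => by
  show fderiv ℝ (dir w f) X v = fderiv ℝ (dir v f) X w
  rw [fderiv_dir hf hX, fderiv_dir hf hX, fderiv_fderiv_symm hf hX]

/-- `[∂_v, X · ∇] = ∂_v`. -/
lemma dir_euler {f : Space n → ℝ} (hf : SmoothUpper 2 f) (v : Space n) :
    EqOn (dir v (euler f)) (fun X => euler (dir v f) X + dir v f X) (upperHalf n) := fun X hX => by
  show fderiv ℝ (euler f) X v = fderiv ℝ (dir v f) X X + fderiv ℝ f X v
  rw [fderiv_euler hf hX, fderiv_dir hf hX, fderiv_fderiv_symm hf hX]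

lemma dir_add {f g : Space n → ℝ} {X : Space n} (hf : DifferentiableAt ℝ f X)
    (hg : DifferentiableAt ℝ g X) (v : Space n) :
    dir v (fun Y => f Y + g Y) X = dir v f X + dir v g X := by
  simp [dir, fderiv_fun_add hf hg]

lemma dir_const_mul {f : Space n → ℝ} {X : Space n} (hf : DifferentiableAt ℝ f X)
    (c : ℝ) (v : Space n) : dir v (fun Y => c * f Y) X = c * dir v f X := by
  simp [dir, fderiv_const_mul hf]

lemma dir_mul {f g : Space n → ℝ} {X : Space n} (hf : DifferentiableAt ℝ f X)
    (hg : DifferentiableAt ℝ g X) (v : Space n) :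
    dir v (fun Y => f Y * g Y) X = f X * dir v g X + dir v f X * g X := by
  simp [dir, fderiv_fun_mul hf hg, mul_comm]

lemma dir_sum {ι : Type*} (s : Finset ι) {F : ι → Space n → ℝ} {X : Space n}
    (hF : ∀ i ∈ s, DifferentiableAt ℝ (F i) X) (v : Space n) :
    dir v (fun Y => ∑ i ∈ s, F i Y) X = ∑ i ∈ s, dir v (F i) X := by
  simp [dir, fderiv_fun_sum hF]

lemma euler_eq_dir (f : Space n → ℝ) (X : Space n) : euler f X = dir X f X := rfl

lemma euler_add {f g : Space n → ℝ} {X : Space n} (hf : DifferentiableAt ℝ f X)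
    (hg : DifferentiableAt ℝ g X) :
    euler (fun Y => f Y + g Y) X = euler f X + euler g X := dir_add hf hg X

lemma euler_const_mul {f : Space n → ℝ} {X : Space n} (hf : DifferentiableAt ℝ f X) (c : ℝ) :
    euler (fun Y => c * f Y) X = c * euler f X := dir_const_mul hf c X

lemma euler_mul {f g : Space n → ℝ} {X : Space n} (hf : DifferentiableAt ℝ f X)
    (hg : DifferentiableAt ℝ g X) :
    euler (fun Y => f Y * g Y) X = f X * euler g X + euler f X * g X := dir_mul hf hg X

lemma euler_sum {ι : Type*} (s : Finset ι) {F : ι → Space n → ℝ} {X : Space n}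
    (hF : ∀ i ∈ s, DifferentiableAt ℝ (F i) X) :
    euler (fun Y => ∑ i ∈ s, F i Y) X = ∑ i ∈ s, euler (F i) X := dir_sum s hF X

lemma dir_eq_sum (f : Space n → ℝ) (X v : Space n) :
    dir v f X = ∑ i, v i * dir (basisVec i) f X := by
  have h : v = ∑ i, v i • basisVec i := by
    ext j
    simp [Finset.sum_apply, Pi.single_apply]
  conv_lhs => rw [h]
  simp [dir, map_sum]

lemma dir_height_rpow (δ : ℝ) {X : Space n} (hX : X ∈ upperHalf n) (v : Space n) :
    dir v (fun Y : Space n => height Y ^ δ) X = δ * height X ^ (δ - 1) * height v := by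
  have h := (hasFDerivAt_height X).rpow_const (p := δ) (Or.inl (ne_of_gt hX))
  rw [dir, h.fderiv]
  rfl

lemma dir_div_height (c : ℝ) {X : Space n} (hX : X ∈ upperHalf n) (v : Space n) :
    dir v (fun Y : Space n => c / height Y) X = - (c / height X ^ 2) * height v := by
  have hX' : height X ≠ 0 := ne_of_gt hX
  have h := ((hasDerivAt_inv hX').const_mul c).comp_hasFDerivAt X (hasFDerivAt_height X)
  have h' : HasFDerivAt (fun Y : Space n => c / height Y) _ X := h
  rw [dir, h'.fderiv]
  show c * -(height X ^ 2)⁻¹ * height v = _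
  ring

lemma dir_normSq (X v : Space n) : dir v (fun Y : Space n => ‖Y‖ ^ 2) X = 2 * inner ℝ X v := by
  have h : HasFDerivAt (fun Y : Space n => ‖Y‖ ^ 2) _ X := (hasStrictFDerivAt_norm_sq X).hasFDerivAt
  simp [dir, h.fderiv]

lemma euler_height_rpow (δ : ℝ) {X : Space n} (hX : X ∈ upperHalf n) :
    euler (fun Y : Space n => height Y ^ δ) X = δ * height X ^ δ := by
  rw [euler_eq_dir, dir_height_rpow δ hX, mul_assoc, ← Real.rpow_add_one (ne_of_gt hX)]
  simp

lemma euler_normSq (X : Space n) : euler (fun Y : Space n => ‖Y‖ ^ 2) X = 2 * ‖X‖ ^ 2 := by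
  rw [euler_eq_dir, dir_normSq, real_inner_self_eq_norm_sq]

lemma laplacian_eq_sum {f : Space n → ℝ} (hf : SmoothUpper 2 f) {X : Space n}
    (hX : X ∈ upperHalf n) :
    Laplacian.laplacian f X = ∑ i, dir (basisVec i) (dir (basisVec i) f) X := by
  rw [InnerProductSpace.laplacian_eq_iteratedFDeriv_orthonormalBasis f
    (EuclideanSpace.basisFun (Fin (n + 1)) ℝ)]
  refine Finset.sum_congr rfl fun i _ => ?_
  rw [iteratedFDeriv_two_apply]
  simp only [EuclideanSpace.basisFun_apply, Matrix.cons_val_zero, Matrix.cons_val_one]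
  exact (fderiv_dir hf hX _ _).symm

lemma weightedLaplacian_eq (b : ℝ) {f : Space n → ℝ} (hf : SmoothUpper 2 f) {X : Space n}
    (hX : X ∈ upperHalf n) :
    weightedLaplacian b f X = ∑ i, dir (basisVec i) (dir (basisVec i) f) X
      + b / height X * dir (basisVec (Fin.last n)) f X := by
  rw [weightedLaplacian, laplacian_eq_sum hf hX, partialY_eq_dir]

lemma weightedLaplacian_congr (b : ℝ) {f g : Space n → ℝ} (h : EqOn f g (upperHalf n)) :
    EqOn (weightedLaplacian b f) (weightedLaplacian b g) (upperHalf n) := fun X hX => by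
  have h' := eventuallyEq_of_eqOn h hX
  simp only [weightedLaplacian, partialY, h'.fderiv_eq]
  rw [(InnerProductSpace.laplacian_congr_nhds h').eq_of_nhds]

lemma SmoothUpper.weightedLaplacian {m : ℕ} (b : ℝ) {f : Space n → ℝ}
    (hf : SmoothUpper (m + 2) f) : SmoothUpper m (weightedLaplacian b f) := by
  refine SmoothUpper.congr (f := fun X => ∑ i, LaneEmden.dir (basisVec i)
    (LaneEmden.dir (basisVec i) f) X + b / height X * LaneEmden.dir (basisVec (Fin.last n)) f X)
    (.add (.sum _ fun i _ => ?_) (.mul (smoothUpper_height_inv m b) ?_))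
    fun X hX => weightedLaplacian_eq b (hf.mono (by omega)) hX
  · exact SmoothUpper.dir (SmoothUpper.dir hf _) _
  · exact (SmoothUpper.dir (m := m + 1) hf _).mono (by omega)

/-- The coefficient b / y is constant in tangential directions, so only the symmetry of mixed
derivatives is needed. -/
lemma weightedLaplacian_dir (b : ℝ) {f : Space n → ℝ} (hf : SmoothUpper 3 f) {v : Space n}
    (hv : height v = 0) :
    EqOn (weightedLaplacian b (dir v f)) (dir v (weightedLaplacian b f)) (upperHalf n) := by
  intro X hX
  have hd : ∀ w, SmoothUpper 2 (dir w f) := fun w => SmoothUpper.dir hf w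
  have hdd : ∀ w w', SmoothUpper 1 (dir w (dir w' f)) := fun w w' => SmoothUpper.dir (hd w') w
  have hdif : ∀ w w', DifferentiableAt ℝ (dir w (dir w' f)) X :=
    fun w w' => (hdd w w').differentiableAt le_rfl hX
  have hi : DifferentiableAt ℝ (fun Y : Space n => b / height Y) X :=
    (smoothUpper_height_inv 1 b).differentiableAt le_rfl hX
  have hy := (hd (basisVec (Fin.last n))).differentiableAt (by norm_num) hX
  rw [weightedLaplacian_eq b (hd v) hX, dir_congr (g := fun X => ∑ i, dir (basisVec i)
    (dir (basisVec i) f) X + b / height X * dir (basisVec (Fin.last n)) f X)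
    (fun Y hY => weightedLaplacian_eq b (hf.mono (by norm_num)) hY) v hX,
    dir_add (DifferentiableAt.fun_sum fun i _ => hdif _ _) (hi.fun_mul hy),
    dir_sum _ (fun i _ => hdif _ _), dir_mul hi hy, dir_div_height b hX, hv]
  have h2 : ∀ w w', dir w (dir w' f) X = dir w' (dir w f) X :=
    fun w w' => dir_comm (hf.mono (by norm_num)) w w' hX
  have h3 : ∀ i, dir v (dir (basisVec i) (dir (basisVec i) f)) X
      = dir (basisVec i) (dir (basisVec i) (dir v f)) X := fun i => by
    rw [dir_comm (hd _) _ _ hX]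
    exact dir_congr (dir_comm (hf.mono (by norm_num)) _ _) _ hX
  simp only [h3, h2 v]
  ring

/-- `[Δ_b, X · ∇] = 2 Δ_b`. -/
lemma weightedLaplacian_euler (b : ℝ) {f : Space n → ℝ} (hf : SmoothUpper 3 f) :
    EqOn (weightedLaplacian b (euler f))
      (fun X => euler (weightedLaplacian b f) X + 2 * weightedLaplacian b f X)
      (upperHalf n) := by
  intro X hX
  have hd : ∀ w, SmoothUpper 2 (dir w f) := fun w => SmoothUpper.dir hf w
  have hdd : ∀ w w', SmoothUpper 1 (dir w (dir w' f)) := fun w w' => SmoothUpper.dir (hd w') w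
  have hdif : ∀ w w', DifferentiableAt ℝ (dir w (dir w' f)) X :=
    fun w w' => (hdd w w').differentiableAt le_rfl hX
  have hi : DifferentiableAt ℝ (fun Y : Space n => b / height Y) X :=
    (smoothUpper_height_inv 1 b).differentiableAt le_rfl hX
  have hy := (hd (basisVec (Fin.last n))).differentiableAt (by norm_num) hX
  have hyX : height X ≠ 0 := ne_of_gt hX
  have hee : SmoothUpper 2 (euler f) := SmoothUpper.euler hf
  show weightedLaplacian b (euler f) X = euler (weightedLaplacian b f) X + _
  rw [weightedLaplacian_eq b hee hX, euler_congr (g := fun X => ∑ i, dir (basisVec i)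
    (dir (basisVec i) f) X + b / height X * dir (basisVec (Fin.last n)) f X)
    (fun Y hY => weightedLaplacian_eq b (hf.mono (by norm_num)) hY) hX,
    euler_add (DifferentiableAt.fun_sum fun i _ => hdif _ _) (hi.fun_mul hy),
    euler_sum _ (fun i _ => hdif _ _), euler_mul hi hy, euler_eq_dir (fun Y => b / height Y),
    dir_div_height b hX, weightedLaplacian_eq b (hf.mono (by norm_num)) hX,
    dir_euler (hf.mono (by norm_num)) _ hX]
  have h3 : ∀ i, dir (basisVec i) (dir (basisVec i) (euler f)) X
      = euler (dir (basisVec i) (dir (basisVec i) f)) X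
        + 2 * dir (basisVec i) (dir (basisVec i) f) X := fun i => by
    rw [dir_congr (dir_euler (hf.mono (by norm_num)) _) _ hX,
      dir_add ((SmoothUpper.euler (hd _)).differentiableAt le_rfl hX)
        ((hd _).differentiableAt (by norm_num) hX), dir_euler (hd _) _ hX]
    ring
  simp only [h3, Finset.sum_add_distrib, ← Finset.mul_sum]
  field_simp
  ring

/-- The conormal derivative `yᵇ ∂_y f`. -/
def conormal (b : ℝ) (f : Space n → ℝ) (X : Space n) : ℝ := height X ^ b * partialY f X

lemma SmoothUpper.conormal {m : ℕ} (b : ℝ) {f : Space n → ℝ} (hf : SmoothUpper (m + 1) f) :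
    SmoothUpper m (conormal b f) :=
  .mul (smoothUpper_height_rpow m b) (SmoothUpper.dir hf _)

/-- The operator y^b ∂_y lowers the degree of homogeneity by 1 - b, which is therefore the factor in
its commutator with X · ∇. -/
lemma conormal_euler (b : ℝ) {f : Space n → ℝ} (hf : SmoothUpper 2 f) :
    EqOn (conormal b (euler f)) (fun X => euler (conormal b f) X + (1 - b) * conormal b f X)
      (upperHalf n) := by
  intro X hX
  have h : euler (conormal b f) X = _ :=
    euler_mul ((smoothUpper_height_rpow 1 b).differentiableAt le_rfl hX)
      ((SmoothUpper.dir hf (basisVec (Fin.last n))).differentiableAt le_rfl hX)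
  simp only [h, euler_height_rpow b hX]
  simp only [conormal, partialY_eq_dir, dir_euler hf _ hX]
  ring

lemma dir_conormal (b : ℝ) {f : Space n → ℝ} (hf : SmoothUpper 2 f) {v : Space n}
    (hv : height v = 0) :
    EqOn (dir v (conormal b f)) (conormal b (dir v f)) (upperHalf n) := by
  intro X hX
  have h : dir v (conormal b f) X = _ :=
    dir_mul ((smoothUpper_height_rpow 1 b).differentiableAt le_rfl hX)
      ((SmoothUpper.dir hf (basisVec (Fin.last n))).differentiableAt le_rfl hX) v
  rw [h, dir_height_rpow b hX, hv, conormal, partialY_eq_dir, dir_comm hf _ _ hX]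
  ring

lemma height_basisVec_castSucc (i : Fin n) : height (basisVec i.castSucc) = 0 := by
  simp [height, Fin.ext_iff, i.isLt.ne']

lemma height_basisVec_last : height (basisVec (Fin.last n)) = 1 := by
  simp [height]

lemma euler_eq_sum (f : Space n → ℝ) (X : Space n) :
    euler f X = (∑ i : Fin n, X i.castSucc * dir (basisVec i.castSucc) f X)
      + height X * dir (basisVec (Fin.last n)) f X := by
  rw [euler_eq_dir, dir_eq_sum, Fin.sum_univ_castSucc]
  rfl

/-- `X · ∇ (yᵇ ∂_y f)` in terms of `yᵇ ∂_y ∂_i f`, `Δ_b f` and `∂_i ∂_i f`. -/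
lemma euler_conormal (b : ℝ) {f : Space n → ℝ} (hf : SmoothUpper 2 f) :
    EqOn (euler (conormal b f)) (fun X =>
      (∑ i : Fin n, X i.castSucc * conormal b (partialX i f) X)
        + height X ^ (b + 1) * (weightedLaplacian b f X
          + (-1) * ∑ i : Fin n, partialX i (partialX i f) X)) (upperHalf n) := by
  intro X hX
  -- ∂_y (y^b ∂_y f) is y^b times the normal part of Δ_b f. Solving for it trades a second normal
  -- derivative, uncontrolled at the boundary, for Δ_b f and tangential derivatives.
  have h : dir (basisVec (Fin.last n)) (conormal b f) X = _ :=
    dir_mul ((smoothUpper_height_rpow 1 b).differentiableAt le_rfl hX)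
      ((SmoothUpper.dir hf (basisVec (Fin.last n))).differentiableAt le_rfl hX) _
  have hX' : 0 < height X := hX
  rw [euler_eq_sum, h, dir_height_rpow b hX, height_basisVec_last]
  simp only [partialX_eq_dir, weightedLaplacian_eq b hf hX,
    Fin.sum_univ_castSucc]
  simp only [fun i : Fin n => dir_conormal b hf (height_basisVec_castSucc i) hX]
  rw [Real.rpow_add_one hX'.ne', Real.rpow_sub_one hX'.ne']
  field_simp
  ring

end LaneEmden
end

/-! ### Continuous extension to the boundary and its stability under the Euler operator. -/

noncomputable section

namespace LaneEmden

open Set Filter Topology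

variable {n : ℕ}

namespace ExtendsContinuously

variable {f g : Space n → ℝ}

lemma congr (hf : ExtendsContinuously f) (h : EqOn g f (upperHalf n)) : ExtendsContinuously g := by
  obtain ⟨F, hF, hFf⟩ := hf
  exact ⟨F, hF, fun X hX => (hFf hX).trans (h hX).symm⟩

lemma of_continuousOn (hf : ContinuousOn f (closedUpperHalf n)) : ExtendsContinuously f :=
  ⟨f, hf, fun _ _ => rfl⟩

lemma add (hf : ExtendsContinuously f) (hg : ExtendsContinuously g) :
    ExtendsContinuously (fun X => f X + g X) := by
  obtain ⟨F, hF, hFf⟩ := hf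
  obtain ⟨G, hG, hGg⟩ := hg
  exact ⟨fun X => F X + G X, hF.add hG, fun X hX => by simp only [hFf hX, hGg hX]⟩

lemma mul (hf : ExtendsContinuously f) (hg : ExtendsContinuously g) :
    ExtendsContinuously (fun X => f X * g X) := by
  obtain ⟨F, hF, hFf⟩ := hf
  obtain ⟨G, hG, hGg⟩ := hg
  exact ⟨fun X => F X * G X, hF.mul hG, fun X hX => by simp only [hFf hX, hGg hX]⟩

lemma const_mul (c : ℝ) (hf : ExtendsContinuously f) : ExtendsContinuously (fun X => c * f X) :=
  mul (of_continuousOn continuousOn_const) hf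

end ExtendsContinuously

lemma extendsContinuously_height_rpow {δ : ℝ} (hδ : 0 ≤ δ) :
    ExtendsContinuously (fun X : Space n => height X ^ δ) :=
  .of_continuousOn ((continuous_height.continuousOn).rpow_const fun _ _ => Or.inr hδ)

lemma extendsContinuously_normSq : ExtendsContinuously (fun X : Space n => ‖X‖ ^ 2) :=
  .of_continuousOn (continuous_norm.pow 2).continuousOn

lemma SmoothUpper.iterPartialX {m : ℕ} (α : List (Fin n)) {f : Space n → ℝ}
    (hf : SmoothUpper (m + α.length) f) : SmoothUpper m (iterPartialX α f) := by
  induction α generalizing m with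
  | nil => exact hf
  | cons i α ih =>
    exact SmoothUpper.dir (ih (hf.mono (by simp only [List.length_cons]; omega))) _

lemma SmoothUpper.weightedLaplacian_iterate (b : ℝ) (j : ℕ) {m : ℕ} {f : Space n → ℝ}
    (hf : SmoothUpper (m + 2 * j) f) : SmoothUpper m ((LaneEmden.weightedLaplacian b)^[j] f) := by
  induction j generalizing m with
  | zero => exact hf
  | succ j ih =>
    rw [Function.iterate_succ_apply']
    exact SmoothUpper.weightedLaplacian b (ih (hf.mono (by omega)))

lemma weightedLaplacian_iterPartialX (b : ℝ) (α : List (Fin n)) {f : Space n → ℝ}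
    (hf : SmoothUpper (α.length + 2) f) :
    EqOn (weightedLaplacian b (iterPartialX α f)) (iterPartialX α (weightedLaplacian b f))
      (upperHalf n) := by
  induction α with
  | nil => exact fun _ _ => rfl
  | cons i α ih =>
    have hlen : (i :: α).length = α.length + 1 := rfl
    refine EqOn.trans (weightedLaplacian_dir b (f := iterPartialX α f) ?_
      (height_basisVec_castSucc i)) (dir_congr (ih (hf.mono (by omega))) _)
    exact SmoothUpper.iterPartialX α (hf.mono (by omega))

/-- The regularity of a classical solution up to the boundary. -/
structure RegularUpper (b : ℝ) (u : Space n → ℝ) : Prop where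
  smooth : SmoothUpper 6 u
  tangential : ∀ (j : ℕ) (α : List (Fin n)), j ≤ 2 → α.length + 2 * j ≤ 5 →
    ExtendsContinuously (iterPartialX α ((weightedLaplacian b)^[j] u))
  conormal : ∀ (j : ℕ) (α : List (Fin n)), j ≤ 2 → α.length + 2 * j + 1 ≤ 5 →
    ExtendsContinuously (conormal b (iterPartialX α ((weightedLaplacian b)^[j] u)))

/-- Functions generated by tangential and conormal derivatives of `Δ_bʲ u` of total order `≤ m`,
multiplied by tangential coordinates and nonnegative powers of the height. -/
inductive Generated (b : ℝ) (u : Space n → ℝ) (m : ℕ) : (Space n → ℝ) → Prop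
  | tangential (j : ℕ) (α : List (Fin n)) (hj : j ≤ 2) (hm : α.length + 2 * j ≤ m) :
      Generated b u m (iterPartialX α ((weightedLaplacian b)^[j] u))
  | conormal (j : ℕ) (α : List (Fin n)) (hj : j ≤ 2) (hm : α.length + 2 * j + 1 ≤ m) :
      Generated b u m (conormal b (iterPartialX α ((weightedLaplacian b)^[j] u)))
  | add {f g : Space n → ℝ} (hf : Generated b u m f) (hg : Generated b u m g) :
      Generated b u m (fun X => f X + g X)
  | const_mul (c : ℝ) {f : Space n → ℝ} (hf : Generated b u m f) :
      Generated b u m (fun X => c * f X)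
  | coord (i : Fin n) {f : Space n → ℝ} (hf : Generated b u m f) :
      Generated b u m (fun X => X i.castSucc * f X)
  | height_rpow (δ : ℝ) (hδ : 0 ≤ δ) {f : Space n → ℝ} (hf : Generated b u m f) :
      Generated b u m (fun X => height X ^ δ * f X)
  | congr {f g : Space n → ℝ} (hf : Generated b u m f) (h : EqOn g f (upperHalf n)) :
      Generated b u m g

lemma contDiff_coord {k : WithTop ℕ∞} (i : Fin (n + 1)) : ContDiff ℝ k (fun X : Space n => X i) :=
  (EuclideanSpace.proj i : Space n →L[ℝ] ℝ).contDiff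

lemma dir_coord (i : Fin (n + 1)) (X v : Space n) : dir v (fun Y : Space n => Y i) X = v i := by
  rw [dir]
  erw [(EuclideanSpace.proj i : Space n →L[ℝ] ℝ).fderiv]
  rfl

namespace Generated

variable {b : ℝ} {u : Space n → ℝ}

lemma mono {m m' : ℕ} (h : m ≤ m') {f : Space n → ℝ} (hf : Generated b u m f) :
    Generated b u m' f := by
  induction hf with
  | tangential j α hj hm => exact .tangential j α hj (hm.trans h)
  | conormal j α hj hm => exact .conormal j α hj (hm.trans h)
  | add _ _ ihf ihg => exact .add ihf ihg
  | const_mul c _ ih => exact .const_mul c ih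
  | coord i _ ih => exact .coord i ih
  | height_rpow δ hδ _ ih => exact .height_rpow δ hδ ih
  | congr _ h ih => exact .congr ih h

lemma sum {m : ℕ} {ι : Type*} (s : Finset ι) {F : ι → Space n → ℝ}
    (hF : ∀ i ∈ s, Generated b u m (F i)) : Generated b u m (fun X => ∑ i ∈ s, F i X) := by
  classical
  induction s using Finset.induction_on with
  | empty =>
    exact (const_mul 0 (.tangential 0 [] (by norm_num) (Nat.zero_le m))).congr fun X _ => by simp
  | insert a s ha ih =>
    refine ((hF a (Finset.mem_insert_self a s)).add
      (ih fun i hi => hF i (Finset.mem_insert_of_mem hi))).congr fun X _ => ?_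
    simp [Finset.sum_insert ha]

lemma normSq_mul {m : ℕ} {f : Space n → ℝ} (hf : Generated b u m f) :
    Generated b u m (fun X => ‖X‖ ^ 2 * f X) := by
  refine ((sum Finset.univ fun (i : Fin n) _ => (hf.coord i).coord i).add
    (hf.height_rpow 2 (by norm_num))).congr fun X _ => ?_
  simp only [EuclideanSpace.norm_sq_eq, Fin.sum_univ_castSucc, Real.norm_eq_abs, sq_abs,
    add_mul, Finset.sum_mul, Real.rpow_two, height]
  congr 1
  exact Finset.sum_congr rfl fun i _ => by ring

variable (hu : RegularUpper b u)
include hu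

lemma smooth {m : ℕ} (hm : m ≤ 5) {f : Space n → ℝ} (hf : Generated b u m f) :
    SmoothUpper (6 - m) f := by
  induction hf with
  | tangential j α hj hm' =>
    exact SmoothUpper.iterPartialX α
      (SmoothUpper.weightedLaplacian_iterate b j (hu.smooth.mono (by omega)))
  | conormal j α hj hm' =>
    exact SmoothUpper.conormal b (SmoothUpper.iterPartialX α
      (SmoothUpper.weightedLaplacian_iterate b j (hu.smooth.mono (by omega))))
  | add _ _ ihf ihg => exact .add ihf ihg
  | const_mul c _ ih => exact .const_mul c ih
  | coord i _ ih => exact .mul (.of_contDiff (contDiff_coord _)) ih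
  | height_rpow δ hδ _ ih => exact .mul (smoothUpper_height_rpow _ δ) ih
  | congr _ h ih => exact ih.congr h

lemma extendsContinuously {m : ℕ} (hm : m ≤ 5) {f : Space n → ℝ} (hf : Generated b u m f) :
    ExtendsContinuously f := by
  induction hf with
  | tangential j α hj hm' => exact hu.tangential j α hj (hm'.trans hm)
  | conormal j α hj hm' => exact hu.conormal j α hj (hm'.trans hm)
  | add _ _ ihf ihg => exact .add ihf ihg
  | const_mul c _ ih => exact .const_mul c ih
  | coord i _ ih => exact .mul (.of_continuousOn (contDiff_coord (k := 0) _).continuous.continuousOn) ih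
  | height_rpow δ hδ _ ih => exact .mul (extendsContinuously_height_rpow hδ) ih
  | congr _ h ih => exact ih.congr h

lemma differentiableAt {m : ℕ} (hm : m ≤ 5) {f : Space n → ℝ} (hf : Generated b u m f)
    {X : Space n} (hX : X ∈ upperHalf n) : DifferentiableAt ℝ f X :=
  (hf.smooth hu hm).differentiableAt (by omega) hX

/-- This closure property dictates the choice of generators. On a tangential generator the normal
part of X · ∇ is y ∂_y = y^{1-b} (y^b ∂_y); on a conormal one `euler_conormal` produces the factor
y^{b+1}. Both powers are nonnegative because |b| < 1. -/
lemma euler (hb : -1 < b) (hb' : b < 1) {m : ℕ} (hm : m ≤ 4) {f : Space n → ℝ}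
    (hf : Generated b u m f) : Generated b u (m + 1) (euler f) := by
  induction hf with
  | tangential j α hj hm' =>
    have hc := (Generated.conormal (b := b) (u := u) j α hj (m := m + 1)
      (by omega)).height_rpow (1 - b) (by linarith)
    refine ((sum Finset.univ fun (i : Fin n) _ =>
      (Generated.tangential (b := b) (u := u) j (i :: α) hj (m := m + 1)
        (by simp only [List.length_cons]; omega)).coord i).add hc).congr fun X hX => ?_
    rw [euler_eq_sum]
    congr 1
    have hX' : 0 < height X := hX
    rw [LaneEmden.conormal, ← mul_assoc, ← Real.rpow_add hX', partialY_eq_dir]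
    simp
  | conormal j α hj hm' =>
    -- A conormal generator of order at most four has 2 j + 1 ≤ 4, hence j ≤ 1, and one more Δ_b
    -- stays within the generators.
    have hj' : j + 1 ≤ 2 := by omega
    have hG : SmoothUpper 2 (iterPartialX α ((weightedLaplacian b)^[j] u)) :=
      SmoothUpper.iterPartialX α
        (SmoothUpper.weightedLaplacian_iterate b j (hu.smooth.mono (by omega)))
    refine ((sum Finset.univ fun (i : Fin n) _ =>
      (Generated.conormal (b := b) (u := u) j (i :: α) hj (m := m + 1)
        (by simp only [List.length_cons]; omega)).coord i).add
      (((Generated.tangential (b := b) (u := u) (j + 1) α hj' (m := m + 1) (by omega)).add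
        ((sum Finset.univ fun (i : Fin n) _ =>
          (Generated.tangential (b := b) (u := u) j (i :: i :: α) hj (m := m + 1)
            (by simp only [List.length_cons]; omega))).const_mul (-1))).height_rpow (b + 1)
        (by linarith))).congr fun X hX => ?_
    refine (euler_conormal b hG hX).trans ?_
    have h := weightedLaplacian_iterPartialX b α (f := (weightedLaplacian b)^[j] u)
      (SmoothUpper.weightedLaplacian_iterate b j (hu.smooth.mono (by omega))) hX
    rw [← Function.iterate_succ_apply' (weightedLaplacian b) j u] at h
    simp only [h]
    rfl
  | add hf hg ihf ihg =>
    exact (ihf.add ihg).congr fun X hX => euler_add (hf.differentiableAt hu (by omega) hX)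
      (hg.differentiableAt hu (by omega) hX)
  | const_mul c hf ih =>
    exact (ih.const_mul c).congr fun X hX =>
      euler_const_mul (hf.differentiableAt hu (by omega) hX) c
  | coord i hf ih =>
    refine ((ih.coord i).add ((hf.mono (Nat.le_succ m)).coord i)).congr fun X hX => ?_
    rw [euler_mul ((contDiff_coord (k := 1) _).differentiable (by norm_num) X)
      (hf.differentiableAt hu (by omega) hX), euler_eq_dir (fun Y : Space n => Y i.castSucc),
      dir_coord]
  | height_rpow δ hδ hf ih =>
    refine ((ih.height_rpow δ hδ).add
      (((hf.mono (Nat.le_succ m)).height_rpow δ hδ).const_mul δ)).congr fun X hX => ?_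
    rw [euler_mul ((smoothUpper_height_rpow 1 δ).differentiableAt le_rfl hX)
      (hf.differentiableAt hu (by omega) hX), euler_height_rpow δ hX, mul_assoc]
  | congr _ h ih => exact ih.congr (euler_congr h)

end Generated

end LaneEmden
end

/-! ### Translation along the boundary, and traces on the boundary. -/

noncomputable section

namespace LaneEmden

open Set Filter Topology

variable {n : ℕ}

section Translation

variable (c : Space n)

/-- The translate `X ↦ f (c + X)`. -/
def translate (f : Space n → ℝ) (X : Space n) : ℝ := f (c + X)

lemma dir_translate (v : Space n) (f : Space n → ℝ) :
    dir v (translate c f) = translate c (dir v f) := by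
  ext X
  show fderiv ℝ (fun Y => f (c + Y)) X v = fderiv ℝ f (c + X) v
  rw [fderiv_comp_add_left]

lemma iterPartialX_translate (α : List (Fin n)) (f : Space n → ℝ) :
    iterPartialX α (translate c f) = translate c (iterPartialX α f) := by
  induction α with
  | nil => rfl
  | cons i α ih =>
    show partialX i (iterPartialX α (translate c f)) = _
    rw [ih]
    exact dir_translate c _ _

lemma weightedLaplacian_translate (hc : height c = 0) (b : ℝ) (f : Space n → ℝ) :
    weightedLaplacian b (translate c f) = translate c (weightedLaplacian b f) := by
  ext X
  simp only [weightedLaplacian, partialY_eq_dir, dir_translate]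
  have h : height (c + X) = height X := by rw [height_add, hc, zero_add]
  show _ = Laplacian.laplacian f (c + X) + b / height (c + X) * dir _ f (c + X)
  rw [h]
  congr 1
  simp only [InnerProductSpace.laplacian_eq_iteratedFDeriv_stdOrthonormalBasis]
  show ∑ i, (iteratedFDeriv ℝ 2 (fun Y => f (c + Y)) X) _ = _
  rw [iteratedFDeriv_comp_add_left]

lemma weightedLaplacian_iterate_translate (hc : height c = 0) (b : ℝ) (j : ℕ) (f : Space n → ℝ) :
    (weightedLaplacian b)^[j] (translate c f) = translate c ((weightedLaplacian b)^[j] f) := by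
  induction j with
  | zero => rfl
  | succ j ih => rw [Function.iterate_succ_apply', Function.iterate_succ_apply', ih,
      weightedLaplacian_translate c hc]

variable {c}

lemma add_mem_upperHalf (hc : height c = 0) {X : Space n} (hX : X ∈ upperHalf n) :
    c + X ∈ upperHalf n := by
  show 0 < height (c + X)
  rw [height_add, hc, zero_add]
  exact hX

lemma add_mem_closedUpperHalf (hc : height c = 0) {X : Space n} (hX : X ∈ closedUpperHalf n) :
    c + X ∈ closedUpperHalf n := by
  show 0 ≤ height (c + X)
  rw [height_add, hc, zero_add]
  exact hX

lemma ContinuousOn.translate (hc : height c = 0) {f : Space n → ℝ}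
    (hf : ContinuousOn f (closedUpperHalf n)) :
    ContinuousOn (translate c f) (closedUpperHalf n) :=
  hf.comp (continuous_const.add continuous_id).continuousOn
    fun _ hX => add_mem_closedUpperHalf hc hX

lemma ExtendsContinuously.translate (hc : height c = 0) {f : Space n → ℝ}
    (hf : ExtendsContinuously f) : ExtendsContinuously (translate c f) := by
  obtain ⟨F, hF, hFf⟩ := hf
  exact ⟨LaneEmden.translate c F, ContinuousOn.translate hc hF,
    fun X hX => hFf (add_mem_upperHalf hc hX)⟩

end Translation

lemma height_point (x : EuclideanSpace ℝ (Fin n)) (y : ℝ) : height (point x y) = y := by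
  simp [height, point]

lemma point_add (x x' : EuclideanSpace ℝ (Fin n)) (y y' : ℝ) :
    point x y + point x' y' = point (x + x') (y + y') := by
  ext i
  refine Fin.lastCases ?_ (fun i => ?_) i <;> simp [point]

lemma smul_point (t : ℝ) (x : EuclideanSpace ℝ (Fin n)) (y : ℝ) :
    t • point x y = point (t • x) (t * y) := by
  ext i
  refine Fin.lastCases ?_ (fun i => ?_) i <;> simp [point]

lemma continuous_point : Continuous fun q : EuclideanSpace ℝ (Fin n) × ℝ => point q.1 q.2 := by
  refine (PiLp.continuous_toLp 2 _).comp (continuous_pi fun i => ?_)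
  refine Fin.lastCases ?_ (fun i => ?_) i
  · simpa using continuous_snd
  · simp only [Fin.snoc_castSucc]
    exact (EuclideanSpace.proj i : EuclideanSpace ℝ (Fin n) →L[ℝ] ℝ).continuous.comp
      continuous_fst

lemma norm_point_sq (x : EuclideanSpace ℝ (Fin n)) (y : ℝ) :
    ‖point x y‖ ^ 2 = ‖x‖ ^ 2 + y ^ 2 := by
  simp [EuclideanSpace.norm_sq_eq, Fin.sum_univ_castSucc, point]

lemma norm_point_zero (x : EuclideanSpace ℝ (Fin n)) : ‖point x 0‖ = ‖x‖ := by
  rw [← sq_eq_sq₀ (norm_nonneg _) (norm_nonneg _), norm_point_sq]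
  ring

lemma point_mem_upperHalf (x : EuclideanSpace ℝ (Fin n)) {y : ℝ} (hy : 0 < y) :
    point x y ∈ upperHalf n := by
  show 0 < height _
  rwa [height_point]

lemma point_mem_closedUpperHalf (x : EuclideanSpace ℝ (Fin n)) {y : ℝ} (hy : 0 ≤ y) :
    point x y ∈ closedUpperHalf n := by
  show 0 ≤ height _
  rwa [height_point]

/-- Translates along the boundary of solutions of the extension problem are solutions. -/
lemma IsExtensionSolution.translate {s p κ : ℝ} {u : Space n → ℝ}
    (hu : IsExtensionSolution s p κ u) (x₀ : EuclideanSpace ℝ (Fin n)) :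
    IsExtensionSolution s p κ (translate (point x₀ 0) u) := by
  have hc : height (point x₀ 0) = 0 := height_point x₀ 0
  have hadd : ∀ x y, point x₀ 0 + point x y = point (x₀ + x) y := fun x y => by
    rw [point_add, zero_add]
  have hpY : ∀ f : Space n → ℝ, partialY (LaneEmden.translate (point x₀ 0) f)
      = LaneEmden.translate (point x₀ 0) (partialY f) := fun f => dir_translate _ _ f
  constructor
  · exact hu.contDiffOn.comp (contDiff_const.add contDiff_id).contDiffOn
      fun _ hX => add_mem_upperHalf hc hX
  · exact ContinuousOn.translate hc hu.continuousOn
  · intro j α hj hm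
    rw [weightedLaplacian_iterate_translate _ hc, iterPartialX_translate]
    exact (hu.tangential j α hj hm).translate hc
  · intro j α hj hm
    rw [weightedLaplacian_iterate_translate _ hc, iterPartialX_translate, hpY]
    have h := (hu.conormal j α hj hm).translate hc
    refine h.congr fun X _ => ?_
    simp only [LaneEmden.translate, height_add, hc, zero_add]
  · intro X hX
    rw [weightedLaplacian_iterate_translate _ hc]
    exact hu.equation _ (add_mem_upperHalf hc hX)
  · intro x
    rw [hpY]
    simp only [LaneEmden.translate, hadd]
    exact hu.boundary_zero _
  · intro x
    rw [weightedLaplacian_translate _ hc, hpY]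
    simp only [LaneEmden.translate, hadd]
    exact hu.boundary_one _
  · intro x
    rw [weightedLaplacian_iterate_translate _ hc, hpY]
    simp only [LaneEmden.translate, hadd]
    exact hu.boundary_two _

lemma IsExtensionSolution.regularUpper {s p κ : ℝ} {u : Space n → ℝ}
    (hu : IsExtensionSolution s p κ u) : RegularUpper (5 - 2 * s) u :=
  ⟨hu.contDiffOn, hu.tangential, hu.conormal⟩

/-- `f` tends to zero along vertical lines at the boundary. -/
def VanishesOnBoundary (f : Space n → ℝ) : Prop :=
  ∀ x : EuclideanSpace ℝ (Fin n),
    Tendsto (fun y : ℝ => f (point x y)) (𝓝[>] 0) (𝓝 0)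

lemma tendsto_point (x : EuclideanSpace ℝ (Fin n)) {F : Space n → ℝ}
    (hF : ContinuousOn F (closedUpperHalf n)) :
    Tendsto (fun y : ℝ => F (point x y)) (𝓝[>] 0) (𝓝 (F (point x 0))) := by
  have h : ContinuousWithinAt (fun y : ℝ => F (point x y)) (Ici 0) 0 :=
    (hF (point x 0) (point_mem_closedUpperHalf x le_rfl)).comp
      (continuous_point.comp (by fun_prop : Continuous fun y : ℝ => (x, y))).continuousWithinAt
      fun y hy => point_mem_closedUpperHalf x hy
  exact h.mono Ioi_subset_Ici_self

lemma tendsto_point_of_eqOn (x : EuclideanSpace ℝ (Fin n)) {f F : Space n → ℝ}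
    (hF : ContinuousOn F (closedUpperHalf n)) (h : EqOn F f (upperHalf n)) :
    Tendsto (fun y : ℝ => f (point x y)) (𝓝[>] 0) (𝓝 (F (point x 0))) := by
  refine (tendsto_point x hF).congr' ?_
  filter_upwards [self_mem_nhdsWithin] with y hy
  exact h (point_mem_upperHalf x hy)

lemma hasDerivAt_ray {f : Space n → ℝ} {X : Space n} {t : ℝ} (ht : t ≠ 0)
    (hf : DifferentiableAt ℝ f (t • X)) :
    HasDerivAt (fun τ : ℝ => f (τ • X)) (euler f (t • X) / t) t := by
  have h := hf.hasFDerivAt.comp_hasDerivAt t ((hasDerivAt_id t).smul_const X)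
  have e : euler f (t • X) / t = fderiv ℝ f (t • X) X := by
    rw [euler, map_smul, smul_eq_mul, mul_div_cancel_left₀ _ ht]
  rw [e]
  simp only [one_smul] at h
  exact h

/-- The continuous extension to the boundary is differentiable along boundary rays, its Euler
derivative being the extension of the Euler derivative. -/
lemma trace_sub_eq_integral {f F G : Space n → ℝ} (hf : SmoothUpper 1 f)
    (hF : ContinuousOn F (closedUpperHalf n)) (hFf : EqOn F f (upperHalf n))
    (hG : ContinuousOn G (closedUpperHalf n)) (hGf : EqOn G (euler f) (upperHalf n))
    (x : EuclideanSpace ℝ (Fin n)) {a c : ℝ} (ha : 0 < a) (hac : a ≤ c) :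
    F (point (c • x) 0) - F (point (a • x) 0) = ∫ t in a..c, G (point (t • x) 0) / t := by
  have hcont : ContinuousOn (fun q : ℝ × ℝ => G (point (q.2 • x) (q.2 * q.1)) / q.2)
      (Ici 0 ×ˢ Icc a c) := by
    refine ContinuousOn.div (hG.comp ?_ ?_) continuous_snd.continuousOn ?_
    · exact (continuous_point.comp (by fun_prop : Continuous fun q : ℝ × ℝ =>
        (q.2 • x, q.2 * q.1))).continuousOn
    · rintro ⟨y, t⟩ ⟨hy, ht⟩
      exact point_mem_closedUpperHalf _ (mul_nonneg (ha.le.trans ht.1) hy)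
    · rintro ⟨y, t⟩ ⟨hy, ht⟩
      exact (ha.trans_le ht.1).ne'
  -- In the interior this is the fundamental theorem of calculus along the ray through (x, y). Both
  -- sides then converge as y → 0, the right one by dominated convergence on a compact set of pairs
  -- (y, t).
  have hy : ∀ y ∈ Ioi (0 : ℝ), F (point (c • x) (c * y)) - F (point (a • x) (a * y))
      = ∫ t in a..c, G (point (t • x) (t * y)) / t := by
    intro y hy
    have hmem : ∀ t ∈ Icc a c, t • point x y ∈ upperHalf n := fun t ht =>
      smul_mem_upperHalf (ha.trans_le ht.1) (point_mem_upperHalf x hy)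
    have h := intervalIntegral.integral_eq_sub_of_hasDerivAt (a := a) (b := c)
      (f := fun t => f (t • point x y)) (f' := fun t => euler f (t • point x y) / t)
      (fun t ht => by
        rw [uIcc_of_le hac] at ht
        exact hasDerivAt_ray (ha.trans_le ht.1).ne' (hf.differentiableAt le_rfl (hmem t ht)))
      (ContinuousOn.intervalIntegrable (by
        rw [uIcc_of_le hac]
        refine ContinuousOn.congr (hcont.comp (f := fun t : ℝ => (y, t)) (by fun_prop)
          fun t ht => ⟨le_of_lt (show 0 < y from hy), ht⟩) fun t ht => ?_
        simp only [Function.comp]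
        rw [← smul_point, hGf (hmem t ht)]))
    simp only [← smul_point]
    rw [hFf (hmem c (right_mem_Icc.2 hac)), hFf (hmem a (left_mem_Icc.2 hac)), ← h]
    refine intervalIntegral.integral_congr fun t ht => ?_
    rw [uIcc_of_le hac] at ht
    simp only [hGf (hmem t ht)]
  have hlim : ∀ t : ℝ, 0 < t →
      Tendsto (fun y : ℝ => F (point (t • x) (t * y))) (𝓝[>] 0) (𝓝 (F (point (t • x) 0))) := by
    intro t ht
    refine (tendsto_point (t • x) hF).comp ?_
    refine tendsto_nhdsWithin_iff.2 ⟨?_, ?_⟩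
    · have : Tendsto (fun y : ℝ => t * y) (𝓝 0) (𝓝 (t * 0)) := (continuous_const_mul t).tendsto 0
      rw [mul_zero] at this
      exact this.mono_left nhdsWithin_le_nhds
    · filter_upwards [self_mem_nhdsWithin] with y hy using mul_pos ht hy
  have hint : Tendsto (fun y : ℝ => ∫ t in a..c, G (point (t • x) (t * y)) / t) (𝓝[>] 0)
      (𝓝 (∫ t in a..c, G (point (t • x) (t * 0)) / t)) := by
    obtain ⟨M, hM⟩ := ((isCompact_Icc (a := (0 : ℝ)) (b := 1)).prod
      (isCompact_Icc (a := a) (b := c))).exists_bound_of_continuousOn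
      (hcont.mono (prod_mono_left Icc_subset_Ici_self))
    have hsec : ∀ y ∈ Ici (0 : ℝ),
        ContinuousOn (fun t => G (point (t • x) (t * y)) / t) (Icc a c) := fun y hy =>
      hcont.comp (f := fun t : ℝ => (y, t)) (by fun_prop) fun t ht => ⟨hy, ht⟩
    have h01 : ∀ᶠ y : ℝ in 𝓝[>] 0, y ∈ Ioo (0 : ℝ) 1 := Ioo_mem_nhdsGT one_pos
    refine intervalIntegral.tendsto_integral_filter_of_dominated_convergence (fun _ => M) ?_ ?_ ?_ ?_
    · filter_upwards [h01] with y hy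
      rw [uIoc_of_le hac]
      exact ((hsec y hy.1.le).mono Ioc_subset_Icc_self).aestronglyMeasurable measurableSet_Ioc
    · filter_upwards [h01] with y hy
      refine Eventually.of_forall fun t ht => ?_
      rw [uIoc_of_le hac] at ht
      exact hM (y, t) ⟨⟨hy.1.le, hy.2.le⟩, Ioc_subset_Icc_self ht⟩
    · exact intervalIntegrable_const
    · refine Eventually.of_forall fun t ht => ?_
      rw [uIoc_of_le hac] at ht
      have h := (hcont (0, t) ⟨self_mem_Ici, Ioc_subset_Icc_self ht⟩).comp
        (f := fun y : ℝ => (y, t)) (s := Ici 0) (by fun_prop)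
        (fun y hy => ⟨hy, Ioc_subset_Icc_self ht⟩)
      exact h.mono Ioi_subset_Ici_self
  have hlhs := (hlim c (ha.trans_le hac)).sub (hlim a ha)
  have := tendsto_nhds_unique (hlhs.congr' (by
    filter_upwards [self_mem_nhdsWithin] with y hy' using hy y hy')) hint
  simpa using this

/-- No differentiability at the boundary is assumed: the trace is an integral of the continuous
function G / t by `trace_sub_eq_integral`, so it is differentiable along rays. -/
lemma hasDerivAt_trace {f F G : Space n → ℝ} (hf : SmoothUpper 1 f)
    (hF : ContinuousOn F (closedUpperHalf n)) (hFf : EqOn F f (upperHalf n))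
    (hG : ContinuousOn G (closedUpperHalf n)) (hGf : EqOn G (euler f) (upperHalf n))
    (x : EuclideanSpace ℝ (Fin n)) {t : ℝ} (ht : 0 < t) :
    HasDerivAt (fun τ : ℝ => F (point (τ • x) 0)) (G (point (t • x) 0) / t) t := by
  have hc : ContinuousOn (fun τ : ℝ => G (point (τ • x) 0) / τ) (Ioi 0) := by
    refine ContinuousOn.div (hG.comp ?_ fun τ hτ => point_mem_closedUpperHalf _ le_rfl)
      continuousOn_id fun τ hτ => ne_of_gt hτ
    exact (continuous_point.comp (by fun_prop : Continuous fun τ : ℝ =>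
        (τ • x, (0 : ℝ)))).continuousOn
  have ht2 : t / 2 < t := by linarith
  have h2 : 0 < t / 2 := by linarith
  have hd : HasDerivAt (fun τ : ℝ => ∫ r in (t / 2)..τ, G (point (r • x) 0) / r)
      (G (point (t • x) 0) / t) t := by
    refine intervalIntegral.integral_hasDerivAt_right ?_ ?_ (hc.continuousAt (Ioi_mem_nhds ht))
    · refine ContinuousOn.intervalIntegrable (hc.mono fun r hr => ?_)
      rw [uIcc_of_le ht2.le] at hr
      exact h2.trans_le hr.1
    · exact hc.stronglyMeasurableAtFilter isOpen_Ioi t ht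
  refine (hd.const_add (F (point ((t / 2) • x) 0))).congr_of_eventuallyEq ?_
  filter_upwards [Ioi_mem_nhds ht2] with τ hτ
  rw [← trace_sub_eq_integral hf hF hFf hG hGf x h2 (le_of_lt hτ)]
  ring

/-- A trace that is identically zero has zero derivative along boundary rays, and at time one this
derivative is the trace of X · ∇ f. This propagates the Neumann conditions from U and Δ_b U to their
derivatives in the scale. -/
lemma VanishesOnBoundary.euler {f : Space n → ℝ} (hv : VanishesOnBoundary f)
    (hf : SmoothUpper 1 f) (hF : ExtendsContinuously f) (hG : ExtendsContinuously (euler f)) :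
    VanishesOnBoundary (euler f) := by
  obtain ⟨F, hF, hFf⟩ := hF
  obtain ⟨G, hG, hGf⟩ := hG
  have hF0 : ∀ x, F (point x 0) = 0 := fun x =>
    tendsto_nhds_unique (tendsto_point_of_eqOn x hF hFf) (hv x)
  intro x
  have h := hasDerivAt_trace hf hF hFf hG hGf x one_pos
  simp only [hF0, one_smul, div_one] at h
  have h' := tendsto_point_of_eqOn x hG hGf
  rwa [h.unique (hasDerivAt_const 1 (0 : ℝ))] at h'

lemma VanishesOnBoundary.congr {f g : Space n → ℝ} (hf : VanishesOnBoundary f)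
    (h : EqOn g f (upperHalf n)) : VanishesOnBoundary g := fun x => by
  refine (hf x).congr' ?_
  filter_upwards [self_mem_nhdsWithin] with y hy using (h (point_mem_upperHalf x hy)).symm

lemma VanishesOnBoundary.add {f g : Space n → ℝ} (hf : VanishesOnBoundary f)
    (hg : VanishesOnBoundary g) : VanishesOnBoundary (fun X => f X + g X) := fun x => by
  simpa using (hf x).add (hg x)

lemma VanishesOnBoundary.mul_extends {f g : Space n → ℝ} (hf : VanishesOnBoundary f)
    (hg : ExtendsContinuously g) : VanishesOnBoundary (fun X => g X * f X) := fun x => by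
  obtain ⟨G, hG, hGg⟩ := hg
  simpa using (tendsto_point_of_eqOn x hG hGg).mul (hf x)

lemma VanishesOnBoundary.const_mul (c : ℝ) {f : Space n → ℝ} (hf : VanishesOnBoundary f) :
    VanishesOnBoundary (fun X => c * f X) := fun x => by
  simpa using (hf x).const_mul c

lemma vanishesOnBoundary_height_rpow {δ : ℝ} (hδ : 0 < δ) :
    VanishesOnBoundary (fun X : Space n => height X ^ δ) := fun x => by
  simp only [height_point]
  have h : ContinuousAt (fun y : ℝ => y ^ δ) 0 := Real.continuousAt_rpow_const 0 δ (Or.inr hδ.le)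
  simpa [ContinuousAt, Real.zero_rpow hδ.ne'] using h.mono_left (nhdsWithin_le_nhds (s := Ioi 0))

end LaneEmden
end

/-! ### Weighted integrability, polar coordinates and differentiation of dilated integrals. -/

noncomputable section

namespace LaneEmden

open Set Filter Topology MeasureTheory

variable {n : ℕ}

/-- `f` is bounded on bounded subsets of the upper half space. -/
def LocallyBounded (f : Space n → ℝ) : Prop :=
  ∀ R : ℝ, ∃ C : ℝ, ∀ X ∈ upperHalf n, ‖X‖ ≤ R → |f X| ≤ C

lemma ExtendsContinuously.locallyBounded {f : Space n → ℝ} (hf : ExtendsContinuously f) :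
    LocallyBounded f := by
  obtain ⟨F, hF, hFf⟩ := hf
  intro R
  have hK : IsCompact (closedUpperHalf n ∩ Metric.closedBall 0 R) :=
    (isCompact_closedBall (0 : Space n) R).inter_left isClosed_closedUpperHalf
  obtain ⟨C, hC⟩ := hK.exists_bound_of_continuousOn (hF.mono inter_subset_left)
  refine ⟨C, fun X hX hR => ?_⟩
  rw [← hFf hX]
  exact hC X ⟨upperHalf_subset hX, by simpa using hR⟩

/-- `F` is continuous in the upper half space and `O(y^{-β})` on bounded sets. -/
structure Tame (β : ℝ) (F : Space n → ℝ) : Prop where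
  continuousOn : ContinuousOn F (upperHalf n)
  bound : ∀ R : ℝ, ∃ C : ℝ, ∀ X ∈ upperHalf n, ‖X‖ ≤ R → |F X| ≤ C * height X ^ (-β)

lemma abs_height_le_norm (X : Space n) : |height X| ≤ ‖X‖ := by
  simpa only [height, Real.norm_eq_abs] using PiLp.norm_apply_le (p := 2) X (Fin.last n)

namespace Tame

variable {β : ℝ} {F G : Space n → ℝ}

lemma congr (hF : Tame β F) (h : EqOn G F (upperHalf n)) : Tame β G := by
  refine ⟨hF.continuousOn.congr h, fun R => ?_⟩
  obtain ⟨C, hC⟩ := hF.bound R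
  exact ⟨C, fun X hX hR => by rw [h hX]; exact hC X hX hR⟩

lemma add (hF : Tame β F) (hG : Tame β G) : Tame β (fun X => F X + G X) := by
  refine ⟨hF.continuousOn.add hG.continuousOn, fun R => ?_⟩
  obtain ⟨C, hC⟩ := hF.bound R
  obtain ⟨D, hD⟩ := hG.bound R
  refine ⟨C + D, fun X hX hR => (abs_add_le _ _).trans ?_⟩
  rw [add_mul]
  exact add_le_add (hC X hX hR) (hD X hX hR)

lemma mul_bounded (hF : Tame β F) (hGc : ContinuousOn G (upperHalf n)) (hG : LocallyBounded G) :
    Tame β (fun X => G X * F X) := by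
  refine ⟨hGc.mul hF.continuousOn, fun R => ?_⟩
  obtain ⟨C, hC⟩ := hF.bound R
  obtain ⟨D, hD⟩ := hG R
  refine ⟨D * C, fun X hX hR => ?_⟩
  rw [abs_mul, mul_assoc]
  exact mul_le_mul (hD X hX hR) (hC X hX hR) (abs_nonneg _)
    ((abs_nonneg _).trans (hD X hX hR))

lemma const_mul (c : ℝ) (hF : Tame β F) : Tame β (fun X => c * F X) :=
  hF.mul_bounded continuousOn_const fun _ => ⟨|c|, fun _ _ _ => le_rfl⟩

end Tame

lemma tame_height_rpow {β γ : ℝ} (h : -β ≤ γ) : Tame β (fun X : Space n => height X ^ γ) := by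
  refine ⟨(smoothUpper_height_rpow 0 γ).continuousOn, fun R => ⟨|R| ^ (γ + β), fun X hX hR => ?_⟩⟩
  have hX' : 0 < height X := hX
  rw [abs_of_nonneg (Real.rpow_nonneg hX'.le _)]
  have e : height X ^ γ = height X ^ (γ + β) * height X ^ (-β) := by
    rw [← Real.rpow_add hX']
    congr 1
    ring
  rw [e]
  refine mul_le_mul_of_nonneg_right (Real.rpow_le_rpow hX'.le ?_ (by linarith))
    (Real.rpow_nonneg hX'.le _)
  exact (le_abs_self _).trans ((abs_height_le_norm X).trans (hR.trans (le_abs_self R)))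

section Integrability

variable {β : ℝ} (hβ : β < 1)
include hβ

/-- Inside a box the power of the height is a product of functions of one variable, and its normal
factor y^{-β} is integrable near 0 since β < 1. -/
lemma integrableOn_height_rpow (R : ℝ) :
    IntegrableOn (fun X : Space n => height X ^ (-β)) (upperHalf n ∩ Metric.closedBall 0 R) := by
  let h : Fin (n + 1) → ℝ → ℝ := fun i =>
    if i = Fin.last n then (Ioc 0 R).indicator (fun y => y ^ (-β))
    else (Icc (-R) R).indicator (fun _ => 1)
  have hh : ∀ i, Integrable (h i) := by
    intro i
    by_cases hi : i = Fin.last n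
    · simp only [h, hi, if_true]
      rw [integrable_indicator_iff measurableSet_Ioc]
      exact (intervalIntegral.intervalIntegrable_rpow' (by linarith)).1
    · simp only [h, hi, if_false]
      rw [integrable_indicator_iff measurableSet_Icc]
      exact integrableOn_const (by simp)
  have hp : Integrable (fun x : Fin (n + 1) → ℝ => ∏ i, h i (x i)) := Integrable.fintype_prod hh
  have hp' : Integrable (fun X : Space n => ∏ i, h i (X i)) :=
    (PiLp.volume_preserving_ofLp (Fin (n + 1))).integrable_comp_of_integrable hp
  refine hp'.integrableOn.congr_fun (fun X hX => ?_)
    (isOpen_upperHalf.measurableSet.inter Metric.isClosed_closedBall.measurableSet)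
  have hR : ‖X‖ ≤ R := by simpa using hX.2
  have hX0 : 0 < height X := hX.1
  have hc : ∀ i, |X i| ≤ R := fun i => by
    simpa using (PiLp.norm_apply_le (p := 2) X i).trans hR
  show ∏ i, h i (X i) = height X ^ (-β)
  rw [Fin.prod_univ_castSucc]
  have h1 : ∀ i : Fin n, h i.castSucc (X i.castSucc) = 1 := fun i => by
    have : i.castSucc ≠ Fin.last n := (Fin.castSucc_lt_last i).ne
    simp only [h, this, if_false]
    exact indicator_of_mem (s := Icc (-R) R) (abs_le.1 (hc i.castSucc)) (fun _ => (1 : ℝ))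
  have h2 : h (Fin.last n) (X (Fin.last n)) = height X ^ (-β) := by
    simp only [h, if_true]
    exact indicator_of_mem (s := Ioc 0 R) ⟨hX0, (le_abs_self _).trans (hc _)⟩ _
  simp [h1, h2]

lemma Tame.integrableOn {F : Space n → ℝ} (hF : Tame β F) (R : ℝ) :
    IntegrableOn F (upperHalf n ∩ Metric.closedBall 0 R) := by
  have hm : MeasurableSet (upperHalf n ∩ Metric.closedBall (0 : Space n) R) :=
    isOpen_upperHalf.measurableSet.inter Metric.isClosed_closedBall.measurableSet
  obtain ⟨C, hC⟩ := hF.bound R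
  refine Integrable.mono' ((integrableOn_height_rpow hβ R).const_mul C)
    ((hF.continuousOn.mono inter_subset_left).aestronglyMeasurable hm) ?_
  filter_upwards [ae_restrict_mem hm] with X hX
  exact hC X hX.1 (by simpa using hX.2)

lemma Tame.integrableOn_of_support {F : Space n → ℝ} (hF : Tame β F) {R : ℝ}
    (hR : ∀ X ∈ upperHalf n, R ≤ ‖X‖ → F X = 0) : IntegrableOn F (upperHalf n) := by
  refine (hF.integrableOn hβ R).of_forall_sdiff_eq_zero isOpen_upperHalf.measurableSet ?_
  intro X hX
  refine hR X hX.1 (le_of_not_ge fun h => hX.2 ⟨hX.1, ?_⟩)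
  simpa using h

end Integrability

section Polar

lemma finrank_space_sub_one : Module.finrank ℝ (Space n) - 1 = n := by simp

/-- Homeomorphism-free form of integrability in polar coordinates. -/
lemma integrable_polar {G : Space n → ℝ} (hG : Integrable G) :
    Integrable (fun q : Metric.sphere (0 : Space n) 1 × Ioi (0 : ℝ) => G (q.2.1 • (q.1 : Space n)))
      ((volume : Measure (Space n)).toSphere.prod (Measure.volumeIoiPow n)) := by
  have h := (volume : Measure (Space n)).measurePreserving_homeomorphUnitSphereProd.symm
    (homeomorphUnitSphereProd (Space n)).toMeasurableEquiv
  rw [finrank_space_sub_one] at h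
  have hG' : Integrable (fun x : ({0}ᶜ : Set (Space n)) => G x)
      ((volume : Measure (Space n)).comap Subtype.val) := by
    have := (integrableOn_iff_comap_subtypeVal (μ := (volume : Measure (Space n))) (f := G)
      (measurableSet_singleton (0 : Space n)).compl).1 hG.integrableOn
    exact this
  exact h.integrable_comp_of_integrable hG'

lemma integral_polar {G : Space n → ℝ} (hG : Integrable G) :
    ∫ X, G X = ∫ r in Ioi (0 : ℝ), r ^ n *
      ∫ ω, G (r • (ω : Space n)) ∂(volume : Measure (Space n)).toSphere := by
  have h := (volume : Measure (Space n)).measurePreserving_homeomorphUnitSphereProd.symm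
    (homeomorphUnitSphereProd (Space n)).toMeasurableEquiv
  rw [finrank_space_sub_one] at h
  have h1 : ∫ X, G X = ∫ x : ({0}ᶜ : Set (Space n)), G x
      ∂((volume : Measure (Space n)).comap Subtype.val) := by
    rw [integral_subtype_comap (measurableSet_singleton _).compl, restrict_compl_singleton]
  have h2 := h.integral_comp' (fun x : ({0}ᶜ : Set (Space n)) => G x)
  rw [h1, ← h2]
  have h3 := integral_prod_symm _ (integrable_polar hG)
  refine Eq.trans h3 ?_
  simp only [Measure.volumeIoiPow, ENNReal.ofReal]
  rw [integral_withDensity_eq_integral_smul (by fun_prop),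
    integral_subtype_comap measurableSet_Ioi fun r : ℝ => Real.toNNReal (r ^ n) •
      ∫ ω, G (r • (ω : Space n)) ∂(volume : Measure (Space n)).toSphere]
  refine setIntegral_congr_fun measurableSet_Ioi fun r hr => ?_
  simp only [NNReal.smul_def, smul_eq_mul]
  rw [Real.coe_toNNReal _ (pow_nonneg (le_of_lt hr) _)]

lemma measurableSet_upperSphere : MeasurableSet (upperSphere n) :=
  (isOpen_lt continuous_const (continuous_height.comp continuous_subtype_val)).measurableSet

lemma ae_upperSphere : ∀ᵐ ω : Metric.sphere (0 : Space n) 1 ∂(upperSphereMeasure n),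
    (ω : Space n) ∈ upperHalf n :=
  ae_restrict_mem measurableSet_upperSphere

lemma norm_sphere (ω : Metric.sphere (0 : Space n) 1) : ‖(ω : Space n)‖ = 1 := by
  simp

/-- The integral of `F` over the upper half of the sphere of radius `r`, without the factor
`rⁿ`. -/
def sphereMean (F : Space n → ℝ) (r : ℝ) : ℝ :=
  ∫ ω, F (r • (ω : Space n)) ∂(upperSphereMeasure n)

lemma integral_upperHalf_polar {F : Space n → ℝ} (hF : IntegrableOn F (upperHalf n)) :
    ∫ X in upperHalf n, F X = ∫ r in Ioi (0 : ℝ), r ^ n * sphereMean F r := by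
  rw [← integral_indicator isOpen_upperHalf.measurableSet,
    integral_polar (hF.integrable_indicator isOpen_upperHalf.measurableSet)]
  refine setIntegral_congr_fun measurableSet_Ioi fun r hr => ?_
  simp only [sphereMean, upperSphereMeasure]
  rw [← integral_indicator measurableSet_upperSphere]
  congr 1
  refine integral_congr_ae (Eventually.of_forall fun ω => ?_)
  have hr' : (0 : ℝ) < r := hr
  have hiff : r • (ω : Space n) ∈ upperHalf n ↔ ω ∈ upperSphere n := by
    show 0 < height (r • (ω : Space n)) ↔ 0 < height (ω : Space n)
    rw [height_smul]
    exact mul_pos_iff_of_pos_left hr'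
  by_cases h : ω ∈ upperSphere n
  · simp only [indicator_of_mem h, indicator_of_mem (hiff.2 h)]
  · simp only [indicator_of_notMem h, indicator_of_notMem (mt hiff.1 h)]

/-- Fubini in polar coordinates gives integrability over almost every half sphere; by homogeneity a
single radius suffices. -/
lemma integrable_sphere_height_rpow {β : ℝ} (hβ : β < 1) :
    Integrable (fun ω : Metric.sphere (0 : Space n) 1 => height (ω : Space n) ^ (-β))
      (upperSphereMeasure n) := by
  have hm : MeasurableSet (upperHalf n ∩ Metric.closedBall (0 : Space n) 1) :=
    isOpen_upperHalf.measurableSet.inter Metric.isClosed_closedBall.measurableSet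
  have h := integrable_polar ((integrableOn_height_rpow (n := n) hβ 1).integrable_indicator hm)
  have h' := h.prod_left_ae
  -- The radii below one have positive measure, so one of them avoids the exceptional null set.
  have hpos : Measure.volumeIoiPow n (Iio ⟨1, mem_Ioi.2 one_pos⟩) ≠ 0 := by
    rw [Measure.volumeIoiPow_apply_Iio]
    simp only [one_pow, ne_eq, ENNReal.ofReal_eq_zero, not_le]
    positivity
  obtain ⟨r, hr1, hr⟩ : ∃ r : Ioi (0 : ℝ), r ∈ Iio (⟨1, mem_Ioi.2 one_pos⟩ : Ioi (0 : ℝ)) ∧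
      Integrable (fun ω : Metric.sphere (0 : Space n) 1 =>
        (upperHalf n ∩ Metric.closedBall (0 : Space n) 1).indicator
          (fun X => height X ^ (-β)) (r.1 • (ω : Space n)))
        (volume : Measure (Space n)).toSphere := by
    by_contra hcon
    push Not at hcon
    refine hpos (measure_mono_null (fun r hr => ?_) (ae_iff.1 h'))
    exact hcon r hr
  have hr0 : 0 < r.1 := r.2
  have hr1' : r.1 < 1 := hr1
  have hg : IntegrableOn (fun ω : Metric.sphere (0 : Space n) 1 =>
      r.1 ^ (-β) * height (ω : Space n) ^ (-β)) (upperSphere n)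
      (volume : Measure (Space n)).toSphere := by
    refine (hr.integrableOn (s := upperSphere n)).congr_fun (fun ω hω => ?_)
      measurableSet_upperSphere
    have hω' : 0 < height (ω : Space n) := hω
    have hmem : r.1 • (ω : Space n) ∈ upperHalf n ∩ Metric.closedBall (0 : Space n) 1 := by
      refine ⟨smul_mem_upperHalf hr0 hω, ?_⟩
      simp only [Metric.mem_closedBall, dist_zero_right, norm_smul, norm_sphere, mul_one,
        Real.norm_eq_abs, abs_of_pos hr0]
      exact hr1'.le
    simp only [indicator_of_mem hmem]
    rw [height_smul, Real.mul_rpow hr0.le hω'.le]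
  refine (Integrable.const_mul hg (r.1 ^ β)).congr (Eventually.of_forall fun ω => ?_)
  simp only
  rw [← mul_assoc, ← Real.rpow_add hr0]
  simp

end Polar

section Dilation

variable {T : Type*} [MeasurableSpace T] {μ : Measure T} {ξ : T → Space n} {β : ℝ}

lemma aestronglyMeasurable_dilation (hξ : Measurable ξ) (hΩ : ∀ᵐ ω ∂μ, ξ ω ∈ upperHalf n)
    {F : Space n → ℝ} (hF : ContinuousOn F (upperHalf n)) {r : ℝ} (hr : 0 < r) :
    AEStronglyMeasurable (fun ω => F (r • ξ ω)) μ := by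
  classical
  have hm : Measurable ((upperHalf n).indicator F) := by
    rw [← Set.piecewise_eq_indicator]
    exact hF.measurable_piecewise continuousOn_const isOpen_upperHalf.measurableSet
  refine (hm.comp (hξ.const_smul r)).aestronglyMeasurable.congr ?_
  filter_upwards [hΩ] with ω hω
  simp only [Function.comp]
  exact indicator_of_mem (smul_mem_upperHalf hr hω) F

/-- The uniform bound on dilates of a tame function. -/
lemma Tame.dilation_bound (hβ0 : 0 ≤ β) {F : Space n → ℝ} (hF : Tame β F) {l : ℝ} (hl : 0 < l) :
    ∃ C : ℝ, ∀ X ∈ upperHalf n, ‖X‖ ≤ 1 → ∀ r ∈ Ioo (l / 2) (2 * l),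
      ‖F (r • X)‖ ≤ C * height X ^ (-β) := by
  obtain ⟨C, hC⟩ := hF.bound (2 * l)
  -- All dilates lie in the ball of radius 2 l, and r^{-β} is largest at the left end l / 2 because
  -- β ≥ 0.
  refine ⟨|C| * (l / 2) ^ (-β), fun X hX hX1 r hr => ?_⟩
  have hr0 : 0 < r := by linarith [hr.1]
  have hX' : 0 < height X := hX
  refine (hC (r • X) (smul_mem_upperHalf hr0 hX) ?_).trans ?_
  · rw [norm_smul, Real.norm_eq_abs, abs_of_pos hr0]
    nlinarith [hr.2, norm_nonneg X]
  · rw [height_smul, Real.mul_rpow hr0.le hX'.le, mul_assoc]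
    have h1 : r ^ (-β) ≤ (l / 2) ^ (-β) :=
      Real.rpow_le_rpow_of_nonpos (by linarith) hr.1.le (by linarith)
    have h2 : 0 ≤ height X ^ (-β) := Real.rpow_nonneg hX'.le _
    have h3 : 0 ≤ r ^ (-β) := Real.rpow_nonneg hr0.le _
    exact mul_le_mul (le_abs_self C) (mul_le_mul_of_nonneg_right h1 h2) (mul_nonneg h3 h2)
      (abs_nonneg C)

variable (hβ0 : 0 ≤ β) (hξ : Measurable ξ) (hΩ : ∀ᵐ ω ∂μ, ξ ω ∈ upperHalf n)
  (h1 : ∀ᵐ ω ∂μ, ‖ξ ω‖ ≤ 1) (hint : Integrable (fun ω => height (ξ ω) ^ (-β)) μ)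
include hβ0 hξ hΩ h1 hint

lemma Tame.integrable_dilation {F : Space n → ℝ} (hF : Tame β F) {l : ℝ} (hl : 0 < l) :
    Integrable (fun ω => F (l • ξ ω)) μ := by
  obtain ⟨C, hC⟩ := hF.dilation_bound hβ0 hl
  refine (hint.const_mul C).mono' (aestronglyMeasurable_dilation hξ hΩ hF.continuousOn hl) ?_
  filter_upwards [hΩ, h1] with ω hω hω1
  exact hC _ hω hω1 l ⟨by linarith, by linarith⟩

lemma Tame.continuousAt_dilation {F : Space n → ℝ} (hF : Tame β F) {l : ℝ} (hl : 0 < l) :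
    ContinuousAt (fun r => ∫ ω, F (r • ξ ω) ∂μ) l := by
  obtain ⟨C, hC⟩ := hF.dilation_bound hβ0 hl
  have hnhds : Ioo (l / 2) (2 * l) ∈ 𝓝 l := Ioo_mem_nhds (by linarith) (by linarith)
  refine continuousAt_of_dominated (bound := fun ω => C * height (ξ ω) ^ (-β)) ?_ ?_
    (hint.const_mul C) ?_
  · filter_upwards [hnhds] with r hr
    exact aestronglyMeasurable_dilation hξ hΩ hF.continuousOn (by linarith [hr.1])
  · filter_upwards [hnhds] with r hr
    filter_upwards [hΩ, h1] with ω hω hω1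
    exact hC _ hω hω1 r hr
  · filter_upwards [hΩ] with ω hω
    exact (hF.continuousOn.continuousAt (upperHalf_mem_nhds (smul_mem_upperHalf hl hω))).comp
      (f := fun r : ℝ => r • ξ ω) (by fun_prop)

/-- The map ξ from a measure space is kept abstract so that one argument serves both the unit half
sphere and the unit half ball. The derivative of F (r ξ) in r is (X · ∇ F)(r ξ) / r, dominated near
l through the bound on X · ∇ F. -/
lemma hasDerivAt_integral_dilation {F : Space n → ℝ} (hs : SmoothUpper 1 F) (hF : Tame β F)
    (hF' : Tame β (euler F)) {l : ℝ} (hl : 0 < l) :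
    HasDerivAt (fun r => ∫ ω, F (r • ξ ω) ∂μ) ((∫ ω, euler F (l • ξ ω) ∂μ) / l) l := by
  obtain ⟨C, hC⟩ := hF'.dilation_bound hβ0 hl
  have hnhds : Ioo (l / 2) (2 * l) ∈ 𝓝 l := Ioo_mem_nhds (by linarith) (by linarith)
  have h := hasDerivAt_integral_of_dominated_loc_of_deriv_le (μ := μ)
    (F := fun r ω => F (r • ξ ω)) (F' := fun r ω => euler F (r • ξ ω) / r)
    (bound := fun ω => (C * height (ξ ω) ^ (-β)) * (l / 2)⁻¹) hnhds ?_
    (hF.integrable_dilation hβ0 hξ hΩ h1 hint hl) ?_ ?_ ((hint.const_mul C).mul_const _) ?_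
  · rw [← integral_div]
    exact h.2
  · filter_upwards [hnhds] with r hr
    exact aestronglyMeasurable_dilation hξ hΩ hF.continuousOn (by linarith [hr.1])
  · exact ((hF'.integrable_dilation hβ0 hξ hΩ h1 hint hl).div_const l).aestronglyMeasurable
  · filter_upwards [hΩ, h1] with ω hω hω1 r hr
    have hr0 : 0 < r := by linarith [hr.1]
    rw [norm_div, Real.norm_eq_abs r, abs_of_pos hr0, div_eq_mul_inv]
    have h2 := hC _ hω hω1 r hr
    exact mul_le_mul h2 ((inv_le_inv₀ hr0 (by linarith)).2 hr.1.le) (by positivity)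
      ((norm_nonneg _).trans h2)
  · filter_upwards [hΩ] with ω hω r hr
    have hr0 : 0 < r := by linarith [hr.1]
    exact hasDerivAt_ray hr0.ne' (hs.differentiableAt le_rfl (smul_mem_upperHalf hr0 hω))

end Dilation

section SphereMean

variable {β : ℝ} (hβ0 : 0 ≤ β) (hβ : β < 1) {F : Space n → ℝ}
include hβ0 hβ

lemma Tame.integrable_sphere (hF : Tame β F) {l : ℝ} (hl : 0 < l) :
    Integrable (fun ω : Metric.sphere (0 : Space n) 1 => F (l • (ω : Space n)))
      (upperSphereMeasure n) :=
  hF.integrable_dilation hβ0 measurable_subtype_coe ae_upperSphere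
    (Eventually.of_forall fun ω => (norm_sphere ω).le) (integrable_sphere_height_rpow hβ) hl

lemma Tame.continuousOn_sphereMean (hF : Tame β F) : ContinuousOn (sphereMean F) (Ioi 0) :=
  fun _ hl => (hF.continuousAt_dilation hβ0 measurable_subtype_coe ae_upperSphere
    (Eventually.of_forall fun ω => (norm_sphere ω).le)
    (integrable_sphere_height_rpow hβ) hl).continuousWithinAt

lemma hasDerivAt_sphereMean (hs : SmoothUpper 1 F) (hF : Tame β F) (hF' : Tame β (euler F))
    {l : ℝ} (hl : 0 < l) : HasDerivAt (sphereMean F) (sphereMean (euler F) l / l) l :=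
  hasDerivAt_integral_dilation hβ0 measurable_subtype_coe ae_upperSphere
    (Eventually.of_forall fun ω => (norm_sphere ω).le) (integrable_sphere_height_rpow hβ) hs hF
    hF' hl

end SphereMean

lemma sphereMean_congr {F G : Space n → ℝ} (h : EqOn F G (upperHalf n)) {r : ℝ} (hr : 0 < r) :
    sphereMean F r = sphereMean G r := by
  refine integral_congr_ae ?_
  filter_upwards [ae_upperSphere] with ω hω using h (smul_mem_upperHalf hr hω)

end LaneEmden
end

/-! ### The divergence theorem in the half space. -/

noncomputable section

namespace LaneEmden

open Set Filter Topology MeasureTheory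

variable {n : ℕ}

/-- The vector field with components `Z i` is differentiable at `X` with divergence `d`. -/
def HasDiv (Z : Fin (n + 1) → Space n → ℝ) (d : ℝ) (X : Space n) : Prop :=
  (∀ i, DifferentiableAt ℝ (Z i) X) ∧ ∑ i, dir (basisVec i) (Z i) X = d

/-- The scalar product of the gradients of `f` and `g`. -/
def gradDot (f g : Space n → ℝ) (X : Space n) : ℝ :=
  ∑ i, dir (basisVec i) f X * dir (basisVec i) g X

lemma gradDot_comm (f g : Space n → ℝ) : gradDot f g = gradDot g f := by
  ext X
  simp only [gradDot, mul_comm]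

lemma HasDiv.add {Z W : Fin (n + 1) → Space n → ℝ} {d e : ℝ} {X : Space n}
    (hZ : HasDiv Z d X) (hW : HasDiv W e X) : HasDiv (fun i Y => Z i Y + W i Y) (d + e) X :=
  ⟨fun i => (hZ.1 i).fun_add (hW.1 i), by
    simp only [dir_add (hZ.1 _) (hW.1 _), Finset.sum_add_distrib, hZ.2, hW.2]⟩

lemma HasDiv.const_mul {Z : Fin (n + 1) → Space n → ℝ} {d : ℝ} {X : Space n}
    (hZ : HasDiv Z d X) (c : ℝ) : HasDiv (fun i Y => c * Z i Y) (c * d) X :=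
  ⟨fun i => (hZ.1 i).const_mul c, by
    simp only [dir_const_mul (hZ.1 _), ← Finset.mul_sum, hZ.2]⟩

lemma HasDiv.mul {Z : Fin (n + 1) → Space n → ℝ} {d : ℝ} {X : Space n} {a : Space n → ℝ}
    (ha : DifferentiableAt ℝ a X) (hZ : HasDiv Z d X) :
    HasDiv (fun i Y => a Y * Z i Y) (a X * d + ∑ i, dir (basisVec i) a X * Z i X) X :=
  ⟨fun i => ha.fun_mul (hZ.1 i), by
    simp only [dir_mul ha (hZ.1 _), Finset.sum_add_distrib, ← Finset.mul_sum, hZ.2]⟩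

lemma hasDiv_radial {B : Space n → ℝ} {X : Space n} (hB : DifferentiableAt ℝ B X) :
    HasDiv (fun i Y => B Y * Y i) (euler B X + (n + 1) * B X) X := by
  have hc : ∀ i, DifferentiableAt ℝ (fun Y : Space n => Y i) X :=
    fun i => (contDiff_coord (k := 1) i).differentiable (by norm_num) X
  refine ⟨fun i => hB.fun_mul (hc i), ?_⟩
  simp only [dir_mul hB (hc _), dir_coord, Finset.sum_add_distrib, PiLp.single_apply, if_true,
    mul_one, Finset.sum_const, Finset.card_univ, Fintype.card_fin]
  rw [euler_eq_dir, dir_eq_sum]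
  simp only [nsmul_eq_mul, mul_comm (dir _ _ _)]
  push_cast
  ring

/-- This is div (y^b ∇g) = y^b Δ_b g with a factor a: the derivative of the weight enters only
through the last coordinate and yields the first-order term of Δ_b. -/
lemma hasDiv_weighted (b : ℝ) {a g : Space n → ℝ} (ha : SmoothUpper 1 a) (hg : SmoothUpper 2 g)
    {X : Space n} (hX : X ∈ upperHalf n) :
    HasDiv (fun i Y => height Y ^ b * a Y * dir (basisVec i) g Y)
      (height X ^ b * (gradDot a g X + a X * weightedLaplacian b g X)) X := by
  have hd : ∀ i, DifferentiableAt ℝ (dir (basisVec i) g) X :=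
    fun i => (SmoothUpper.dir hg _).differentiableAt le_rfl hX
  have hy := (smoothUpper_height_rpow (n := n) 1 b).differentiableAt le_rfl hX
  have ha' := ha.differentiableAt le_rfl hX
  refine ⟨fun i => (hy.fun_mul ha').fun_mul (hd i), ?_⟩
  have hX' : 0 < height X := hX
  have hC : ∑ i, b * height X ^ (b - 1) * height (basisVec i : Space n) * a X
      * dir (basisVec i) g X = b * height X ^ (b - 1) * a X * dir (basisVec (Fin.last n)) g X := by
    rw [Fin.sum_univ_castSucc]
    simp only [height_basisVec_castSucc, height_basisVec_last, mul_zero, zero_mul,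
      Finset.sum_const_zero, zero_add, mul_one]
  have hS : ∑ i, dir (basisVec i) (fun Y => height Y ^ b * a Y * dir (basisVec i) g Y) X
      = height X ^ b * gradDot a g X
        + height X ^ b * a X * ∑ i, dir (basisVec i) (dir (basisVec i) g) X
        + ∑ i, b * height X ^ (b - 1) * height (basisVec i : Space n) * a X
          * dir (basisVec i) g X := by
    simp only [gradDot, Finset.mul_sum, ← Finset.sum_add_distrib]
    refine Finset.sum_congr rfl fun i _ => ?_
    rw [dir_mul (hy.fun_mul ha') (hd _), dir_mul hy ha', dir_height_rpow b hX]
    ring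
  rw [hS, hC, weightedLaplacian_eq b hg hX, Real.rpow_sub_one hX'.ne']
  field_simp
  ring

section Flux

variable {Z : Fin (n + 1) → Space n → ℝ} {d : Space n → ℝ} {R : ℝ}

lemma toLp_insertNth_last (x : Fin n → ℝ) (y : ℝ) :
    (WithLp.toLp 2 ((Fin.last n).insertNth y x : Fin (n + 1) → ℝ) : Space n)
      = point (WithLp.toLp 2 x) y := by
  rw [Fin.insertNth_last']
  rfl

/-- The divergence theorem above height `ε`, for compactly supported fields. -/
lemma flux_at_height (hZ : ∀ X ∈ upperHalf n, HasDiv Z (d X) X) (hd : ContinuousOn d (upperHalf n))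
    (hZR : ∀ X ∈ upperHalf n, R ≤ ‖X‖ → ∀ i, Z i X = 0)
    (hdR : ∀ X ∈ upperHalf n, R ≤ ‖X‖ → d X = 0) {ε : ℝ} (hε : 0 < ε) :
    ∫ x : EuclideanSpace ℝ (Fin n), Z (Fin.last n) (point x ε)
      = -∫ X in {X : Space n | ε ≤ height X}, d X := by
  -- The maximum keeps the box [-R', R']^n × [ε, R'] nonempty even when ε exceeds the support
  -- radius.
  set R' := max R ε with hR'
  have hRR : R ≤ R' := le_max_left _ _
  have hεR : ε ≤ R' := le_max_right _ _
  have hR0 : 0 < R' := hε.trans_le hεR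
  let a : Fin (n + 1) → ℝ := fun i => if i = Fin.last n then ε else -R'
  let c : Fin (n + 1) → ℝ := fun _ => R'
  have hac : a ≤ c := by
    intro i
    by_cases hi : i = Fin.last n
    · simp only [a, c, hi, if_true]
      exact hεR
    · simp only [a, c, hi, if_false]
      linarith
  let T : (Fin (n + 1) → ℝ) ≃L[ℝ] Space n :=
    (PiLp.continuousLinearEquiv 2 ℝ (fun _ : Fin (n + 1) => ℝ)).symm
  have hT : ∀ x, T x = WithLp.toLp 2 x := fun x => rfl
  have hup : ∀ x ∈ Icc a c, T x ∈ upperHalf n := by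
    intro x hx
    have h := hx.1 (Fin.last n)
    simp only [a, if_true] at h
    exact hε.trans_le h
  have hnorm : ∀ (x : Fin (n + 1) → ℝ) i, |x i| ≤ ‖T x‖ := fun x i => by
    exact PiLp.norm_apply_le (p := 2) (T x) i
  have hbox := integral_divergence_of_hasFDerivAt_off_countable' a c hac
    (fun i x => Z i (T x))
    (fun i x => (fderiv ℝ (Z i) (T x)).comp (T : (Fin (n + 1) → ℝ) →L[ℝ] Space n)) ∅ countable_empty
    (fun i x hx => (((hZ _ (hup x hx)).1 i).continuousAt.comp
      T.continuous.continuousAt).continuousWithinAt)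
    (fun x hx i => by
      have hx' : x ∈ Icc a c := by
        have h2 := hx.1
        simp only [Set.mem_pi, mem_univ, forall_true_left] at h2
        exact ⟨fun j => (h2 j).1.le, fun j => (h2 j).2.le⟩
      exact ((hZ _ (hup x hx')).1 i).hasFDerivAt.comp x T.hasFDerivAt)
  have hdiv : ∀ x ∈ Icc a c, ∑ i, ((fderiv ℝ (Z i) (T x)).comp
      (T : (Fin (n + 1) → ℝ) →L[ℝ] Space n)) (Pi.single i 1) = d (T x) :=
    fun x hx => (hZ _ (hup x hx)).2
  have hdc : ContinuousOn (fun x => d (T x)) (Icc a c) :=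
    hd.comp T.continuous.continuousOn hup
  have hint : IntegrableOn (fun x => d (T x)) (Icc a c) := hdc.integrableOn_Icc
  have h1 := hbox (hint.congr_fun (fun x hx => (hdiv x hx).symm) measurableSet_Icc)
  rw [setIntegral_congr_fun measurableSet_Icc hdiv, Fin.sum_univ_castSucc] at h1
  -- On the lateral faces and the top face some coordinate has modulus R' ≥ R, so the field vanishes
  -- and only the bottom face contributes.
  have hR1 : ∀ x ∈ Icc a c, (∃ i, |x i| = R') → ∀ j, Z j (T x) = 0 := by
    rintro x hx ⟨i, hi⟩ j
    exact hZR _ (hup x hx) (hRR.trans (hi ▸ hnorm x i)) j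
  have hins : ∀ (i : Fin (n + 1)) (y : ℝ), a i ≤ y → y ≤ c i → ∀ x ∈ Icc (a ∘ i.succAbove)
      (c ∘ i.succAbove), (i.insertNth y x : Fin (n + 1) → ℝ) ∈ Icc a c := by
    intro i y h1 h2 x hx
    rw [Fin.insertNth_mem_Icc]
    exact ⟨⟨h1, h2⟩, hx⟩
  have hside : ∀ i : Fin n, ((∫ x in Icc (a ∘ i.castSucc.succAbove) (c ∘ i.castSucc.succAbove),
      Z i.castSucc (T (i.castSucc.insertNth (c i.castSucc) x))) -
      ∫ x in Icc (a ∘ i.castSucc.succAbove) (c ∘ i.castSucc.succAbove),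
      Z i.castSucc (T (i.castSucc.insertNth (a i.castSucc) x))) = 0 := by
    intro i
    have hai : a i.castSucc = -R' := by simp [a, (Fin.castSucc_lt_last i).ne]
    rw [setIntegral_eq_zero_of_forall_eq_zero, setIntegral_eq_zero_of_forall_eq_zero, sub_zero]
    · intro x hx
      refine hR1 _ (hins _ _ le_rfl (hac _) x hx) ⟨i.castSucc, ?_⟩ _
      rw [Fin.insertNth_apply_same, hai, abs_neg, abs_of_pos hR0]
    · intro x hx
      refine hR1 _ (hins _ _ (hac _) le_rfl x hx) ⟨i.castSucc, ?_⟩ _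
      rw [Fin.insertNth_apply_same]
      exact abs_of_pos hR0
  have htop : ∫ x in Icc (a ∘ (Fin.last n).succAbove) (c ∘ (Fin.last n).succAbove),
      Z (Fin.last n) (T ((Fin.last n).insertNth (c (Fin.last n)) x)) = 0 := by
    refine setIntegral_eq_zero_of_forall_eq_zero fun x hx => ?_
    refine hR1 _ (hins _ _ (hac _) le_rfl x hx) ⟨Fin.last n, ?_⟩ _
    rw [Fin.insertNth_apply_same]
    exact abs_of_pos hR0
  have hal : a (Fin.last n) = ε := by simp [a]
  rw [Finset.sum_eq_zero fun i _ => hside i, htop, zero_add, zero_sub, hal] at h1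
  have hbot : ∫ x in Icc (a ∘ (Fin.last n).succAbove) (c ∘ (Fin.last n).succAbove),
      Z (Fin.last n) (T ((Fin.last n).insertNth ε x))
      = ∫ x : EuclideanSpace ℝ (Fin n), Z (Fin.last n) (point x ε) := by
    rw [setIntegral_eq_integral_of_forall_compl_eq_zero]
    · simp only [hT, toLp_insertNth_last]
      exact (PiLp.volume_preserving_toLp (Fin n)).integral_comp
        (MeasurableEquiv.toLp 2 (Fin n → ℝ)).measurableEmbedding
        (fun x : EuclideanSpace ℝ (Fin n) => Z (Fin.last n) (point x ε))
    · intro x hx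
      have hup' : T ((Fin.last n).insertNth ε x) ∈ upperHalf n := by
        rw [hT, toLp_insertNth_last]
        exact point_mem_upperHalf _ hε
      refine hZR _ hup' ?_ _
      by_contra hlt
      push Not at hlt
      refine hx ⟨fun i => ?_, fun i => ?_⟩
      · have h2 := (hnorm ((Fin.last n).insertNth ε x) ((Fin.last n).succAbove i)).trans
          (hlt.le.trans hRR)
        rw [Fin.insertNth_apply_succAbove] at h2
        have h3 : a ((Fin.last n).succAbove i) = -R' := by
          simp [a, (Fin.castSucc_lt_last i).ne]
        show a ((Fin.last n).succAbove i) ≤ x i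
        rw [h3]
        exact (abs_le.1 h2).1
      · have h2 := (hnorm ((Fin.last n).insertNth ε x) ((Fin.last n).succAbove i)).trans
          (hlt.le.trans hRR)
        rw [Fin.insertNth_apply_succAbove] at h2
        exact (abs_le.1 h2).2
  rw [hbot] at h1
  have hms : MeasurableSet {X : Space n | ε ≤ height X} :=
    (isClosed_le continuous_const continuous_height).measurableSet
  have hlhs : ∫ x in Icc a c, d (T x) = ∫ X in {X : Space n | ε ≤ height X}, d X := by
    rw [← integral_indicator measurableSet_Icc, ← integral_indicator hms]
    rw [← (PiLp.volume_preserving_toLp (Fin (n + 1))).integral_comp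
        (MeasurableEquiv.toLp 2 (Fin (n + 1) → ℝ)).measurableEmbedding]
    congr 1
    ext x
    by_cases hx : x ∈ Icc a c
    · have h2 := hx.1 (Fin.last n)
      rw [hal] at h2
      rw [indicator_of_mem hx, indicator_of_mem (show (WithLp.toLp 2 x : Space n) ∈ _ from h2), hT]
    · rw [indicator_of_notMem hx]
      by_cases hx2 : (WithLp.toLp 2 x : Space n) ∈ {X : Space n | ε ≤ height X}
      · rw [indicator_of_mem hx2]
        refine (hdR _ (hε.trans_le hx2) ?_).symm
        by_contra hlt
        push Not at hlt
        have h3 : ∀ i, |x i| ≤ R' := fun i => (hnorm x i).trans (hlt.le.trans hRR)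
        refine hx ⟨fun i => ?_, fun i => (abs_le.1 (h3 i)).2⟩
        by_cases hi : i = Fin.last n
        · rw [hi, hal]
          exact hx2
        · simp only [a, hi, if_false]
          exact (abs_le.1 (h3 i)).1
      · rw [indicator_of_notMem hx2]
  rw [hlhs] at h1
  linarith

/-- The divergence theorem in the upper half space for compactly supported fields whose normal
component has a boundary trace `q`. -/
lemma integral_div_upperHalf (hZ : ∀ X ∈ upperHalf n, HasDiv Z (d X) X)
    (hd : ContinuousOn d (upperHalf n)) (hdi : IntegrableOn d (upperHalf n))
    (hZR : ∀ X ∈ upperHalf n, R ≤ ‖X‖ → ∀ i, Z i X = 0)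
    (hdR : ∀ X ∈ upperHalf n, R ≤ ‖X‖ → d X = 0)
    {C : ℝ} (hC : ∀ X ∈ upperHalf n, |Z (Fin.last n) X| ≤ C) {q : EuclideanSpace ℝ (Fin n) → ℝ}
    (hq : ∀ x, Tendsto (fun y : ℝ => Z (Fin.last n) (point x y)) (𝓝[>] 0) (𝓝 (q x))) :
    ∫ X in upperHalf n, d X = -∫ x, q x := by
  have hms : ∀ ε : ℝ, MeasurableSet {X : Space n | ε ≤ height X} := fun ε =>
    (isClosed_le continuous_const continuous_height).measurableSet
  -- Both sides of `flux_at_height` pass to the limit ε → 0 by dominated convergence: the volume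
  -- integral because d is integrable, the flux because the normal component is bounded with bounded
  -- support.
  have h1 : Tendsto (fun ε : ℝ => ∫ X in upperHalf n, {X : Space n | ε ≤ height X}.indicator d X)
      (𝓝[>] 0) (𝓝 (∫ X in upperHalf n, d X)) := by
    refine tendsto_integral_filter_of_dominated_convergence (fun X => ‖d X‖) ?_ ?_ hdi.norm ?_
    · exact Eventually.of_forall fun ε => hdi.aestronglyMeasurable.indicator (hms ε)
    · exact Eventually.of_forall fun ε => Eventually.of_forall fun X =>
        norm_indicator_le_norm_self _ _
    · filter_upwards [ae_restrict_mem isOpen_upperHalf.measurableSet] with X hX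
      refine tendsto_const_nhds.congr' ?_
      have hX' : 0 < height X := hX
      filter_upwards [Ioo_mem_nhdsGT hX'] with ε hε
      rw [indicator_of_mem (show X ∈ {X : Space n | ε ≤ height X} from hε.2.le)]
  have h2 : Tendsto (fun ε : ℝ => ∫ x : EuclideanSpace ℝ (Fin n), Z (Fin.last n) (point x ε))
      (𝓝[>] 0) (𝓝 (∫ x, q x)) := by
    refine tendsto_integral_filter_of_dominated_convergence
      ((Metric.closedBall (0 : EuclideanSpace ℝ (Fin n)) R).indicator fun _ => |C|) ?_ ?_ ?_ ?_
    · filter_upwards [self_mem_nhdsWithin] with ε hε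
      refine Continuous.aestronglyMeasurable (continuous_iff_continuousAt.2 fun x => ?_)
      exact ((hZ _ (point_mem_upperHalf x hε)).1 _).continuousAt.comp
        (f := fun x => point x ε) (continuous_point.comp (by fun_prop :
          Continuous fun x : EuclideanSpace ℝ (Fin n) => (x, ε))).continuousAt
    · filter_upwards [self_mem_nhdsWithin] with ε hε
      refine Eventually.of_forall fun x => ?_
      by_cases hx : ‖x‖ ≤ R
      · rw [indicator_of_mem (by simpa using hx)]
        exact (hC _ (point_mem_upperHalf x hε)).trans (le_abs_self C)
      · rw [indicator_of_notMem (by simpa using hx), hZR _ (point_mem_upperHalf x hε), norm_zero]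
        push Not at hx
        have h3 := norm_point_sq x ε
        refine hx.le.trans ?_
        rw [← sq_le_sq₀ (norm_nonneg _) (norm_nonneg _), h3]
        nlinarith
    · rw [integrable_indicator_iff Metric.isClosed_closedBall.measurableSet]
      exact integrableOn_const (isCompact_closedBall _ _).measure_lt_top.ne
    · exact Eventually.of_forall hq
  have h3 : ∀ᶠ ε : ℝ in 𝓝[>] 0, -∫ X in upperHalf n, {X : Space n | ε ≤ height X}.indicator d X
      = ∫ x : EuclideanSpace ℝ (Fin n), Z (Fin.last n) (point x ε) := by
    filter_upwards [self_mem_nhdsWithin] with ε hε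
    have hε' : 0 < ε := hε
    have hsub : upperHalf n ∩ {X : Space n | ε ≤ height X} = {X : Space n | ε ≤ height X} :=
      inter_eq_right.2 fun X (hX : ε ≤ height X) => show 0 < height X from hε'.trans_le hX
    rw [flux_at_height hZ hd hZR hdR hε, setIntegral_indicator (hms ε),
      hsub]
  have h4 := tendsto_nhds_unique (h1.neg.congr' h3) h2
  linarith

end Flux

end LaneEmden
end

/-! ### Radial cutoffs and integration by parts on half spheres. -/

noncomputable section

namespace LaneEmden

open Set Filter Topology MeasureTheory
open scoped ContDiff

variable {n : ℕ}

lemma ExtendsContinuously.continuousOn {f : Space n → ℝ} (hf : ExtendsContinuously f) :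
    ContinuousOn f (upperHalf n) := by
  obtain ⟨F, hF, hFf⟩ := hf
  exact (hF.mono upperHalf_subset).congr hFf.symm

lemma extendsContinuously_of_continuous {f : Space n → ℝ} (hf : Continuous f) :
    ExtendsContinuously f := .of_continuousOn hf.continuousOn

lemma ExtendsContinuously.sum {ι : Type*} (s : Finset ι) {F : ι → Space n → ℝ}
    (hF : ∀ i ∈ s, ExtendsContinuously (F i)) :
    ExtendsContinuously (fun X => ∑ i ∈ s, F i X) := by
  classical
  induction s using Finset.induction_on with
  | empty => simpa using extendsContinuously_of_continuous continuous_const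
  | insert a s ha ih =>
    simp only [Finset.sum_insert ha]
    exact (hF a (Finset.mem_insert_self a s)).add
      (ih fun i hi => hF i (Finset.mem_insert_of_mem hi))

lemma Tame.mul_extends {β : ℝ} {F G : Space n → ℝ} (hF : Tame β F)
    (hG : ExtendsContinuously G) : Tame β (fun X => G X * F X) :=
  hF.mul_bounded hG.continuousOn hG.locallyBounded

lemma tame_weight_mul {b : ℝ} {f : Space n → ℝ} (hf : ExtendsContinuously f) :
    Tame |b| (fun X => height X ^ b * f X) :=
  ((tame_height_rpow (neg_abs_le b)).mul_extends hf).congr fun _ _ => mul_comm _ _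

/-- Functions with one derivative that is controlled up to the boundary. -/
structure Admissible (b : ℝ) (f : Space n → ℝ) : Prop where
  smooth : SmoothUpper 1 f
  extends_self : ExtendsContinuously f
  extends_tangential : ∀ i, ExtendsContinuously (partialX i f)
  extends_conormal : ExtendsContinuously (conormal b f)

/-- Functions with two derivatives that are controlled up to the boundary, with vanishing conormal
derivative. -/
structure NeumannAdmissible (b : ℝ) (f : Space n → ℝ) : Prop extends Admissible b f where
  smooth_two : SmoothUpper 2 f
  extends_euler_euler : ExtendsContinuously (euler (euler f))
  extends_laplacian : ExtendsContinuously (weightedLaplacian b f)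
  vanishes : VanishesOnBoundary (conormal b f)

section

variable {b : ℝ}

/-- The normal part is y ∂_y = y^{1-b} (y^b ∂_y), with a nonnegative power in front of the conormal
derivative. -/
lemma Admissible.extends_euler (hb : b < 1) {f : Space n → ℝ} (hf : Admissible b f) :
    ExtendsContinuously (euler f) := by
  refine ((ExtendsContinuously.sum Finset.univ fun (i : Fin n) _ =>
    (extendsContinuously_of_continuous (contDiff_coord (k := 0) i.castSucc).continuous).mul
      (hf.extends_tangential i)).add ((extendsContinuously_height_rpow (by linarith : 0 ≤ 1 - b)).mul
        hf.extends_conormal)).congr fun X hX => ?_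
  have hX' : 0 < height X := hX
  show euler f X = (∑ i : Fin n, X i.castSucc * partialX i f X)
    + height X ^ (1 - b) * (height X ^ b * partialY f X)
  rw [euler_eq_sum, ← mul_assoc, ← Real.rpow_add hX', partialY_eq_dir]
  simp [partialX_eq_dir]

/-- The normal part y^b ∂_y f ∂_y g is y^{-b} times a product of conormal derivatives. Both weights
y^b and y^{-b} thus occur, which is why singularities are measured by y^{-|b|}. -/
lemma weight_mul_gradDot (b : ℝ) (f g : Space n → ℝ) {X : Space n} (hX : X ∈ upperHalf n) :
    height X ^ b * gradDot f g X = height X ^ b * (∑ i : Fin n, partialX i f X * partialX i g X)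
      + height X ^ (-b) * (conormal b f X * conormal b g X) := by
  have hX' : 0 < height X := hX
  have h : height X ^ (-b) * (height X ^ b * height X ^ b) = height X ^ b := by
    rw [← Real.rpow_add hX', ← Real.rpow_add hX']
    congr 1
    ring
  simp only [gradDot, Fin.sum_univ_castSucc, conormal, partialY_eq_dir, partialX_eq_dir]
  linear_combination (-dir (basisVec (Fin.last n)) f X * dir (basisVec (Fin.last n)) g X) * h

lemma Admissible.tame_gradDot {f g : Space n → ℝ} (hf : Admissible b f) (hg : Admissible b g) :
    Tame |b| (fun X => height X ^ b * gradDot f g X) := by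
  refine Tame.congr (F := fun X => height X ^ b * (∑ i : Fin n, partialX i f X * partialX i g X)
      + height X ^ (-b) * (conormal b f X * conormal b g X)) ((tame_weight_mul
      (.sum _ fun i _ => (hf.extends_tangential i).mul (hg.extends_tangential i))).add ?_)
      fun X hX => weight_mul_gradDot b f g hX
  have h := tame_weight_mul (b := -b) (hf.extends_conormal.mul hg.extends_conormal)
  rwa [abs_neg] at h

/-- The spherical part `|X|² Δ_b f - (X · ∇)² f - (n + b - 1) X · ∇ f` of `|X|² Δ_b f`. -/
def sphLaplacian (b : ℝ) (f : Space n → ℝ) (X : Space n) : ℝ :=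
  ‖X‖ ^ 2 * weightedLaplacian b f X - euler (euler f) X - (n + b - 1) * euler f X

/-- The spherical part of `|X|² ∇f · ∇g`. -/
def sphGradDot (f g : Space n → ℝ) (X : Space n) : ℝ :=
  ‖X‖ ^ 2 * gradDot f g X - euler f X * euler g X

lemma sphGradDot_comm (f g : Space n → ℝ) : sphGradDot f g = sphGradDot g f := by
  ext X
  rw [sphGradDot, sphGradDot, gradDot_comm, mul_comm (euler f X)]

lemma NeumannAdmissible.extends_sphLaplacian (hb : b < 1) {f : Space n → ℝ}
    (hf : NeumannAdmissible b f) : ExtendsContinuously (sphLaplacian b f) := by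
  refine (((extendsContinuously_normSq.mul hf.extends_laplacian).add
    (hf.extends_euler_euler.const_mul (-1))).add
    ((hf.extends_euler hb).const_mul (-(n + b - 1)))).congr fun X _ => ?_
  rw [sphLaplacian]
  ring

lemma Admissible.tame_sphGradDot (hb : b < 1) {f g : Space n → ℝ} (hf : Admissible b f)
    (hg : Admissible b g) : Tame |b| (fun X => height X ^ b * sphGradDot f g X) := by
  refine (((hf.tame_gradDot hg).mul_extends extendsContinuously_normSq).add
    ((tame_weight_mul (b := b) ((hf.extends_euler hb).mul (hg.extends_euler hb))).const_mul
      (-1))).congr fun X _ => ?_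
  simp only [sphGradDot]
  ring

end

lemma dir_radial {φ : ℝ → ℝ} {X : Space n} (hX : X ≠ 0) {c : ℝ}
    (hφ : HasDerivAt φ (‖X‖ * c) ‖X‖) (v : Space n) :
    dir v (fun Y => φ ‖Y‖) X = c * inner ℝ X v := by
  have hX' : ‖X‖ ≠ 0 := norm_ne_zero_iff.2 hX
  have hd : DifferentiableAt ℝ (fun Y : Space n => ‖Y‖) X :=
    (contDiffAt_norm ℝ hX (n := 1)).differentiableAt (by norm_num)
  have h1 : dir v (fun Y : Space n => ‖Y‖ ^ 2) X = 2 * (‖X‖ * dir v (fun Y : Space n => ‖Y‖) X) := by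
    simp only [pow_two]
    rw [dir_mul hd hd]
    ring
  rw [dir_normSq] at h1
  have h2 : HasFDerivAt (fun Y : Space n => φ ‖Y‖) _ X := hφ.comp_hasFDerivAt X hd.hasFDerivAt
  rw [dir, h2.fderiv]
  show (‖X‖ * c) * dir v (fun Y : Space n => ‖Y‖) X = _
  linear_combination (-c / 2) * h1

lemma ne_zero_of_mem_upperHalf {X : Space n} (hX : X ∈ upperHalf n) : X ≠ 0 := by
  rintro rfl
  exact lt_irrefl (0 : ℝ) hX

lemma euler_eq_sum_basis (f : Space n → ℝ) (X : Space n) :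
    euler f X = ∑ i, X i * dir (basisVec i) f X := by
  rw [euler_eq_dir, dir_eq_sum]

/-- The divergence theorem tested against a radial cutoff `φ(|X|)`, where `φ'(r) = r ψ(r)`. -/
lemma integral_cutoff_div {β : ℝ} (hβ : β < 1) {W : Fin (n + 1) → Space n → ℝ}
    {d Y F : Space n → ℝ} (hW : ∀ X ∈ upperHalf n, HasDiv W (d X) X) (hd : Tame β d)
    (hY : Tame β Y) (hWY : ∀ X ∈ upperHalf n, ∑ i, X i * W i X = Y X)
    (hF : ContinuousOn F (closedUpperHalf n)) (hFW : EqOn F (W (Fin.last n)) (upperHalf n))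
    {φ ψ : ℝ → ℝ} {R : ℝ} (hφ : ∀ r, 0 < r → HasDerivAt φ (r * ψ r) r) (hφc : Continuous φ)
    (hψc : Continuous ψ) (hφR : ∀ r, R ≤ r → φ r = 0) (hψR : ∀ r, R ≤ r → ψ r = 0) :
    (∫ X in upperHalf n, φ ‖X‖ * d X) + (∫ X in upperHalf n, ψ ‖X‖ * Y X)
      = -∫ x : EuclideanSpace ℝ (Fin n), φ ‖x‖ * F (point x 0) := by
  have hφe : ExtendsContinuously (fun X : Space n => φ ‖X‖) :=
    extendsContinuously_of_continuous (hφc.comp continuous_norm)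
  have hψe : ExtendsContinuously (fun X : Space n => ψ ‖X‖) :=
    extendsContinuously_of_continuous (hψc.comp continuous_norm)
  have ht1 : Tame β (fun X => φ ‖X‖ * d X) := hd.mul_extends hφe
  have ht2 : Tame β (fun X => ψ ‖X‖ * Y X) := hY.mul_extends hψe
  have hi1 := ht1.integrableOn_of_support hβ (R := R) fun X _ hX => by
    simp only [hφR _ hX, zero_mul]
  have hi2 := ht2.integrableOn_of_support hβ (R := R) fun X _ hX => by
    simp only [hψR _ hX, zero_mul]
  have hφd : ∀ X ∈ upperHalf n, DifferentiableAt ℝ (fun Y : Space n => φ ‖Y‖) X := fun X hX =>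
    ((hφ _ (norm_pos_iff.2 (ne_zero_of_mem_upperHalf hX))).differentiableAt).comp X
      ((contDiffAt_norm ℝ (ne_zero_of_mem_upperHalf hX) (n := 1)).differentiableAt (by norm_num))
  have hZ : ∀ X ∈ upperHalf n, HasDiv (fun i X => φ ‖X‖ * W i X)
      (φ ‖X‖ * d X + ψ ‖X‖ * Y X) X := by
    intro X hX
    have h := (hW X hX).mul (hφd X hX)
    have hX0 := ne_zero_of_mem_upperHalf hX
    have e : ∑ i, dir (basisVec i) (fun Y : Space n => φ ‖Y‖) X * W i X = ψ ‖X‖ * Y X := by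
      rw [← hWY X hX, Finset.mul_sum]
      refine Finset.sum_congr rfl fun i _ => ?_
      rw [dir_radial hX0 (hφ _ (norm_pos_iff.2 hX0))]
      simp only [EuclideanSpace.inner_single_right, one_mul, conj_trivial]
      ring
    rwa [e] at h
  have hWe : ExtendsContinuously (fun X => φ ‖X‖ * W (Fin.last n) X) :=
    hφe.mul ⟨F, hF, hFW⟩
  obtain ⟨C, hC⟩ := hWe.locallyBounded R
  have key := integral_div_upperHalf (R := R) hZ (ht1.add ht2).continuousOn (hi1.add hi2)
    (fun X _ hX i => by simp only [hφR _ hX, zero_mul])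
    (fun X _ hX => by simp only [hφR _ hX, hψR _ hX, zero_mul, add_zero]) (C := |C|)
    (fun X hX => by
      rcases le_total R ‖X‖ with h | h
      · simp only [hφR _ h, zero_mul, abs_zero, abs_nonneg]
      · exact (hC X hX h).trans (le_abs_self C))
    (q := fun x => φ ‖x‖ * F (point x 0)) (fun x => by
      have h := (tendsto_point x (hφc.comp continuous_norm).continuousOn).mul
        (tendsto_point_of_eqOn x hF hFW)
      simpa only [Function.comp, norm_point_zero] using h)
  rw [← key]
  exact (integral_add hi1 hi2).symm

/-- The fundamental lemma of the calculus of variations gives the conclusion for almost every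
radius; continuity extends it to every radius. Surface identities are obtained in this way from
volume identities with radial test functions. -/
lemma eqOn_zero_of_integral_eq_zero {f : ℝ → ℝ} (hf : ContinuousOn f (Ioi 0))
    (h : ∀ φ : ℝ → ℝ, ContDiff ℝ ∞ φ → HasCompactSupport φ → tsupport φ ⊆ Ioi 0 →
      ∫ r in Ioi (0 : ℝ), φ r * f r = 0) : ∀ r, 0 < r → f r = 0 := by
  have hae := isOpen_Ioi.ae_eq_zero_of_integral_contDiff_smul_eq_zero (μ := volume)
    (hf.locallyIntegrableOn measurableSet_Ioi) (fun φ h1 h2 h3 => by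
      rw [← h φ h1 h2 h3]
      simp only [smul_eq_mul]
      refine (setIntegral_eq_integral_of_forall_compl_eq_zero fun r hr => ?_).symm
      rw [image_eq_zero_of_notMem_tsupport fun hr' => hr (h3 hr'), zero_mul])
  have hae' : f =ᵐ[volume.restrict (Ioi 0)] fun _ => 0 :=
    (ae_restrict_iff' measurableSet_Ioi).2 hae
  exact fun r hr => Measure.eqOn_open_of_ae_eq hae' isOpen_Ioi hf continuousOn_const hr

lemma exists_cutoff_radius {φ : ℝ → ℝ} (h : HasCompactSupport φ) :
    ∃ R : ℝ, 0 < R ∧ ∀ r, R ≤ r → r ∉ tsupport φ := by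
  obtain ⟨R, hR⟩ := h.isBounded.subset_closedBall (0 : ℝ)
  refine ⟨max R 0 + 1, by positivity, fun r hr hmem => ?_⟩
  have h1 := hR hmem
  rw [mem_closedBall_zero_iff, Real.norm_eq_abs] at h1
  linarith [le_abs_self r, le_max_left R 0]

lemma continuous_div_of_tsupport_subset {χ : ℝ → ℝ} (hχ : Continuous χ)
    (hs : tsupport χ ⊆ Ioi 0) : Continuous fun r => χ r / r := by
  refine continuous_iff_continuousAt.2 fun r => ?_
  by_cases hr : r ∈ tsupport χ
  · exact hχ.continuousAt.div continuousAt_id (ne_of_gt (hs hr))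
  · have h0 : (fun r => χ r / r) =ᶠ[𝓝 r] fun _ => 0 := by
      filter_upwards [(isClosed_tsupport χ).isOpen_compl.mem_nhds hr] with t ht
      rw [image_eq_zero_of_notMem_tsupport ht, zero_div]
    exact (continuousAt_const (y := (0 : ℝ))).congr h0.symm

lemma integral_radial_mul {β : ℝ} (hβ : β < 1) {F : Space n → ℝ} (hF : Tame β F) {φ : ℝ → ℝ}
    (hφc : Continuous φ) {R : ℝ} (hφR : ∀ r, R ≤ r → φ r = 0) :
    ∫ X in upperHalf n, φ ‖X‖ * F X
      = ∫ r in Ioi (0 : ℝ), φ r * (r ^ n * sphereMean F r) := by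
  have ht : Tame β (fun X => φ ‖X‖ * F X) :=
    hF.mul_extends (extendsContinuously_of_continuous (hφc.comp continuous_norm))
  rw [integral_upperHalf_polar (ht.integrableOn_of_support hβ (R := R) fun X _ hX => by
    simp only [hφR _ hX, zero_mul])]
  refine setIntegral_congr_fun measurableSet_Ioi fun r hr => ?_
  have hr' : 0 < r := hr
  simp only [sphereMean]
  have e : ∀ θ : Metric.sphere (0 : Space n) 1, ‖r • (θ : Space n)‖ = r := fun θ => by
    rw [norm_smul, norm_sphere, mul_one, Real.norm_eq_abs, abs_of_pos hr']
  simp only [e]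
  rw [integral_const_mul]
  ring

section SphereIBP

variable {b : ℝ} (hb : -1 < b) (hb' : b < 1)
include hb hb'

/-- Integration by parts on the upper half sphere. -/
theorem sphereMean_integration_by_parts {f g : Space n → ℝ} (hf : Admissible b f)
    (hg : NeumannAdmissible b g) {r : ℝ} (hr : 0 < r) :
    sphereMean (fun X => height X ^ b * (f X * sphLaplacian b g X + sphGradDot f g X)) r = 0 := by
  have hβ : |b| < 1 := abs_lt.2 ⟨hb, hb'⟩
  have hJ : Tame |b|
      (fun X => height X ^ b * (f X * sphLaplacian b g X + sphGradDot f g X)) := by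
    refine ((tame_weight_mul (b := b) (hf.extends_self.mul (hg.extends_sphLaplacian hb'))).add
      (hf.tame_sphGradDot hb' hg.toAdmissible)).congr fun X _ => ?_
    ring
  have hA : SmoothUpper 1 (fun X => ‖X‖ ^ 2 * f X) := .mul (smoothUpper_normSq 1) hf.smooth
  have heg : SmoothUpper 1 (euler g) := SmoothUpper.euler hg.smooth_two
  have hB : SmoothUpper 1 (fun X => height X ^ b * (f X * euler g X)) :=
    .mul (smoothUpper_height_rpow 1 b) (.mul hf.smooth heg)
  -- The field y^b f (|X|² ∇g - (X · ∇g) X) is tangent to spheres, and its divergence is the desired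
  -- integrand.
  set W : Fin (n + 1) → Space n → ℝ := fun i X =>
    height X ^ b * (‖X‖ ^ 2 * f X) * dir (basisVec i) g X
      + (-1) * (height X ^ b * (f X * euler g X) * X i) with hWdef
  have hnorm : ∀ X : Space n, ∑ i, X i * X i = ‖X‖ ^ 2 := fun X => by
    rw [EuclideanSpace.norm_sq_eq]
    simp only [Real.norm_eq_abs, sq_abs]
    exact Finset.sum_congr rfl fun i _ => (pow_two _).symm
  have hW : ∀ X ∈ upperHalf n, HasDiv W
      (height X ^ b * (f X * sphLaplacian b g X + sphGradDot f g X)) X := by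
    intro X hX
    have h := (hasDiv_weighted b hA hg.smooth_two hX).add
      ((hasDiv_radial (hB.differentiableAt le_rfl hX)).const_mul (-1))
    have dn := (smoothUpper_normSq (n := n) 1).differentiableAt le_rfl hX
    have dy := (smoothUpper_height_rpow (n := n) 1 b).differentiableAt le_rfl hX
    have df := hf.smooth.differentiableAt le_rfl hX
    have dg := heg.differentiableAt le_rfl hX
    have e1 : gradDot (fun X => ‖X‖ ^ 2 * f X) g X
        = ‖X‖ ^ 2 * gradDot f g X + 2 * f X * euler g X := by
      simp only [gradDot, dir_mul dn df, dir_normSq, EuclideanSpace.inner_single_right, one_mul,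
        conj_trivial, euler_eq_sum_basis, Finset.mul_sum, ← Finset.sum_add_distrib]
      refine Finset.sum_congr rfl fun i _ => ?_
      ring
    have e2 : euler (fun X => height X ^ b * (f X * euler g X)) X
        = height X ^ b * (b * (f X * euler g X) + euler f X * euler g X
          + f X * euler (euler g) X) := by
      rw [euler_mul dy (df.fun_mul dg), euler_mul df dg, euler_height_rpow b hX]
      ring
    rw [e1, e2] at h
    convert h using 1
    rw [sphLaplacian, sphGradDot]
    ring
  have hWY : ∀ X ∈ upperHalf n, ∑ i, X i * W i X = 0 := by
    intro X _
    have e : ∑ i, X i * W i X = height X ^ b * (‖X‖ ^ 2 * f X) * (∑ i, X i * dir (basisVec i) g X)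
        - height X ^ b * (f X * euler g X) * ∑ i, X i * X i := by
      simp only [hWdef, Finset.mul_sum, ← Finset.sum_sub_distrib]
      refine Finset.sum_congr rfl fun i _ => ?_
      ring
    rw [e, hnorm, ← euler_eq_sum_basis]
    ring
  have hWl : EqOn (W (Fin.last n)) (fun X => (‖X‖ ^ 2 * f X) * conormal b g X
      + ((-1) * (f X * euler g X)) * height X ^ (b + 1)) (upperHalf n) := by
    intro X hX
    have hX' : 0 < height X := hX
    simp only [hWdef, conormal, partialY_eq_dir]
    rw [Real.rpow_add_one hX'.ne', height]
    ring
  have hfe := hf.extends_self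
  have hge := hg.toAdmissible.extends_euler hb'
  obtain ⟨F, hF, hFW⟩ : ExtendsContinuously (W (Fin.last n)) :=
    (((extendsContinuously_normSq.mul hfe).mul hg.extends_conormal).add
      (((hfe.mul hge).const_mul (-1)).mul
        (extendsContinuously_height_rpow (by linarith : 0 ≤ b + 1)))).congr hWl
  -- No flux passes through {y = 0}: the gradient part vanishes by the Neumann condition on g, the
  -- radial part carries y^{b+1} → 0.
  have hF0 : ∀ x, F (point x 0) = 0 := by
    have hv : VanishesOnBoundary (W (Fin.last n)) :=
      ((hg.vanishes.mul_extends (extendsContinuously_normSq.mul hfe)).add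
        ((vanishesOnBoundary_height_rpow (by linarith : 0 < b + 1)).mul_extends
          ((hfe.mul hge).const_mul (-1)))).congr hWl
    exact fun x => tendsto_nhds_unique (tendsto_point_of_eqOn x hF hFW) (hv x)
  have hcont : ContinuousOn (fun r => r ^ n * sphereMean (fun X => height X ^ b *
      (f X * sphLaplacian b g X + sphGradDot f g X)) r) (Ioi 0) :=
    (continuous_pow n).continuousOn.mul (hJ.continuousOn_sphereMean (abs_nonneg b) hβ)
  -- As the field has no radial component, the derivative of the cutoff never contributes, and the
  -- mean of the divergence vanishes when tested against any φ.
  have hzero := eqOn_zero_of_integral_eq_zero hcont fun φ h1 h2 h3 => by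
    obtain ⟨R, _, hR⟩ := exists_cutoff_radius h2
    have hφR : ∀ r, R ≤ r → φ r = 0 := fun r hr => image_eq_zero_of_notMem_tsupport (hR r hr)
    have hdφ : tsupport (deriv φ) ⊆ tsupport φ := closure_minimal support_deriv_subset (isClosed_tsupport φ)
    have hψR : ∀ r, R ≤ r → deriv φ r / r = 0 := fun r hr => by
      rw [image_eq_zero_of_notMem_tsupport fun h => hR r hr (hdφ h), zero_div]
    have h4 := integral_cutoff_div hβ hW hJ (Y := fun _ => 0)
      ⟨continuousOn_const, fun _ => ⟨0, by simp⟩⟩ hWY hF hFW (φ := φ) (ψ := fun r => deriv φ r / r)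
      (R := R) (fun r hr => by
        have := (h1.differentiable (by norm_num) r).hasDerivAt
        rwa [mul_div_cancel₀ _ hr.ne']) h1.continuous
      (continuous_div_of_tsupport_subset (h1.continuous_deriv (by norm_num)) (hdφ.trans h3)) hφR hψR
    simp only [hF0, mul_zero, integral_zero, add_zero, neg_zero] at h4
    rw [integral_radial_mul hβ hJ h1.continuous hφR] at h4
    exact h4
  have := hzero r hr
  exact (mul_eq_zero.1 this).resolve_left (pow_pos hr n).ne'

end SphereIBP

end LaneEmden
end

/-! ### The divergence theorem and Green's identity on half balls. -/

noncomputable section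

namespace LaneEmden

open Set Filter Topology MeasureTheory
open scoped ContDiff

variable {n : ℕ}

section LayerCake

variable {E : Type*} [NormedAddCommGroup E] [MeasurableSpace E] [BorelSpace E] {μ : Measure E}
  {q : E → ℝ}

/-- The indicator of the ball of radius t converges as t → r off the sphere of radius r, which is a
null set. -/
lemma continuousOn_integral_ball (hq : ∀ R : ℝ, IntegrableOn q (Metric.ball 0 R) μ)
    (hμ : ∀ r : ℝ, 0 < r → μ (Metric.sphere 0 r) = 0) :
    ContinuousOn (fun r : ℝ => ∫ X in Metric.ball 0 r, q X ∂μ) (Ioi 0) := by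
  intro r hr
  have hr' : 0 < r := hr
  refine ContinuousAt.continuousWithinAt ?_
  simp only [← integral_indicator Metric.isOpen_ball.measurableSet]
  have hm : ∀ R : ℝ, MeasurableSet (Metric.ball (0 : E) R) :=
    fun R => Metric.isOpen_ball.measurableSet
  refine continuousAt_of_dominated
    (bound := (Metric.ball (0 : E) (r + 1)).indicator fun X => ‖q X‖) ?_ ?_ ?_ ?_
  · exact Eventually.of_forall fun t =>
      (((hq t).integrable_indicator (hm t))).aestronglyMeasurable
  · filter_upwards [Iio_mem_nhds (by linarith : r < r + 1)] with t ht
    refine Eventually.of_forall fun X => ?_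
    rw [norm_indicator_eq_indicator_norm]
    exact indicator_le_indicator_of_subset (Metric.ball_subset_ball (le_of_lt ht))
      (fun _ => norm_nonneg _) X
  · exact IntegrableOn.integrable_indicator ((hq (r + 1)).norm) (hm _)
  · have hs : ∀ᵐ X ∂μ, X ∉ Metric.sphere (0 : E) r := measure_eq_zero_iff_ae_notMem.1 (hμ r hr')
    filter_upwards [hs] with X hX
    have hne : ‖X‖ ≠ r := by simpa using hX
    refine continuousAt_const.congr (f := fun _ => (Metric.ball (0 : E) r).indicator q X) ?_
    rcases lt_or_gt_of_ne hne with h | h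
    · filter_upwards [Ioi_mem_nhds h] with t ht
      rw [indicator_of_mem (by simpa using h), indicator_of_mem (by simpa using ht)]
    · filter_upwards [Iio_mem_nhds h] with t ht
      rw [indicator_of_notMem (by simpa using h.le),
        indicator_of_notMem (by simpa using le_of_lt ht)]

/-- Fubini on the set {‖X‖ < r}. It turns an integral against a primitive of φ into a test of the
ball integrals against φ itself. -/
lemma integral_radial_primitive [SFinite μ] (hq : ∀ R : ℝ, IntegrableOn q (Metric.ball 0 R) μ)
    {φ : ℝ → ℝ} (hφ : Continuous φ) {R : ℝ} (hφR : ∀ r, R ≤ r → φ r = 0) :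
    ∫ X, (∫ t in ‖X‖..R, φ t) * q X ∂μ
      = ∫ r in Ioi (0 : ℝ), φ r * ∫ X in Metric.ball 0 r, q X ∂μ := by
  have hm : ∀ r : ℝ, MeasurableSet (Metric.ball (0 : E) r) :=
    fun r => Metric.isOpen_ball.measurableSet
  have hφi : IntegrableOn φ (Ioi 0) := by
    have h1 : IntegrableOn φ (Icc 0 R) := hφ.continuousOn.integrableOn_Icc
    refine h1.of_forall_sdiff_eq_zero measurableSet_Ioi fun r hr => hφR r ?_
    by_contra hlt
    push Not at hlt
    exact hr.2 ⟨le_of_lt hr.1, hlt.le⟩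
  have hS : MeasurableSet {z : E × ℝ | ‖z.1‖ < z.2} :=
    (isOpen_lt (continuous_norm.comp continuous_fst) continuous_snd).measurableSet
  have hint : Integrable (fun z : E × ℝ => {z : E × ℝ | ‖z.1‖ < z.2}.indicator
      (fun z => (Metric.ball (0 : E) R).indicator q z.1 * φ z.2) z)
      (μ.prod (volume.restrict (Ioi 0))) :=
    (((hq R).integrable_indicator (hm R)).mul_prod hφi).indicator hS
  have hswap := integral_integral_swap (f := fun X r => {z : E × ℝ | ‖z.1‖ < z.2}.indicator
    (fun z => (Metric.ball (0 : E) R).indicator q z.1 * φ z.2) (X, r)) hint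
  have hL : ∀ X : E, ∫ r in Ioi (0 : ℝ), {z : E × ℝ | ‖z.1‖ < z.2}.indicator
      (fun z => (Metric.ball (0 : E) R).indicator q z.1 * φ z.2) (X, r)
      = (∫ t in ‖X‖..R, φ t) * q X := by
    intro X
    have e1 : ∀ r : ℝ, {z : E × ℝ | ‖z.1‖ < z.2}.indicator
        (fun z => (Metric.ball (0 : E) R).indicator q z.1 * φ z.2) (X, r)
        = (Ioi ‖X‖).indicator (fun r => φ r * q X) r := by
      intro r
      by_cases h : ‖X‖ < r
      · rw [indicator_of_mem (show (X, r) ∈ {z : E × ℝ | ‖z.1‖ < z.2} from h),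
          indicator_of_mem (show r ∈ Ioi ‖X‖ from h)]
        by_cases hR : ‖X‖ < R
        · rw [indicator_of_mem (by simpa using hR), mul_comm]
        · rw [hφR r ((not_lt.1 hR).trans h.le), mul_zero, zero_mul]
      · rw [indicator_of_notMem (show (X, r) ∉ {z : E × ℝ | ‖z.1‖ < z.2} from h),
          indicator_of_notMem (show r ∉ Ioi ‖X‖ from h)]
    simp only [e1]
    rw [setIntegral_indicator measurableSet_Ioi,
      inter_eq_right.2 (Ioi_subset_Ioi (norm_nonneg X)), integral_mul_const]
    congr 1
    rcases le_total ‖X‖ R with h | h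
    · rw [intervalIntegral.integral_of_le h]
      refine (setIntegral_eq_of_subset_of_forall_sdiff_eq_zero measurableSet_Ioi
        Ioc_subset_Ioi_self fun r hr => hφR r ?_)
      by_contra hlt
      push Not at hlt
      exact hr.2 ⟨hr.1, hlt.le⟩
    · have h0 : ∫ t in Ioi ‖X‖, φ t = 0 :=
        setIntegral_eq_zero_of_forall_eq_zero fun r hr => hφR r (h.trans (le_of_lt hr))
      rw [h0, intervalIntegral.integral_of_ge h,
        setIntegral_eq_zero_of_forall_eq_zero fun r hr => hφR r (le_of_lt hr.1), neg_zero]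
  have hRR : ∀ r ∈ Ioi (0 : ℝ), ∫ X, {z : E × ℝ | ‖z.1‖ < z.2}.indicator
      (fun z => (Metric.ball (0 : E) R).indicator q z.1 * φ z.2) (X, r) ∂μ
      = φ r * ∫ X in Metric.ball 0 r, q X ∂μ := by
    intro r _
    rw [← integral_indicator (hm r), ← integral_const_mul]
    congr 1
    ext X
    by_cases h : ‖X‖ < r
    · rw [indicator_of_mem (show (X, r) ∈ {z : E × ℝ | ‖z.1‖ < z.2} from h),
        indicator_of_mem (show X ∈ Metric.ball 0 r by simpa using h)]
      by_cases hR : ‖X‖ < R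
      · rw [indicator_of_mem (by simpa using hR), mul_comm]
      · rw [hφR r ((not_lt.1 hR).trans h.le), mul_zero, zero_mul]
    · rw [indicator_of_notMem (show (X, r) ∉ {z : E × ℝ | ‖z.1‖ < z.2} from h),
        indicator_of_notMem (show X ∉ Metric.ball 0 r by simpa using h), mul_zero]
  simp only [hL] at hswap
  rw [hswap]
  exact setIntegral_congr_fun measurableSet_Ioi hRR

end LayerCake

lemma integrableOn_ball_boundary {F : Space n → ℝ} (hF : ContinuousOn F (closedUpperHalf n)) (R : ℝ) :
    IntegrableOn (fun x : EuclideanSpace ℝ (Fin n) => F (point x 0)) (Metric.ball 0 R) := by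
  have hc : Continuous fun x : EuclideanSpace ℝ (Fin n) => F (point x 0) :=
    hF.comp_continuous (continuous_point.comp (by fun_prop :
      Continuous fun x : EuclideanSpace ℝ (Fin n) => (x, (0 : ℝ))))
      fun x => point_mem_closedUpperHalf x le_rfl
  exact (hc.continuousOn.integrableOn_compact (isCompact_closedBall 0 R)).mono_set
    Metric.ball_subset_closedBall

/-- The divergence theorem on the upper half ball of radius `r`. -/
theorem integral_div_halfBall {β : ℝ} (hβ0 : 0 ≤ β) (hβ : β < 1)
    {W : Fin (n + 1) → Space n → ℝ} {d Y F : Space n → ℝ}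
    (hW : ∀ X ∈ upperHalf n, HasDiv W (d X) X) (hd : Tame β d)
    (hY : Tame β Y) (hWY : ∀ X ∈ upperHalf n, ∑ i, X i * W i X = Y X)
    (hF : ContinuousOn F (closedUpperHalf n)) (hFW : EqOn F (W (Fin.last n)) (upperHalf n))
    {r : ℝ} (hr : 0 < r) :
    ∫ X in upperHalf n ∩ Metric.ball 0 r, d X = r ^ n * sphereMean Y r / r
      - ∫ x in Metric.ball (0 : EuclideanSpace ℝ (Fin n)) r, F (point x 0) := by
  have hdi : ∀ R : ℝ, IntegrableOn d (Metric.ball 0 R) (volume.restrict (upperHalf n)) := by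
    intro R
    rw [IntegrableOn, Measure.restrict_restrict Metric.isOpen_ball.measurableSet, inter_comm]
    exact (hd.integrableOn hβ R).mono_set (inter_subset_inter_right _ Metric.ball_subset_closedBall)
  have hFi := integrableOn_ball_boundary hF
  have hc1 := continuousOn_integral_ball hdi (fun r hr => by
    refine le_antisymm ((Measure.restrict_apply_le _ _).trans_eq ?_) zero_le
    exact Measure.addHaar_sphere_of_ne_zero _ _ hr.ne')
  have hc2 := continuousOn_integral_ball hFi (fun r hr =>
    Measure.addHaar_sphere_of_ne_zero _ _ hr.ne')
  have hc3 : ContinuousOn (fun r => r ^ n * sphereMean Y r / r) (Ioi 0) :=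
    ((continuous_pow n).continuousOn.mul (hY.continuousOn_sphereMean hβ0 hβ)).div
      continuousOn_id fun r hr => ne_of_gt hr
  have hc : ContinuousOn (fun r =>
      (∫ X in Metric.ball 0 r, d X ∂(volume.restrict (upperHalf n))) - r ^ n * sphereMean Y r / r
        + ∫ x in Metric.ball (0 : EuclideanSpace ℝ (Fin n)) r, F (point x 0)) (Ioi 0) :=
    (hc1.sub hc3).add hc2
  have hzero := eqOn_zero_of_integral_eq_zero hc fun φ h1 h2 h3 => by
    obtain ⟨R, hR0, hR⟩ := exists_cutoff_radius h2
    have hφR : ∀ r, R ≤ r → φ r = 0 := fun r hr => image_eq_zero_of_notMem_tsupport (hR r hr)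
    -- The cutoff is the primitive of φ vanishing beyond R, so ψ = -φ / r. By
    -- `integral_radial_primitive` the tested identity becomes the claimed one, integrated in the
    -- radius against φ.
    have hΦd : ∀ r : ℝ, HasDerivAt (fun r => ∫ t in r..R, φ t) (-φ r) r := fun r =>
      intervalIntegral.integral_hasDerivAt_left (h1.continuous.intervalIntegrable _ _)
        (h1.continuous.stronglyMeasurableAtFilter _ _) h1.continuous.continuousAt
    have hΦR : ∀ r, R ≤ r → ∫ t in r..R, φ t = 0 := fun r hr => by
      rw [intervalIntegral.integral_of_ge hr,
        setIntegral_eq_zero_of_forall_eq_zero fun t ht => hφR t (le_of_lt ht.1), neg_zero]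
    have hψc := continuous_div_of_tsupport_subset h1.continuous h3
    have hcut := integral_cutoff_div hβ hW hd hY hWY hF hFW (φ := fun r => ∫ t in r..R, φ t)
      (ψ := fun r => -(φ r / r)) (R := R)
      (fun r hr => by
        have e : r * -(φ r / r) = -φ r := by
          field_simp
        rw [e]
        exact hΦd r)
      (continuous_iff_continuousAt.2 fun r => (hΦd r).continuousAt) hψc.neg hΦR
      (fun r hr => by rw [hφR r hr, zero_div, neg_zero])
    rw [integral_radial_primitive hdi h1.continuous hφR,
      integral_radial_primitive hFi h1.continuous hφR,
      integral_radial_mul hβ hY (φ := fun r => -(φ r / r)) hψc.neg (R := R)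
        (fun r hr => by rw [hφR r hr, zero_div, neg_zero])] at hcut
    have hint : ∀ f : ℝ → ℝ, ContinuousOn f (Ioi 0) →
        IntegrableOn (fun r => φ r * f r) (Ioi 0) := by
      intro f hf
      have hK : IntegrableOn (fun r => φ r * f r) (tsupport φ) :=
        (h1.continuous.continuousOn.mul (hf.mono h3)).integrableOn_compact h2
      refine hK.of_forall_sdiff_eq_zero measurableSet_Ioi fun r hr => ?_
      rw [image_eq_zero_of_notMem_tsupport hr.2, zero_mul]
    have e : ∀ r, φ r * ((∫ X in Metric.ball 0 r, d X ∂(volume.restrict (upperHalf n)))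
        - r ^ n * sphereMean Y r / r
        + ∫ x in Metric.ball (0 : EuclideanSpace ℝ (Fin n)) r, F (point x 0))
        = φ r * (∫ X in Metric.ball 0 r, d X ∂(volume.restrict (upperHalf n)))
          + (-(φ r / r) * (r ^ n * sphereMean Y r)
          + φ r * ∫ x in Metric.ball (0 : EuclideanSpace ℝ (Fin n)) r, F (point x 0)) := by
      intro r
      ring
    have hi3 : IntegrableOn (fun r => -(φ r / r) * (r ^ n * sphereMean Y r)) (Ioi 0) := by
      refine (hint _ hc3).neg.congr (Eventually.of_forall fun r => ?_)
      simp only [Pi.neg_apply]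
      ring
    refine (integral_congr_ae (Eventually.of_forall e)).trans ?_
    have hadd := integral_add hi3 (hint _ hc2)
    have hadd' := integral_add (hint _ hc1) (hi3.add (hint _ hc2))
    simp only [Pi.add_apply] at hadd'
    rw [hadd', hadd]
    linarith
  have h := hzero r hr
  rw [Measure.restrict_restrict Metric.isOpen_ball.measurableSet, inter_comm] at h
  linarith

section Green

variable {b : ℝ} (hb : -1 < b) (hb' : b < 1)
include hb hb'

/-- The integrated energy identity for a triharmonic pair: `g = Δ_b u`, `h = Δ_b² u`, and `v` with
`Δ_b v = w`. -/
theorem integral_gradDot_halfBall {g h v w : Space n → ℝ} (hg : NeumannAdmissible b g)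
    (hv : NeumannAdmissible b v) (hh : Admissible b h) (hh2 : SmoothUpper 2 h)
    (hw : Admissible b w) (hgh : EqOn (weightedLaplacian b g) h (upperHalf n))
    (hvw : EqOn (weightedLaplacian b v) w (upperHalf n))
    (hh0 : ∀ X ∈ upperHalf n, weightedLaplacian b h X = 0) {V K : Space n → ℝ}
    (hV : ContinuousOn V (closedUpperHalf n)) (hVv : EqOn V v (upperHalf n))
    (hK : ∀ x, Tendsto (fun y : ℝ => conormal b h (point x y)) (𝓝[>] 0) (𝓝 (K (point x 0))))
    {r : ℝ} (hr : 0 < r) :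
    ∫ X in upperHalf n ∩ Metric.ball 0 r, height X ^ b * gradDot w g X
      = r ^ n * sphereMean (fun X => height X ^ b * (w X * euler g X
        + (-1) * (h X * euler v X) + v X * euler h X)) r / r
        - ∫ x in Metric.ball (0 : EuclideanSpace ℝ (Fin n)) r, V (point x 0) * K (point x 0) := by
  have hβ : |b| < 1 := abs_lt.2 ⟨hb, hb'⟩
  -- In the divergence of y^b (w ∇g - h ∇v + v ∇h) the products w Δ_b g and h Δ_b v are both w h and
  -- cancel, the two products ∇h · ∇v cancel, and v Δ_b h = 0.
  set W : Fin (n + 1) → Space n → ℝ := fun i X =>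
    (height X ^ b * w X * dir (basisVec i) g X
      + (-1) * (height X ^ b * h X * dir (basisVec i) v X))
      + height X ^ b * v X * dir (basisVec i) h X with hWdef
  have hW : ∀ X ∈ upperHalf n, HasDiv W (height X ^ b * gradDot w g X) X := by
    intro X hX
    have h1 := ((hasDiv_weighted b hw.smooth hg.smooth_two hX).add
      ((hasDiv_weighted b hh.smooth hv.smooth_two hX).const_mul (-1))).add
      (hasDiv_weighted b hv.smooth hh2 hX)
    rw [hgh hX, hvw hX, hh0 X hX, gradDot_comm v h] at h1
    convert h1 using 1
    ring
  have hY : Tame |b| (fun X => height X ^ b * (w X * euler g X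
      + (-1) * (h X * euler v X) + v X * euler h X)) :=
    tame_weight_mul (((hw.extends_self.mul (hg.extends_euler hb')).add
      ((hh.extends_self.mul (hv.extends_euler hb')).const_mul (-1))).add
      (hv.extends_self.mul (hh.extends_euler hb')))
  have hWY : ∀ X ∈ upperHalf n, ∑ i, X i * W i X = height X ^ b * (w X * euler g X
      + (-1) * (h X * euler v X) + v X * euler h X) := by
    intro X _
    simp only [hWdef, euler_eq_sum_basis, Finset.mul_sum, ← Finset.sum_add_distrib]
    refine Finset.sum_congr rfl fun i _ => ?_
    ring
  have hWl : EqOn (W (Fin.last n)) (fun X => w X * conormal b g X + (-1) * (h X * conormal b v X)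
      + v X * conormal b h X) (upperHalf n) := by
    intro X _
    simp only [hWdef, conormal, partialY_eq_dir]
    ring
  obtain ⟨F, hF, hFW⟩ : ExtendsContinuously (W (Fin.last n)) :=
    (((hw.extends_self.mul hg.extends_conormal).add
      ((hh.extends_self.mul hv.extends_conormal).const_mul (-1))).add
      (hv.extends_self.mul hh.extends_conormal)).congr hWl
  -- The Neumann conditions on g and v remove two of the three boundary terms; the conormal
  -- derivative of h carries the nonlinearity.
  have hF0 : ∀ x, F (point x 0) = V (point x 0) * K (point x 0) := by
    intro x
    refine tendsto_nhds_unique (tendsto_point_of_eqOn x hF (hFW.trans hWl)) ?_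
    have h1 := ((hg.vanishes.mul_extends hw.extends_self) x).add
      (((hv.vanishes.mul_extends hh.extends_self).const_mul (-1)) x)
    have h2 := (tendsto_point_of_eqOn x hV hVv).mul (hK x)
    simpa using h1.add h2
  rw [integral_div_halfBall (abs_nonneg b) hβ hW (hw.tame_gradDot hg.toAdmissible) hY hWY hF hFW hr]
  simp only [hF0]

end Green

end LaneEmden
end

/-! ### Commutation rules for X · ∇ + c and the count of derivatives. -/

noncomputable section

namespace LaneEmden

open Set Filter Topology

variable {n : ℕ}

/-- The shifted Euler operator `X · ∇ + c`. -/
def eulerShift (c : ℝ) (f : Space n → ℝ) (X : Space n) : ℝ := euler f X + c * f X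

lemma SmoothUpper.eulerShift {m : ℕ} (c : ℝ) {f : Space n → ℝ} (hf : SmoothUpper (m + 1) f) :
    SmoothUpper m (eulerShift c f) :=
  .add (SmoothUpper.euler hf) (.const_mul c (hf.mono (Nat.le_succ m)))

lemma eulerShift_congr (c : ℝ) {f g : Space n → ℝ} (h : EqOn f g (upperHalf n)) :
    EqOn (eulerShift c f) (eulerShift c g) (upperHalf n) := fun X hX => by
  simp only [eulerShift, euler_congr h hX, h hX]

lemma conormal_add (b : ℝ) {f g : Space n → ℝ} {X : Space n} (hf : DifferentiableAt ℝ f X)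
    (hg : DifferentiableAt ℝ g X) :
    conormal b (fun Y => f Y + g Y) X = conormal b f X + conormal b g X := by
  simp only [conormal, partialY_eq_dir, dir_add hf hg, mul_add]

lemma conormal_const_mul (b : ℝ) {f : Space n → ℝ} {X : Space n} (hf : DifferentiableAt ℝ f X)
    (c : ℝ) : conormal b (fun Y => c * f Y) X = c * conormal b f X := by
  simp only [conormal, partialY_eq_dir, dir_const_mul hf]
  ring

lemma weightedLaplacian_add (b : ℝ) {f g : Space n → ℝ} (hf : SmoothUpper 2 f)
    (hg : SmoothUpper 2 g) :
    EqOn (weightedLaplacian b (fun Y => f Y + g Y))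
      (fun X => weightedLaplacian b f X + weightedLaplacian b g X) (upperHalf n) := by
  intro X hX
  have h1 : ∀ v, EqOn (dir v (fun Y => f Y + g Y)) (fun Y => dir v f Y + dir v g Y)
      (upperHalf n) := fun v Y hY =>
    dir_add (hf.differentiableAt (by norm_num) hY) (hg.differentiableAt (by norm_num) hY) v
  have h2 : ∀ v, dir v (dir v (fun Y => f Y + g Y)) X = dir v (dir v f) X + dir v (dir v g) X :=
    fun v => by
      rw [dir_congr (h1 v) v hX, dir_add ((SmoothUpper.dir hf v).differentiableAt le_rfl hX)
        ((SmoothUpper.dir hg v).differentiableAt le_rfl hX)]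
  simp only [weightedLaplacian_eq b (hf.add hg) hX, weightedLaplacian_eq b hf hX,
    weightedLaplacian_eq b hg hX, h2, h1 _ hX, Finset.sum_add_distrib]
  ring

lemma weightedLaplacian_const_mul (b c : ℝ) {f : Space n → ℝ} (hf : SmoothUpper 2 f) :
    EqOn (weightedLaplacian b (fun Y => c * f Y)) (fun X => c * weightedLaplacian b f X)
      (upperHalf n) := by
  intro X hX
  have h1 : ∀ v, EqOn (dir v (fun Y => c * f Y)) (fun Y => c * dir v f Y)
      (upperHalf n) := fun v Y hY => dir_const_mul (hf.differentiableAt (by norm_num) hY) c v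
  have h2 : ∀ v, dir v (dir v (fun Y => c * f Y)) X = c * dir v (dir v f) X :=
    fun v => by
      rw [dir_congr (h1 v) v hX, dir_const_mul ((SmoothUpper.dir hf v).differentiableAt le_rfl hX)]
  simp only [weightedLaplacian_eq b (hf.const_mul c) hX, weightedLaplacian_eq b hf hX,
    h2, h1 _ hX, ← Finset.mul_sum]
  ring

/-- Δ_b lowers homogeneity by two, hence the shift of the constant by two. -/
lemma weightedLaplacian_eulerShift (b c : ℝ) {f : Space n → ℝ} (hf : SmoothUpper 3 f) :
    EqOn (weightedLaplacian b (eulerShift c f)) (eulerShift (c + 2) (weightedLaplacian b f))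
      (upperHalf n) := by
  intro X hX
  refine (weightedLaplacian_add b (SmoothUpper.euler hf)
    (.const_mul c (hf.mono (by norm_num))) hX).trans ?_
  simp only [weightedLaplacian_euler b hf hX,
    weightedLaplacian_const_mul b c (hf.mono (by norm_num)) hX, eulerShift]
  ring

lemma dir_normSq_mul {f : Space n → ℝ} {X : Space n} (hf : DifferentiableAt ℝ f X)
    (hX : X ∈ upperHalf n) (v : Space n) :
    dir v (fun Y => ‖Y‖ ^ 2 * f Y) X = ‖X‖ ^ 2 * dir v f X + 2 * inner ℝ X v * f X := by
  rw [dir_mul ((smoothUpper_normSq 1).differentiableAt le_rfl hX) hf, dir_normSq]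

lemma euler_normSq_mul {f : Space n → ℝ} {X : Space n} (hf : DifferentiableAt ℝ f X)
    (hX : X ∈ upperHalf n) :
    euler (fun Y => ‖Y‖ ^ 2 * f Y) X = ‖X‖ ^ 2 * (euler f X + 2 * f X) := by
  rw [euler_mul ((smoothUpper_normSq 1).differentiableAt le_rfl hX) hf, euler_normSq]
  ring

/-- Leibniz rule with ∇|X|² = 2 X and Δ_b |X|² = 2 (n + 1 + b). -/
lemma weightedLaplacian_normSq_mul (b : ℝ) {f : Space n → ℝ} (hf : SmoothUpper 2 f) :
    EqOn (weightedLaplacian b (fun Y => ‖Y‖ ^ 2 * f Y))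
      (fun X => ‖X‖ ^ 2 * weightedLaplacian b f X + 4 * euler f X + 2 * (n + 1 + b) * f X)
      (upperHalf n) := by
  intro X hX
  have h1 : ∀ i, EqOn (dir (basisVec i) (fun Y => ‖Y‖ ^ 2 * f Y))
      (fun Y => ‖Y‖ ^ 2 * dir (basisVec i) f Y + 2 * (Y i * f Y)) (upperHalf n) := by
    intro i Y hY
    rw [dir_normSq_mul (hf.differentiableAt (by norm_num) hY) hY]
    simp only [EuclideanSpace.inner_single_right, one_mul, conj_trivial]
    ring
  have hc : ∀ i, DifferentiableAt ℝ (fun Y : Space n => Y i) X :=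
    fun i => (contDiff_coord (k := 1) i).differentiable (by norm_num) X
  have df := hf.differentiableAt (by norm_num) hX
  have hd := fun i => (SmoothUpper.dir hf (basisVec i)).differentiableAt le_rfl hX
  have dn := (smoothUpper_normSq (n := n) 1).differentiableAt le_rfl hX
  have h2 : ∀ i, dir (basisVec i) (dir (basisVec i) (fun Y => ‖Y‖ ^ 2 * f Y)) X
      = ‖X‖ ^ 2 * dir (basisVec i) (dir (basisVec i) f) X + 4 * (X i * dir (basisVec i) f X)
        + 2 * f X := by
    intro i
    rw [dir_congr (h1 i) _ hX, dir_add (dn.fun_mul (hd i)) (((hc i).fun_mul df).const_mul 2),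
      dir_const_mul ((hc i).fun_mul df), dir_mul (hc i) df, dir_normSq_mul (hd i) hX, dir_coord]
    simp only [EuclideanSpace.inner_single_right, one_mul, conj_trivial, PiLp.single_apply, if_true]
    ring
  have hX' : 0 < height X := hX
  rw [weightedLaplacian_eq b (SmoothUpper.mul (smoothUpper_normSq 2) hf) hX, h1 _ hX]
  simp only [h2, weightedLaplacian_eq b hf hX, Finset.sum_add_distrib, ← Finset.mul_sum,
    ← euler_eq_sum_basis, Finset.sum_const, Finset.card_univ, Fintype.card_fin, nsmul_eq_mul]
  rw [show X (Fin.last n) = height X from rfl]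
  push_cast
  field_simp
  ring

lemma conormal_normSq_mul (b : ℝ) {f : Space n → ℝ} {X : Space n} (hf : DifferentiableAt ℝ f X)
    (hX : X ∈ upperHalf n) :
    conormal b (fun Y => ‖Y‖ ^ 2 * f Y) X
      = ‖X‖ ^ 2 * conormal b f X + 2 * (height X ^ (b + 1) * f X) := by
  have hX' : 0 < height X := hX
  rw [conormal, partialY_eq_dir, dir_normSq_mul hf hX, Real.rpow_add_one hX'.ne', conormal,
    partialY_eq_dir]
  simp only [EuclideanSpace.inner_single_right, one_mul, conj_trivial]
  rw [show X (Fin.last n) = height X from rfl]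
  ring

lemma partialX_normSq_mul {f : Space n → ℝ} {X : Space n} (hf : DifferentiableAt ℝ f X)
    (hX : X ∈ upperHalf n) (i : Fin n) :
    partialX i (fun Y => ‖Y‖ ^ 2 * f Y) X
      = ‖X‖ ^ 2 * partialX i f X + 2 * (X i.castSucc * f X) := by
  rw [partialX_eq_dir, dir_normSq_mul hf hX, partialX_eq_dir]
  simp only [EuclideanSpace.inner_single_right, one_mul, conj_trivial]
  ring

/-- Functions of order `m` generated by `u`, together with their first derivatives. -/
structure Level (b : ℝ) (u : Space n → ℝ) (m : ℕ) (f : Space n → ℝ) : Prop where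
  gen : Generated b u m f
  tan : ∀ i, Generated b u (m + 1) (partialX i f)
  con : Generated b u (m + 1) (conormal b f)

/-- Functions of order `m` generated by `u`, together with their first derivatives and their
weighted Laplacian, with vanishing conormal derivative. -/
structure NeumannLevel (b : ℝ) (u : Space n → ℝ) (m : ℕ) (f : Space n → ℝ) : Prop
    extends Level b u m f where
  lap : Generated b u (m + 2) (weightedLaplacian b f)
  vanishes : VanishesOnBoundary (conormal b f)

section

variable {b : ℝ} {u f : Space n → ℝ} {m : ℕ}

lemma Level.iterate {j : ℕ} (hj : j ≤ 2) :
    Level b u (2 * j) ((weightedLaplacian b)^[j] u) where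
  gen := .tangential j [] hj (by simp)
  tan i := .tangential j [i] hj (by simp only [List.length_singleton]; omega)
  con := .conormal j [] hj (by simp)

variable (hb : -1 < b) (hb' : b < 1) (hu : RegularUpper b u)
include hb hb' hu

lemma Generated.eulerShift (hm : m ≤ 4) (c : ℝ) (hf : Generated b u m f) :
    Generated b u (m + 1) (eulerShift c f) :=
  (hf.euler hu hb hb' hm).add ((hf.mono (Nat.le_succ m)).const_mul c)

lemma Level.eulerShift (hm : m ≤ 3) (c : ℝ) (hf : Level b u m f) :
    Level b u (m + 1) (eulerShift c f) := by
  have hs : SmoothUpper 2 f := (hf.gen.smooth hu (by omega)).mono (by omega)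
  have hes : SmoothUpper 1 (euler f) := SmoothUpper.euler hs
  refine ⟨hf.gen.eulerShift hb hb' hu (by omega) c, fun i => ?_, ?_⟩
  · refine ((hf.tan i).eulerShift hb hb' hu (by omega) (1 + c)).congr fun X hX => ?_
    have df := hs.differentiableAt (by norm_num) hX
    refine (dir_add (hes.differentiableAt le_rfl hX) (df.const_mul c) _).trans ?_
    rw [dir_euler hs _ hX, dir_const_mul df, LaneEmden.eulerShift, partialX_eq_dir]
    ring
  · refine (hf.con.eulerShift hb hb' hu (by omega) (1 - b + c)).congr fun X hX => ?_
    have df := hs.differentiableAt (by norm_num) hX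
    refine (conormal_add b (hes.differentiableAt le_rfl hX) (df.const_mul c)).trans ?_
    rw [conormal_euler b hs hX, conormal_const_mul b df, LaneEmden.eulerShift]
    ring

/-- The Neumann condition survives: y^b ∂_y commutes with X · ∇ up to a multiple of itself, and X ·
∇ preserves zero traces. -/
lemma NeumannLevel.eulerShift (hm : m ≤ 2) (c : ℝ) (hf : NeumannLevel b u m f) :
    NeumannLevel b u (m + 1) (eulerShift c f) := by
  have hs : SmoothUpper 3 f := (hf.gen.smooth hu (by omega)).mono (by omega)
  have hes : SmoothUpper 1 (euler f) := (SmoothUpper.euler hs).mono (by norm_num)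
  have hcg := hf.con.euler hu hb hb' (by omega)
  refine ⟨hf.toLevel.eulerShift hb hb' hu (by omega) c, ?_, ?_⟩
  · exact (hf.lap.eulerShift hb hb' hu (by omega) (c + 2)).congr
      (weightedLaplacian_eulerShift b c hs)
  · refine ((hf.vanishes.euler (SmoothUpper.conormal b (hs.mono (by norm_num)))
      (hf.con.extendsContinuously hu (by omega)) (hcg.extendsContinuously hu (by omega))).add
      (hf.vanishes.const_mul (1 - b + c))).congr fun X hX => ?_
    have df := hs.differentiableAt (by norm_num) hX
    refine (conormal_add b (hes.differentiableAt le_rfl hX) (df.const_mul c)).trans ?_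
    rw [conormal_euler b (hs.mono (by norm_num)) hX, conormal_const_mul b df]
    ring

-- Multiplication by |X|² costs no derivative, so the order stays m. The extra conormal term 2
-- y^{b+1} f vanishes at the boundary because b > -1.
omit hb hb' in
lemma NeumannLevel.normSq_mul (hb : -1 < b) (hb' : b < 1) (hm : m ≤ 3)
    (hf : NeumannLevel b u m f) : NeumannLevel b u m (fun X => ‖X‖ ^ 2 * f X) := by
  have hs : SmoothUpper 2 f := (hf.gen.smooth hu (by omega)).mono (by omega)
  refine ⟨⟨hf.gen.normSq_mul, fun i => ?_, ?_⟩, ?_, ?_⟩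
  · exact ((hf.tan i).normSq_mul.add
      (((hf.gen.mono (Nat.le_succ m)).coord i).const_mul 2)).congr fun X hX =>
      partialX_normSq_mul (hs.differentiableAt (by norm_num) hX) hX i
  · exact (hf.con.normSq_mul.add (((hf.gen.mono (Nat.le_succ m)).height_rpow (b + 1)
      (by linarith)).const_mul 2)).congr fun X hX =>
      conormal_normSq_mul b (hs.differentiableAt (by norm_num) hX) hX
  · exact ((hf.lap.normSq_mul.add
      (((hf.gen.euler hu hb hb' (by omega)).mono (Nat.le_succ _)).const_mul 4)).add
      ((hf.gen.mono (by omega)).const_mul (2 * (n + 1 + b)))).congr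
      (weightedLaplacian_normSq_mul b hs)
  · have hfe := hf.gen.extendsContinuously hu (by omega)
    refine ((hf.vanishes.mul_extends extendsContinuously_normSq).add
      (((vanishesOnBoundary_height_rpow (by linarith : 0 < b + 1)).mul_extends
        hfe).const_mul 2)).congr fun X hX => ?_
    rw [conormal_normSq_mul b (hs.differentiableAt (by norm_num) hX) hX]
    ring

omit hb hb' in
lemma Level.admissible (hm : m ≤ 4) (hf : Level b u m f) : Admissible b f where
  smooth := (hf.gen.smooth hu (by omega)).mono (by omega)
  extends_self := hf.gen.extendsContinuously hu (by omega)
  extends_tangential i := (hf.tan i).extendsContinuously hu (by omega)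
  extends_conormal := hf.con.extendsContinuously hu (by omega)

lemma NeumannLevel.admissible (hm : m ≤ 3) (hf : NeumannLevel b u m f) :
    NeumannAdmissible b f where
  toAdmissible := hf.toLevel.admissible hu (by omega)
  smooth_two := (hf.gen.smooth hu (by omega)).mono (by omega)
  extends_euler_euler :=
    ((hf.gen.euler hu hb hb' (by omega)).euler hu hb hb' (by omega)).extendsContinuously hu
      (by omega)
  extends_laplacian := hf.lap.extendsContinuously hu (by omega)
  vanishes := hf.vanishes

end

section Commutators

/-- The Euler operator commutes with the spherical Laplacian. -/
lemma euler_sphLaplacian (b : ℝ) {f : Space n → ℝ} (hf : SmoothUpper 3 f) :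
    EqOn (euler (sphLaplacian b f)) (sphLaplacian b (euler f)) (upperHalf n) := by
  intro X hX
  have hL : SmoothUpper 1 (weightedLaplacian b f) := SmoothUpper.weightedLaplacian b hf
  have he : SmoothUpper 1 (euler f) := (SmoothUpper.euler hf).mono (by norm_num)
  have hee : SmoothUpper 1 (euler (euler f)) := SmoothUpper.euler (SmoothUpper.euler hf)
  have dL := hL.differentiableAt le_rfl hX
  have de := he.differentiableAt le_rfl hX
  have dee := hee.differentiableAt le_rfl hX
  have dn := (smoothUpper_normSq (n := n) 1).differentiableAt le_rfl hX
  have e1 : euler (sphLaplacian b f) X = euler (fun Y => ‖Y‖ ^ 2 * weightedLaplacian b f Y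
      + ((-1) * euler (euler f) Y + (-(n + b - 1)) * euler f Y)) X := by
    refine euler_congr (fun Y _ => ?_) hX
    rw [sphLaplacian]
    ring
  rw [e1, euler_add (dn.fun_mul dL) ((dee.const_mul _).fun_add (de.const_mul _)),
    euler_add (dee.const_mul _) (de.const_mul _), euler_const_mul dee, euler_const_mul de,
    euler_normSq_mul dL hX, sphLaplacian, weightedLaplacian_euler b hf hX]
  ring

lemma euler_gradDot {f g : Space n → ℝ} (hf : SmoothUpper 2 f) (hg : SmoothUpper 2 g) :
    EqOn (euler (gradDot f g)) (fun X => gradDot (euler f) g X + gradDot f (euler g) X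
      - 2 * gradDot f g X) (upperHalf n) := by
  intro X hX
  have df := fun i => (SmoothUpper.dir hf (basisVec i)).differentiableAt le_rfl hX
  have dg := fun i => (SmoothUpper.dir hg (basisVec i)).differentiableAt le_rfl hX
  have e1 : euler (gradDot f g) X = _ := euler_sum Finset.univ (fun i _ => (df i).fun_mul (dg i))
  rw [e1]
  simp only [gradDot, Finset.mul_sum, ← Finset.sum_add_distrib, ← Finset.sum_sub_distrib]
  refine Finset.sum_congr rfl fun i _ => ?_
  rw [euler_mul (df i) (dg i), dir_euler hf _ hX, dir_euler hg _ hX]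
  ring

lemma smoothUpper_gradDot {m : ℕ} {f g : Space n → ℝ} (hf : SmoothUpper (m + 1) f)
    (hg : SmoothUpper (m + 1) g) : SmoothUpper m (gradDot f g) :=
  SmoothUpper.sum _ fun _ _ => .mul (SmoothUpper.dir hf _) (SmoothUpper.dir hg _)

lemma smoothUpper_sphGradDot {m : ℕ} {f g : Space n → ℝ} (hf : SmoothUpper (m + 1) f)
    (hg : SmoothUpper (m + 1) g) : SmoothUpper m (sphGradDot f g) :=
  .sub (.mul (smoothUpper_normSq m) (smoothUpper_gradDot hf hg))
    (.mul (SmoothUpper.euler hf) (SmoothUpper.euler hg))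

lemma smoothUpper_sphLaplacian (b : ℝ) {m : ℕ} {f : Space n → ℝ} (hf : SmoothUpper (m + 2) f) :
    SmoothUpper m (sphLaplacian b f) :=
  .sub (.sub (.mul (smoothUpper_normSq m) (SmoothUpper.weightedLaplacian b hf))
    (SmoothUpper.euler (SmoothUpper.euler hf)))
    (.const_mul _ ((SmoothUpper.euler (m := m + 1) hf).mono (Nat.le_succ m)))

/-- The loss of degree two from the two gradients is compensated by the factor |X|², so X · ∇ acts
as a derivation without remainder. -/
lemma euler_sphGradDot {f g : Space n → ℝ} (hf : SmoothUpper 2 f) (hg : SmoothUpper 2 g) :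
    EqOn (euler (sphGradDot f g))
      (fun X => sphGradDot (euler f) g X + sphGradDot f (euler g) X) (upperHalf n) := by
  intro X hX
  have dG := (smoothUpper_gradDot (m := 1) hf hg).differentiableAt le_rfl hX
  have def' := (SmoothUpper.euler (m := 1) hf).differentiableAt le_rfl hX
  have deg := (SmoothUpper.euler (m := 1) hg).differentiableAt le_rfl hX
  have dn := (smoothUpper_normSq (n := n) 1).differentiableAt le_rfl hX
  have e1 : euler (sphGradDot f g) X = euler (fun Y => ‖Y‖ ^ 2 * gradDot f g Y
      + (-1) * (euler f Y * euler g Y)) X := by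
    refine euler_congr (fun Y _ => ?_) hX
    rw [sphGradDot]
    ring
  rw [e1, euler_add (dn.fun_mul dG) ((def'.fun_mul deg).const_mul _),
    euler_const_mul (def'.fun_mul deg), euler_mul def' deg, euler_normSq_mul dG hX,
    euler_gradDot hf hg hX]
  simp only [sphGradDot]
  ring

lemma sphLaplacian_congr (b : ℝ) {f g : Space n → ℝ} (h : EqOn f g (upperHalf n)) :
    EqOn (sphLaplacian b f) (sphLaplacian b g) (upperHalf n) := fun X hX => by
  simp only [sphLaplacian, weightedLaplacian_congr b h hX, euler_congr h hX,
    euler_congr (euler_congr h) hX]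

/-- `X · ∇ + c` commutes with the spherical Laplacian. -/
lemma sphLaplacian_eulerShift (b c : ℝ) {f : Space n → ℝ} (hf : SmoothUpper 3 f) :
    EqOn (sphLaplacian b (eulerShift c f)) (eulerShift c (sphLaplacian b f)) (upperHalf n) := by
  intro X hX
  have hf2 : SmoothUpper 2 f := hf.mono (by norm_num)
  have df : ∀ Y ∈ upperHalf n, DifferentiableAt ℝ f Y := fun Y hY =>
    hf.differentiableAt (by norm_num) hY
  have de : ∀ Y ∈ upperHalf n, DifferentiableAt ℝ (euler f) Y := fun Y hY =>
    (SmoothUpper.euler hf2).differentiableAt le_rfl hY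
  have dee : DifferentiableAt ℝ (euler (euler f)) X :=
    (SmoothUpper.euler (m := 1) (SmoothUpper.euler hf)).differentiableAt le_rfl hX
  have e1 : EqOn (euler (eulerShift c f)) (fun Y => euler (euler f) Y + c * euler f Y)
      (upperHalf n) := fun Y hY => by
    refine (euler_add (de Y hY) ((df Y hY).const_mul c)).trans ?_
    rw [euler_const_mul (df Y hY)]
  have e2 : euler (euler (eulerShift c f)) X = euler (euler (euler f)) X + c * euler (euler f) X := by
    rw [euler_congr e1 hX, euler_add dee ((de X hX).const_mul c), euler_const_mul (de X hX)]
  rw [sphLaplacian, e2, e1 hX, weightedLaplacian_eulerShift b c hf hX]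
  simp only [eulerShift, euler_sphLaplacian b hf hX]
  simp only [sphLaplacian, weightedLaplacian_euler b hf hX]
  ring

lemma gradDot_add_left {f g h : Space n → ℝ} {X : Space n} (hf : DifferentiableAt ℝ f X)
    (hg : DifferentiableAt ℝ g X) :
    gradDot (fun Y => f Y + g Y) h X = gradDot f h X + gradDot g h X := by
  simp only [gradDot, dir_add hf hg, add_mul, Finset.sum_add_distrib]

lemma gradDot_const_mul_left {f h : Space n → ℝ} {X : Space n} (hf : DifferentiableAt ℝ f X)
    (c : ℝ) : gradDot (fun Y => c * f Y) h X = c * gradDot f h X := by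
  simp only [gradDot, dir_const_mul hf, mul_assoc, Finset.mul_sum]

lemma sphGradDot_add_left {f g h : Space n → ℝ} {X : Space n} (hf : DifferentiableAt ℝ f X)
    (hg : DifferentiableAt ℝ g X) :
    sphGradDot (fun Y => f Y + g Y) h X = sphGradDot f h X + sphGradDot g h X := by
  simp only [sphGradDot, gradDot_add_left hf hg, euler_add hf hg]
  ring

lemma sphGradDot_const_mul_left {f h : Space n → ℝ} {X : Space n} (hf : DifferentiableAt ℝ f X)
    (c : ℝ) : sphGradDot (fun Y => c * f Y) h X = c * sphGradDot f h X := by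
  simp only [sphGradDot, gradDot_const_mul_left hf, euler_const_mul hf]
  ring

lemma sphGradDot_eulerShift_left {f h : Space n → ℝ} {X : Space n} (c : ℝ)
    (hf : SmoothUpper 2 f) (hX : X ∈ upperHalf n) :
    sphGradDot (eulerShift c f) h X = sphGradDot (euler f) h X + c * sphGradDot f h X := by
  have df := hf.differentiableAt (by norm_num) hX
  have de := (SmoothUpper.euler (m := 1) hf).differentiableAt le_rfl hX
  refine (sphGradDot_add_left de (df.const_mul c)).trans ?_
  rw [sphGradDot_const_mul_left df]

/-- Cauchy–Schwarz for X and ∇f. -/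
lemma sphGradDot_self_nonneg (f : Space n → ℝ) (X : Space n) : 0 ≤ sphGradDot f f X := by
  have h := Finset.sum_mul_sq_le_sq_mul_sq Finset.univ (fun i => X i)
    (fun i => dir (basisVec i) f X)
  have hn : ∑ i, X i ^ 2 = ‖X‖ ^ 2 := by
    rw [EuclideanSpace.norm_sq_eq]
    simp only [Real.norm_eq_abs, sq_abs]
  rw [← euler_eq_sum_basis, hn] at h
  simp only [sphGradDot, gradDot]
  simp only [pow_two] at h ⊢
  linarith

end Commutators

end LaneEmden
end

/-! ### Homogeneous boundary integrals and their derivative in the radius. -/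

noncomputable section

namespace LaneEmden

open Set Filter Topology MeasureTheory

variable {n : ℕ}

/-- The integral of `yᵇ q` over the upper half of the sphere of radius `l`, normalized so that it
is homogeneous of degree `2 k` in the dilations. -/
def boundaryForm (b k : ℝ) (q : Space n → ℝ) (l : ℝ) : ℝ :=
  l ^ (2 * k - b) * sphereMean (fun X => height X ^ b * q X) l

/-- Functions whose weighted integral over half spheres depends differentiably on the radius. -/
structure BoundaryDensity (b : ℝ) (q : Space n → ℝ) : Prop where
  smooth : SmoothUpper 1 q
  tame : Tame |b| (fun X => height X ^ b * q X)
  tame_euler : Tame |b| (fun X => height X ^ b * euler q X)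

/-- Functions whose weighted integral over the upper half sphere of radius `l` vanishes. -/
structure NullOnSphere (b l : ℝ) (q : Space n → ℝ) : Prop where
  integrable : Integrable
    (fun ω : Metric.sphere (0 : Space n) 1 =>
      height (l • (ω : Space n)) ^ b * q (l • (ω : Space n))) (upperSphereMeasure n)
  integral_eq_zero : sphereMean (fun X => height X ^ b * q X) l = 0

lemma height_rpow_smul (b : ℝ) {l : ℝ} (hl : 0 < l) {X : Space n} (hX : X ∈ upperHalf n) :
    height (l • X) ^ b = l ^ b * height X ^ b := by
  rw [height_smul, Real.mul_rpow hl.le (le_of_lt hX)]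

lemma Tame.smul_weight {β b : ℝ} {q : Space n → ℝ} (hq : Tame β (fun X => height X ^ b * q X))
    (c : ℝ) : Tame β (fun X => height X ^ b * (c * q X)) :=
  (hq.const_mul c).congr fun _ _ => mul_left_comm _ _ _

lemma Tame.add_weight {β b : ℝ} {q q' : Space n → ℝ}
    (hq : Tame β (fun X => height X ^ b * q X)) (hq' : Tame β (fun X => height X ^ b * q' X)) :
    Tame β (fun X => height X ^ b * (q X + q' X)) :=
  (hq.add hq').congr fun _ _ => mul_add _ _ _

lemma boundaryForm_eq_integral (b k : ℝ) (q : Space n → ℝ) {l : ℝ} (hl : 0 < l) :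
    boundaryForm b k q l
      = l ^ (2 * k) * ∫ ω, height (ω : Space n) ^ b * q (l • (ω : Space n))
          ∂(upperSphereMeasure n) := by
  have h : sphereMean (fun X => height X ^ b * q X) l
      = l ^ b * ∫ ω, height (ω : Space n) ^ b * q (l • (ω : Space n))
          ∂(upperSphereMeasure n) := by
    rw [← integral_const_mul, sphereMean]
    refine integral_congr_ae ?_
    filter_upwards [ae_upperSphere] with ω hω
    rw [height_rpow_smul b hl hω, mul_assoc]
  rw [boundaryForm, h, ← mul_assoc, ← Real.rpow_add hl, sub_add_cancel]

lemma boundaryForm_congr (b k : ℝ) {q q' : Space n → ℝ} (h : EqOn q q' (upperHalf n)) {l : ℝ}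
    (hl : 0 < l) : boundaryForm b k q l = boundaryForm b k q' l := by
  rw [boundaryForm, boundaryForm, sphereMean_congr (fun X hX => by rw [h hX]) hl]

namespace NullOnSphere

variable {b l : ℝ} {q q' : Space n → ℝ}

lemma add (hq : NullOnSphere b l q) (hq' : NullOnSphere b l q') :
    NullOnSphere b l (fun X => q X + q' X) := by
  refine ⟨(hq.integrable.add hq'.integrable).congr (.of_forall fun ω => (mul_add _ _ _).symm), ?_⟩
  simp only [sphereMean, mul_add]
  rw [integral_add hq.integrable hq'.integrable]
  have h1 := hq.integral_eq_zero
  have h2 := hq'.integral_eq_zero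
  simp only [sphereMean] at h1 h2
  rw [h1, h2, add_zero]

lemma const_mul (c : ℝ) (hq : NullOnSphere b l q) : NullOnSphere b l (fun X => c * q X) := by
  refine ⟨(hq.integrable.const_mul c).congr (.of_forall fun ω => mul_left_comm _ _ _), ?_⟩
  have h1 := hq.integral_eq_zero
  simp only [sphereMean] at h1 ⊢
  simp only [mul_left_comm _ c]
  rw [integral_const_mul, h1, mul_zero]

lemma sub (hq : NullOnSphere b l q) (hq' : NullOnSphere b l q') :
    NullOnSphere b l (fun X => q X - q' X) := by
  simpa only [neg_one_mul, ← sub_eq_add_neg] using hq.add (hq'.const_mul (-1))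

end NullOnSphere

section

variable {b : ℝ} (hb : -1 < b) (hb' : b < 1)
include hb hb'

lemma abs_lt_one_of_mem : |b| < 1 := abs_lt.2 ⟨hb, hb'⟩

lemma nullOnSphere_integration_by_parts {f g : Space n → ℝ} (hf : Admissible b f)
    (hg : NeumannAdmissible b g) {l : ℝ} (hl : 0 < l) :
    NullOnSphere b l (fun X => f X * sphLaplacian b g X + sphGradDot f g X) :=
  ⟨(Tame.add_weight (tame_weight_mul (hf.extends_self.mul (hg.extends_sphLaplacian hb')))
    (hf.tame_sphGradDot hb' hg.toAdmissible)).integrable_sphere (abs_nonneg b)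
      (abs_lt_one_of_mem hb hb') hl, sphereMean_integration_by_parts hb hb' hf hg hl⟩

lemma integrable_weight_sphere {q : Space n → ℝ} (hq : Tame |b| (fun X => height X ^ b * q X))
    {l : ℝ} (hl : 0 < l) :
    Integrable (fun ω : Metric.sphere (0 : Space n) 1 =>
      height (ω : Space n) ^ b * q (l • (ω : Space n))) (upperSphereMeasure n) := by
  refine ((hq.integrable_sphere (abs_nonneg b) (abs_lt_one_of_mem hb hb') hl).const_mul
    (l ^ (-b))).congr ?_
  filter_upwards [ae_upperSphere] with ω hω
  rw [height_rpow_smul b hl hω, ← mul_assoc, ← mul_assoc, ← Real.rpow_add hl, neg_add_cancel,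
    Real.rpow_zero, one_mul]

/-- Reduces identities between boundary integrals to pointwise algebra modulo integrations by parts
on the half sphere, collected in N. -/
lemma boundaryForm_eq_of_null (k : ℝ) {q q' N : Space n → ℝ} {l : ℝ} (hl : 0 < l)
    (hq' : Tame |b| (fun X => height X ^ b * q' X)) (hN : NullOnSphere b l N)
    (h : ∀ X ∈ upperHalf n, q X = q' X + N X) :
    boundaryForm b k q l = boundaryForm b k q' l := by
  rw [boundaryForm_congr b k h hl, boundaryForm, boundaryForm]
  congr 1
  have h1 := hN.integral_eq_zero
  simp only [sphereMean, mul_add] at h1 ⊢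
  rw [integral_add (hq'.integrable_sphere (abs_nonneg b) (abs_lt_one_of_mem hb hb') hl)
    hN.integrable, h1, add_zero]

lemma boundaryForm_add (k : ℝ) {q q' : Space n → ℝ} {l : ℝ} (hl : 0 < l)
    (hq : Tame |b| (fun X => height X ^ b * q X)) (hq' : Tame |b| (fun X => height X ^ b * q' X)) :
    boundaryForm b k (fun X => q X + q' X) l = boundaryForm b k q l + boundaryForm b k q' l := by
  simp only [boundaryForm, sphereMean, mul_add]
  rw [integral_add (hq.integrable_sphere (abs_nonneg b) (abs_lt_one_of_mem hb hb') hl)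
    (hq'.integrable_sphere (abs_nonneg b) (abs_lt_one_of_mem hb hb') hl), mul_add]

omit hb hb' in
lemma boundaryForm_const_mul (k c : ℝ) (q : Space n → ℝ) (l : ℝ) :
    boundaryForm b k (fun X => c * q X) l = c * boundaryForm b k q l := by
  simp only [boundaryForm, sphereMean, mul_left_comm _ c]
  rw [integral_const_mul, mul_left_comm]

omit hb hb' in
lemma boundaryForm_mono_zero (k : ℝ) {q : Space n → ℝ} {l : ℝ} (hl : 0 < l)
    (hq : ∀ X ∈ upperHalf n, 0 ≤ q X) : 0 ≤ boundaryForm b k q l := by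
  refine mul_nonneg (Real.rpow_nonneg hl.le _) (integral_nonneg_of_ae ?_)
  filter_upwards [ae_upperSphere] with ω hω
  have := smul_mem_upperHalf hl hω
  exact mul_nonneg (Real.rpow_nonneg (le_of_lt this) _) (hq _ this)

lemma boundaryForm_mono (k : ℝ) {q q' : Space n → ℝ} {l : ℝ} (hl : 0 < l)
    (hq : Tame |b| (fun X => height X ^ b * q X)) (hq' : Tame |b| (fun X => height X ^ b * q' X))
    (h : ∀ X ∈ upperHalf n, q X ≤ q' X) : boundaryForm b k q l ≤ boundaryForm b k q' l := by
  have h0 := boundaryForm_mono_zero (b := b) k hl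
    (q := fun X => q' X + (-1) * q X) fun X hX => by linarith [h X hX]
  rw [boundaryForm_add hb hb' k hl hq' (hq.smul_weight (-1)), boundaryForm_const_mul] at h0
  linarith

/-- The degree b of the weight cancels the -b in the prefactor l^{2k-b}, so l d/dl acts on the
density as X · ∇ + 2k. -/
lemma BoundaryDensity.hasDerivAt (k : ℝ) {q : Space n → ℝ} (hq : BoundaryDensity b q) {l : ℝ}
    (hl : 0 < l) :
    HasDerivAt (boundaryForm b k q) (boundaryForm b k (eulerShift (2 * k) q) l / l) l := by
  have he : EqOn (euler fun X => height X ^ b * q X)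
      (fun X => height X ^ b * (euler q X + b * q X)) (upperHalf n) := fun X hX => by
    rw [euler_mul ((smoothUpper_height_rpow 1 b).differentiableAt le_rfl hX)
      (hq.smooth.differentiableAt le_rfl hX), euler_height_rpow b hX]
    ring
  have hT := hq.tame_euler.add_weight (hq.tame.smul_weight b)
  have hd := hasDerivAt_sphereMean (abs_nonneg b) (abs_lt_one_of_mem hb hb')
    (SmoothUpper.mul (smoothUpper_height_rpow 1 b) hq.smooth) hq.tame (hT.congr he) hl
  have hp := Real.hasDerivAt_rpow_const (x := l) (p := 2 * k - b) (Or.inl hl.ne')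
  refine (hp.mul hd).congr_deriv ?_
  rw [sphereMean_congr he hl]
  have e2 : boundaryForm b k (eulerShift (2 * k) q) l
      = boundaryForm b k (fun X => (euler q X + b * q X) + (2 * k - b) * q X) l :=
    boundaryForm_congr b k (fun X _ => by simp only [LaneEmden.eulerShift]; ring) hl
  rw [e2, boundaryForm_add hb hb' k hl hT (hq.tame.smul_weight _), boundaryForm_const_mul,
    boundaryForm, boundaryForm, Real.rpow_sub_one hl.ne']
  field_simp
  ring

end

namespace BoundaryDensity

variable {b : ℝ} {q q' : Space n → ℝ}

lemma add (hq : BoundaryDensity b q) (hq' : BoundaryDensity b q') :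
    BoundaryDensity b (fun X => q X + q' X) :=
  ⟨.add hq.smooth hq'.smooth, hq.tame.add_weight hq'.tame,
    (hq.tame_euler.add_weight hq'.tame_euler).congr fun X hX => by
      rw [euler_add (hq.smooth.differentiableAt le_rfl hX)
        (hq'.smooth.differentiableAt le_rfl hX)]⟩

lemma const_mul (c : ℝ) (hq : BoundaryDensity b q) : BoundaryDensity b (fun X => c * q X) :=
  ⟨.const_mul c hq.smooth, hq.tame.smul_weight c,
    (hq.tame_euler.smul_weight c).congr fun X hX => by
      rw [euler_const_mul (hq.smooth.differentiableAt le_rfl hX)]⟩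

lemma mul_of_extends {f g : Space n → ℝ} (hf : SmoothUpper 1 f) (hg : SmoothUpper 1 g)
    (hf0 : ExtendsContinuously f) (hf1 : ExtendsContinuously (euler f))
    (hg0 : ExtendsContinuously g) (hg1 : ExtendsContinuously (euler g)) :
    BoundaryDensity b (fun X => f X * g X) :=
  ⟨.mul hf hg, tame_weight_mul (hf0.mul hg0),
    (tame_weight_mul ((hf1.mul hg0).add (hf0.mul hg1))).congr fun X hX => by
      rw [euler_mul (hf.differentiableAt le_rfl hX) (hg.differentiableAt le_rfl hX)]
      ring⟩

lemma sphGradDot_of_admissible (hb' : b < 1) {f g : Space n → ℝ} (hf : SmoothUpper 2 f)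
    (hg : SmoothUpper 2 g) (hf0 : Admissible b f) (hg0 : Admissible b g)
    (hf1 : Admissible b (euler f)) (hg1 : Admissible b (euler g)) :
    BoundaryDensity b (sphGradDot f g) :=
  ⟨smoothUpper_sphGradDot hf hg, hf0.tame_sphGradDot hb' hg0,
    ((hf1.tame_sphGradDot hb' hg0).add_weight (hf0.tame_sphGradDot hb' hg1)).congr fun X hX => by
      rw [euler_sphGradDot hf hg hX]⟩

end BoundaryDensity

end LaneEmden
end

/-! ### Polar form of Δ_b and Δ_b² in terms of D = X · ∇ + k. -/

noncomputable section

namespace LaneEmden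

open Set Filter Topology MeasureTheory

variable {n : ℕ}

/-- The coefficients in `|X|² Δ_b = D² + linCoef D + constCoef + Δ_S`, where `D = X · ∇ + k` and
`m = n + b - 1`. -/
def linCoef (m k : ℝ) : ℝ := m - 2 * k

/-- See `linCoef`. -/
def constCoef (m k : ℝ) : ℝ := k * (k - m)

lemma eulerShift_normSq_mul (c : ℝ) {f : Space n → ℝ} (hf : SmoothUpper 1 f) :
    EqOn (eulerShift c (fun X => ‖X‖ ^ 2 * f X)) (fun X => ‖X‖ ^ 2 * eulerShift (c + 2) f X)
      (upperHalf n) := fun X hX => by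
  simp only [eulerShift, euler_normSq_mul (hf.differentiableAt le_rfl hX) hX]
  ring

lemma sphLaplacian_normSq_mul (b : ℝ) {f : Space n → ℝ} (hf : SmoothUpper 2 f) :
    EqOn (sphLaplacian b (fun X => ‖X‖ ^ 2 * f X)) (fun X => ‖X‖ ^ 2 * sphLaplacian b f X)
      (upperHalf n) := by
  intro X hX
  have df : ∀ Y ∈ upperHalf n, DifferentiableAt ℝ f Y := fun Y hY =>
    hf.differentiableAt (by norm_num) hY
  have he : SmoothUpper 1 (euler f) := SmoothUpper.euler hf
  have h1 : EqOn (euler fun Y => ‖Y‖ ^ 2 * f Y)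
      (fun Y => ‖Y‖ ^ 2 * (euler f Y + 2 * f Y)) (upperHalf n) := fun Y hY =>
    euler_normSq_mul (df Y hY) hY
  have h2 : euler (euler fun Y => ‖Y‖ ^ 2 * f Y) X
      = ‖X‖ ^ 2 * (euler (euler f) X + 4 * euler f X + 4 * f X) := by
    rw [euler_congr h1 hX,
      euler_normSq_mul ((he.differentiableAt le_rfl hX).fun_add ((df X hX).const_mul 2)) hX,
      euler_add (he.differentiableAt le_rfl hX) ((df X hX).const_mul 2),
      euler_const_mul (df X hX)]
    ring
  simp only [sphLaplacian, h2, weightedLaplacian_normSq_mul b hf hX, h1 hX]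
  ring

lemma eulerShift_eulerShift (c : ℝ) {f : Space n → ℝ} (hf : SmoothUpper 2 f) {X : Space n}
    (hX : X ∈ upperHalf n) :
    eulerShift c (eulerShift c f) X = euler (euler f) X + 2 * c * euler f X + c ^ 2 * f X := by
  have he : SmoothUpper 1 (euler f) := SmoothUpper.euler hf
  have df := hf.differentiableAt (by norm_num) hX
  have h : euler (eulerShift c f) X = euler (euler f) X + c * euler f X :=
    (euler_add (he.differentiableAt le_rfl hX) (df.const_mul c)).trans (by rw [euler_const_mul df])
  simp only [eulerShift] at h ⊢
  rw [h]
  ring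

/-- `|X|² Δ_b` in polar coordinates. -/
lemma normSq_mul_weightedLaplacian (b k : ℝ) {f : Space n → ℝ} (hf : SmoothUpper 2 f)
    {X : Space n} (hX : X ∈ upperHalf n) :
    ‖X‖ ^ 2 * weightedLaplacian b f X
      = eulerShift k (eulerShift k f) X + linCoef (n + b - 1) k * eulerShift k f X
        + constCoef (n + b - 1) k * f X + sphLaplacian b f X := by
  rw [eulerShift_eulerShift k hf hX]
  simp only [sphLaplacian, eulerShift, linCoef, constCoef]
  ring

/-- The iterates of `D = X · ∇ + k` on `U`. -/
def scaleDeriv (k : ℝ) (U : Space n → ℝ) (i : ℕ) : Space n → ℝ := (eulerShift k)^[i] U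

lemma scaleDeriv_succ (k : ℝ) (U : Space n → ℝ) (i : ℕ) :
    scaleDeriv k U (i + 1) = eulerShift k (scaleDeriv k U i) :=
  Function.iterate_succ_apply' _ _ _

lemma euler_scaleDeriv (k : ℝ) (U : Space n → ℝ) (i : ℕ) (X : Space n) :
    euler (scaleDeriv k U i) X = scaleDeriv k U (i + 1) X - k * scaleDeriv k U i X := by
  rw [scaleDeriv_succ, eulerShift, add_sub_cancel_right]

/-- `|X|² Δ_b U`. -/
def scaledLap (b : ℝ) (U : Space n → ℝ) (X : Space n) : ℝ := ‖X‖ ^ 2 * weightedLaplacian b U X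

/-- `|X|⁴ Δ_b² U`. -/
def scaledBilap (b : ℝ) (U : Space n → ℝ) (X : Space n) : ℝ :=
  ‖X‖ ^ 2 * (‖X‖ ^ 2 * weightedLaplacian b (weightedLaplacian b U) X)

/-- The boundary regularity of solutions of the extension problem that enters the monotonicity
formula. -/
structure NeumannPair (b : ℝ) (U : Space n → ℝ) : Prop where
  neg_one_lt : -1 < b
  lt_one : b < 1
  regular : RegularUpper b U
  level_zero : NeumannLevel b U 0 U
  level_one : NeumannLevel b U 2 (weightedLaplacian b U)
  level_two : Level b U 4 (weightedLaplacian b (weightedLaplacian b U))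

lemma IsExtensionSolution.neumannPair {s p κ : ℝ} {U : Space n → ℝ} (hs₂ : 2 < s) (hs₃ : s < 3)
    (hU : IsExtensionSolution s p κ U) : NeumannPair (5 - 2 * s) U where
  neg_one_lt := by linarith
  lt_one := by linarith
  regular := hU.regularUpper
  level_zero :=
    { Level.iterate (j := 0) (by norm_num) with
      lap := .tangential 1 [] (by norm_num) (by simp)
      vanishes := fun x => (hU.boundary_zero x).congr' <| by
        filter_upwards with y
        simp only [LaneEmden.conormal, height_point] }
  level_one :=
    { Level.iterate (j := 1) (by norm_num) with
      lap := .tangential 2 [] (by norm_num) (by simp)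
      vanishes := fun x => (hU.boundary_one x).congr' <| by
        filter_upwards with y
        simp only [LaneEmden.conormal, height_point] }
  level_two := Level.iterate (j := 2) (by norm_num)

namespace NeumannPair

variable {b : ℝ} {U : Space n → ℝ} (k : ℝ) (hU : NeumannPair b U)
include hU

/-- The limit three leaves room, within the total order five, for the two orders taken by Δ_b; mere
boundary continuity holds up to five. -/
lemma level_scaleDeriv : ∀ {i : ℕ}, i ≤ 3 → NeumannLevel b U i (scaleDeriv k U i)
  | 0, _ => hU.level_zero
  | i + 1, hi => by
    rw [scaleDeriv_succ]
    exact (level_scaleDeriv (by omega)).eulerShift hU.neg_one_lt hU.lt_one hU.regular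
      (by omega) k

lemma generated_scaleDeriv : ∀ {i : ℕ}, i ≤ 5 → Generated b U i (scaleDeriv k U i)
  | 0, _ => hU.level_zero.gen
  | i + 1, hi => by
    rw [scaleDeriv_succ]
    exact (generated_scaleDeriv (by omega)).eulerShift hU.neg_one_lt hU.lt_one hU.regular
      (by omega) k

lemma smooth_scaleDeriv {i m : ℕ} (h : i + m ≤ 6) (hi : i ≤ 5) :
    SmoothUpper m (scaleDeriv k U i) :=
  ((hU.generated_scaleDeriv k hi).smooth hU.regular hi).mono (by omega)

lemma admissible_scaleDeriv {i : ℕ} (hi : i ≤ 3) : NeumannAdmissible b (scaleDeriv k U i) :=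
  (hU.level_scaleDeriv k hi).admissible hU.neg_one_lt hU.lt_one hU.regular hi

lemma level_scaledLap : NeumannLevel b U 2 (scaledLap b U) :=
  hU.level_one.normSq_mul hU.regular hU.neg_one_lt hU.lt_one (by norm_num)

lemma smooth_scaledLap : SmoothUpper 4 (scaledLap b U) :=
  hU.level_scaledLap.gen.smooth hU.regular (by norm_num)

lemma admissible_scaledLap : NeumannAdmissible b (scaledLap b U) :=
  hU.level_scaledLap.admissible hU.neg_one_lt hU.lt_one hU.regular (by norm_num)

lemma generated_scaledBilap : Generated b U 4 (scaledBilap b U) :=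
  hU.level_two.gen.normSq_mul.normSq_mul

lemma smooth_sphLaplacian {i m : ℕ} (h : i + 2 + m ≤ 6) :
    SmoothUpper m (sphLaplacian b (scaleDeriv k U i)) :=
  smoothUpper_sphLaplacian b (hU.smooth_scaleDeriv k (m := m + 2) (by omega) (by omega))

/-- `D Δ_S = Δ_S D`. -/
lemma eulerShift_sphLaplacian {i : ℕ} (hi : i ≤ 3) :
    EqOn (eulerShift k (sphLaplacian b (scaleDeriv k U i)))
      (sphLaplacian b (scaleDeriv k U (i + 1))) (upperHalf n) := by
  rw [scaleDeriv_succ]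
  exact (sphLaplacian_eulerShift b k (hU.smooth_scaleDeriv k (by omega) (by omega))).symm

lemma scaledLap_eq {X : Space n} (hX : X ∈ upperHalf n) :
    scaledLap b U X = scaleDeriv k U 2 X + linCoef (n + b - 1) k * scaleDeriv k U 1 X
      + constCoef (n + b - 1) k * scaleDeriv k U 0 X + sphLaplacian b (scaleDeriv k U 0) X :=
  normSq_mul_weightedLaplacian b k (hU.smooth_scaleDeriv k (i := 0) (by norm_num) (by norm_num)) hX

/-- D commutes with Δ_S and with constant coefficients, so the polar expansion of |X|² Δ_b U may be
differentiated term by term. -/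
lemma eulerShift_combination {i : ℕ} (hi : i ≤ 2) (α β : ℝ) :
    EqOn (eulerShift k fun X => scaleDeriv k U (i + 2) X + α * scaleDeriv k U (i + 1) X
        + β * scaleDeriv k U i X + sphLaplacian b (scaleDeriv k U i) X)
      (fun X => scaleDeriv k U (i + 1 + 2) X + α * scaleDeriv k U (i + 1 + 1) X
        + β * scaleDeriv k U (i + 1) X + sphLaplacian b (scaleDeriv k U (i + 1)) X)
      (upperHalf n) := by
  intro X hX
  have d : ∀ j, j ≤ 5 → DifferentiableAt ℝ (scaleDeriv k U j) X := fun j hj =>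
    (hU.smooth_scaleDeriv k (m := 1) (by omega) hj).differentiableAt le_rfl hX
  have d2 := d (i + 2) (by omega)
  have d1 := (d (i + 1) (by omega)).const_mul α
  have d0 := (d i (by omega)).const_mul β
  have da := (hU.smooth_sphLaplacian k (i := i) (m := 1) (by omega)).differentiableAt le_rfl hX
  have ha : euler (sphLaplacian b (scaleDeriv k U i)) X
      = sphLaplacian b (scaleDeriv k U (i + 1)) X - k * sphLaplacian b (scaleDeriv k U i) X := by
    rw [← hU.eulerShift_sphLaplacian k (i := i) (by omega) hX, eulerShift, add_sub_cancel_right]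
  rw [eulerShift, euler_add ((d2.fun_add d1).fun_add d0) da, euler_add (d2.fun_add d1) d0,
    euler_add d2 d1, euler_const_mul (d (i + 1) (by omega)), euler_const_mul (d i (by omega)), ha,
    euler_scaleDeriv, euler_scaleDeriv, euler_scaleDeriv]
  ring

lemma eulerShift_scaledLap {X : Space n} (hX : X ∈ upperHalf n) :
    eulerShift k (scaledLap b U) X = scaleDeriv k U 3 X
      + linCoef (n + b - 1) k * scaleDeriv k U 2 X
      + constCoef (n + b - 1) k * scaleDeriv k U 1 X + sphLaplacian b (scaleDeriv k U 1) X := by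
  rw [eulerShift_congr k (fun Y hY => hU.scaledLap_eq k hY) hX]
  exact hU.eulerShift_combination k (i := 0) (by norm_num) _ _ hX

lemma eulerShift_eulerShift_scaledLap {X : Space n} (hX : X ∈ upperHalf n) :
    eulerShift k (eulerShift k (scaledLap b U)) X = scaleDeriv k U 4 X
      + linCoef (n + b - 1) k * scaleDeriv k U 3 X
      + constCoef (n + b - 1) k * scaleDeriv k U 2 X + sphLaplacian b (scaleDeriv k U 2) X := by
  rw [eulerShift_congr k (fun Y hY => hU.eulerShift_scaledLap k hY) hX]
  exact hU.eulerShift_combination k (i := 1) (by norm_num) _ _ hX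

/-- The polar formula for Δ_b U, taken with k + 2 in place of k, because D (|X|² f) = |X|² (D + 2) f
and Δ_S commutes with multiplication by |X|². This is the origin of the second pair of coefficients
α', β'. -/
lemma scaledBilap_eq {X : Space n} (hX : X ∈ upperHalf n) :
    scaledBilap b U X = eulerShift k (eulerShift k (scaledLap b U)) X
      + linCoef (n + b - 1) (k + 2) * eulerShift k (scaledLap b U) X
      + constCoef (n + b - 1) (k + 2) * scaledLap b U X + sphLaplacian b (scaledLap b U) X := by
  have hg : SmoothUpper 4 (weightedLaplacian b U) :=
    hU.level_one.gen.smooth hU.regular (by norm_num)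
  have h1 : EqOn (eulerShift k (scaledLap b U))
      (fun Y => ‖Y‖ ^ 2 * eulerShift (k + 2) (weightedLaplacian b U) Y) (upperHalf n) :=
    eulerShift_normSq_mul k (hg.mono (by norm_num))
  have h2 : EqOn (eulerShift k (eulerShift k (scaledLap b U)))
      (fun Y => ‖Y‖ ^ 2 * eulerShift (k + 2) (eulerShift (k + 2) (weightedLaplacian b U)) Y)
      (upperHalf n) :=
    (eulerShift_congr k h1).trans (eulerShift_normSq_mul k
      (SmoothUpper.eulerShift (m := 1) (k + 2) (hg.mono (by norm_num))))
  have h3 : sphLaplacian b (scaledLap b U) X = ‖X‖ ^ 2 * sphLaplacian b (weightedLaplacian b U) X :=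
    sphLaplacian_normSq_mul b (hg.mono (by norm_num)) hX
  rw [h2 hX, h1 hX, h3, scaledBilap, scaledLap,
    normSq_mul_weightedLaplacian b (k + 2) (hg.mono (by norm_num)) hX]
  ring

end NeumannPair

end LaneEmden
end

/-! ### Quadratic boundary densities and the algebra of the dissipation. -/

noncomputable section

namespace LaneEmden

open Set Filter Topology MeasureTheory

variable {n : ℕ}

/-- Boundary densities `q` with `(X · ∇ + 2 k) q = q'`. -/
structure ShiftDensity (b k : ℝ) (q q' : Space n → ℝ) : Prop where
  density : BoundaryDensity b q
  shift : EqOn (eulerShift (2 * k) q) q' (upperHalf n)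

namespace ShiftDensity

variable {b k : ℝ} {q q' r r' : Space n → ℝ}

lemma add (hq : ShiftDensity b k q q') (hr : ShiftDensity b k r r') :
    ShiftDensity b k (fun X => q X + r X) (fun X => q' X + r' X) :=
  ⟨hq.density.add hr.density, fun X hX => by
    simp only [← hq.shift hX, ← hr.shift hX, eulerShift,
      euler_add (hq.density.smooth.differentiableAt le_rfl hX)
        (hr.density.smooth.differentiableAt le_rfl hX)]
    ring⟩

lemma const_mul (c : ℝ) (hq : ShiftDensity b k q q') :
    ShiftDensity b k (fun X => c * q X) (fun X => c * q' X) :=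
  ⟨hq.density.const_mul c, fun X hX => by
    simp only [← hq.shift hX, eulerShift,
      euler_const_mul (hq.density.smooth.differentiableAt le_rfl hX)]
    ring⟩

lemma tame (hq : ShiftDensity b k q q') : Tame |b| (fun X => height X ^ b * q' X) :=
  (hq.density.tame_euler.add_weight (hq.density.tame.smul_weight (2 * k))).congr fun X hX => by
    rw [← hq.shift hX, eulerShift]

lemma hasDerivAt (hb : -1 < b) (hb' : b < 1) (hq : ShiftDensity b k q q') {l : ℝ} (hl : 0 < l) :
    HasDerivAt (boundaryForm b k q) (boundaryForm b k q' l / l) l :=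
  (hq.density.hasDerivAt hb hb' k hl).congr_deriv (by rw [boundaryForm_congr b k hq.shift hl])

/-- The shift 2k splits as k on each factor, so the product rule holds for D. -/
lemma mul {f g f' g' : Space n → ℝ} (hf : SmoothUpper 1 f) (hg : SmoothUpper 1 g)
    (hf0 : ExtendsContinuously f) (hf1 : ExtendsContinuously f')
    (hg0 : ExtendsContinuously g) (hg1 : ExtendsContinuously g')
    (hff : EqOn (eulerShift k f) f' (upperHalf n)) (hgg : EqOn (eulerShift k g) g' (upperHalf n)) :
    ShiftDensity b k (fun X => f X * g X) (fun X => f' X * g X + f X * g' X) := by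
  have hf1' : ExtendsContinuously (euler f) :=
    (hf1.add (hf0.const_mul (-k))).congr fun X hX => by
      simp only [← hff hX, eulerShift]
      ring
  have hg1' : ExtendsContinuously (euler g) :=
    (hg1.add (hg0.const_mul (-k))).congr fun X hX => by
      simp only [← hgg hX, eulerShift]
      ring
  refine ⟨.mul_of_extends hf hg hf0 hf1' hg0 hg1', fun X hX => ?_⟩
  simp only [← hff hX, ← hgg hX, eulerShift,
    euler_mul (hf.differentiableAt le_rfl hX) (hg.differentiableAt le_rfl hX)]
  ring

end ShiftDensity

section Densities

variable (α β α' β' b : ℝ) (f : ℕ → Space n → ℝ) (X : Space n)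

/-- The boundary terms of the energy, in terms of `f i = Dⁱ U`. -/
def energyDensity : ℝ :=
  -(f 4 X * f 1 X) + (4 - α - α') * (f 3 X * f 1 X) + 2 * (f 3 X * f 2 X)
    + (α' - 2) * (f 2 X * f 2 X)
    + (4 * (α + α') - 2 * β - (α * α' + β + β')) * (f 2 X * f 1 X)
    + (2 * (α * α' + β + β') - α * β) * (f 1 X * f 1 X)
    + β * β' * (f 0 X * f 1 X) + 2 * (β * β') * (f 0 X * f 0 X)
    + 4 * sphGradDot (f 2) (f 1) X + (α - 4) * sphGradDot (f 1) (f 1) X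
    + -(β + β') * sphGradDot (f 0) (f 1) X + -(2 * (β + β')) * sphGradDot (f 0) (f 0) X
    + sphLaplacian b (f 0) X * sphLaplacian b (f 1) X
    + 2 * (sphLaplacian b (f 0) X * sphLaplacian b (f 0) X)

/-- The part of the boundary terms of the energy that does not involve `Δ_b² U`. -/
def correctionDensity : ℝ :=
  (-2) * (f 3 X * f 2 X) + (-4) * (f 3 X * f 1 X) + (2 - α') * (f 2 X * f 2 X)
    + (2 * β - 4 * (α + α')) * (f 2 X * f 1 X)
    + (α * β - (α * β' + α' * β) - 2 * (α * α' + β + β')) * (f 1 X * f 1 X)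
    + (-(2 * (β * β'))) * (f 0 X * f 1 X) + (-(2 * (β * β'))) * (f 0 X * f 0 X)
    + (-2) * sphGradDot (f 2) (f 1) X + (α' + 4) * sphGradDot (f 1) (f 1) X
    + (2 * (β + β')) * sphGradDot (f 0) (f 1) X + (2 * (β + β')) * sphGradDot (f 0) (f 0) X
    + (-2) * (sphLaplacian b (f 0) X * sphLaplacian b (f 1) X)
    + (-2) * (sphLaplacian b (f 0) X * sphLaplacian b (f 0) X)

/-- `(X · ∇ + 2 k)` applied to `correctionDensity`. -/
def correctionShift : ℝ :=
  (-2) * (f 4 X * f 2 X + f 3 X * f 3 X) + (-4) * (f 4 X * f 1 X + f 3 X * f 2 X)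
    + (2 - α') * (f 3 X * f 2 X + f 2 X * f 3 X)
    + (2 * β - 4 * (α + α')) * (f 3 X * f 1 X + f 2 X * f 2 X)
    + (α * β - (α * β' + α' * β) - 2 * (α * α' + β + β')) * (f 2 X * f 1 X + f 1 X * f 2 X)
    + (-(2 * (β * β'))) * (f 1 X * f 1 X + f 0 X * f 2 X)
    + (-(2 * (β * β'))) * (f 1 X * f 0 X + f 0 X * f 1 X)
    + (-2) * (sphGradDot (f 3) (f 1) X + sphGradDot (f 2) (f 2) X)
    + (α' + 4) * (sphGradDot (f 2) (f 1) X + sphGradDot (f 1) (f 2) X)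
    + (2 * (β + β')) * (sphGradDot (f 1) (f 1) X + sphGradDot (f 0) (f 2) X)
    + (2 * (β + β')) * (sphGradDot (f 1) (f 0) X + sphGradDot (f 0) (f 1) X)
    + (-2) * (sphLaplacian b (f 1) X * sphLaplacian b (f 1) X
      + sphLaplacian b (f 0) X * sphLaplacian b (f 2) X)
    + (-2) * (sphLaplacian b (f 1) X * sphLaplacian b (f 0) X
      + sphLaplacian b (f 0) X * sphLaplacian b (f 1) X)

/-- The coefficient of `|D² U|²` in the derivative of the energy. -/
def dissipationCoef₂ : ℝ := α ^ 2 - 2 * β - 2 * (α * α' + β + β') + 4 * (α + α')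

/-- The coefficient of `|∇_S D U|²` in the derivative of the energy. -/
def dissipationCoefGrad : ℝ := 4 * (α + α') - 2 * β - 2 * (β + β')

/-- The coefficient of `|D U|²` in the derivative of the energy. -/
def dissipationCoef₁ : ℝ := β ^ 2 + 2 * (β * β') - 4 * (α * β' + α' * β)

/-- The derivative of the energy, as a quadratic form in `f i = Dⁱ U`. -/
def dissipationDensity : ℝ :=
  3 * (f 3 X * f 3 X) + dissipationCoef₂ α β α' β' * (f 2 X * f 2 X)
    + dissipationCoef₁ α β α' β' * (f 1 X * f 1 X)
    + 6 * sphGradDot (f 2) (f 2) X + dissipationCoefGrad α β α' β' * sphGradDot (f 1) (f 1) X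
    + 3 * (sphLaplacian b (f 1) X * sphLaplacian b (f 1) X)

end Densities

namespace NeumannPair

variable {b : ℝ} {U : Space n → ℝ} (k : ℝ) (hU : NeumannPair b U)

section

include hU

lemma extends_scaleDeriv {i : ℕ} (hi : i ≤ 5) : ExtendsContinuously (scaleDeriv k U i) :=
  (hU.generated_scaleDeriv k hi).extendsContinuously hU.regular hi

lemma extends_sphLaplacian {i : ℕ} (hi : i ≤ 3) :
    ExtendsContinuously (sphLaplacian b (scaleDeriv k U i)) :=
  (hU.admissible_scaleDeriv k hi).extends_sphLaplacian hU.lt_one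

lemma shiftDensity_mul {i j : ℕ} (hi : i ≤ 4) (hj : j ≤ 4) :
    ShiftDensity b k (fun X => scaleDeriv k U i X * scaleDeriv k U j X)
      (fun X => scaleDeriv k U (i + 1) X * scaleDeriv k U j X
        + scaleDeriv k U i X * scaleDeriv k U (j + 1) X) :=
  .mul (hU.smooth_scaleDeriv k (by omega) (by omega)) (hU.smooth_scaleDeriv k (by omega) (by omega))
    (hU.extends_scaleDeriv k (by omega)) (hU.extends_scaleDeriv k (by omega))
    (hU.extends_scaleDeriv k (by omega)) (hU.extends_scaleDeriv k (by omega))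
    (fun X _ => by rw [scaleDeriv_succ]) (fun X _ => by rw [scaleDeriv_succ])

lemma shiftDensity_sphLaplacian {i j : ℕ} (hi : i ≤ 2) (hj : j ≤ 2) :
    ShiftDensity b k
      (fun X => sphLaplacian b (scaleDeriv k U i) X * sphLaplacian b (scaleDeriv k U j) X)
      (fun X => sphLaplacian b (scaleDeriv k U (i + 1)) X * sphLaplacian b (scaleDeriv k U j) X
        + sphLaplacian b (scaleDeriv k U i) X * sphLaplacian b (scaleDeriv k U (j + 1)) X) :=
  .mul (hU.smooth_sphLaplacian k (by omega)) (hU.smooth_sphLaplacian k (by omega))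
    (hU.extends_sphLaplacian k (by omega)) (hU.extends_sphLaplacian k (by omega))
    (hU.extends_sphLaplacian k (by omega)) (hU.extends_sphLaplacian k (by omega))
    (hU.eulerShift_sphLaplacian k (by omega)) (hU.eulerShift_sphLaplacian k (by omega))

lemma admissible_euler_scaleDeriv {i : ℕ} (hi : i ≤ 2) :
    Admissible b (euler (scaleDeriv k U i)) := by
  have h := ((hU.level_scaleDeriv k (i := i) (by omega)).eulerShift hU.neg_one_lt hU.lt_one
    hU.regular hi 0).admissible hU.neg_one_lt hU.lt_one hU.regular (by omega)
  have e : eulerShift 0 (scaleDeriv k U i) = euler (scaleDeriv k U i) := by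
    ext X
    simp only [eulerShift, zero_mul, add_zero]
  exact e ▸ h.toAdmissible

lemma shiftDensity_sphGradDot {i j : ℕ} (hi : i ≤ 2) (hj : j ≤ 2) :
    ShiftDensity b k (sphGradDot (scaleDeriv k U i) (scaleDeriv k U j))
      (fun X => sphGradDot (scaleDeriv k U (i + 1)) (scaleDeriv k U j) X
        + sphGradDot (scaleDeriv k U i) (scaleDeriv k U (j + 1)) X) := by
  have si := hU.smooth_scaleDeriv k (i := i) (m := 2) (by omega) (by omega)
  have sj := hU.smooth_scaleDeriv k (i := j) (m := 2) (by omega) (by omega)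
  refine ⟨.sphGradDot_of_admissible hU.lt_one si sj
    (hU.admissible_scaleDeriv k (by omega)).toAdmissible
    (hU.admissible_scaleDeriv k (by omega)).toAdmissible
    (hU.admissible_euler_scaleDeriv k hi) (hU.admissible_euler_scaleDeriv k hj), fun X hX => ?_⟩
  have e1 := sphGradDot_eulerShift_left (h := scaleDeriv k U j) k si hX
  have e2 := sphGradDot_eulerShift_left (h := scaleDeriv k U i) k sj hX
  rw [eulerShift, euler_sphGradDot si sj hX, scaleDeriv_succ, scaleDeriv_succ, e1,
    sphGradDot_comm (scaleDeriv k U i) (eulerShift k _), e2,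
    sphGradDot_comm (scaleDeriv k U j) (scaleDeriv k U i),
    sphGradDot_comm (euler (scaleDeriv k U j))]
  ring

lemma shiftDensity_correction (α β α' β' : ℝ) :
    ShiftDensity b k (correctionDensity α β α' β' b (scaleDeriv k U))
      (correctionShift α β α' β' b (scaleDeriv k U)) := by
  have m := fun (i j : ℕ) (hi : i ≤ 4) (hj : j ≤ 4) => hU.shiftDensity_mul k hi hj
  have g := fun (i j : ℕ) (hi : i ≤ 2) (hj : j ≤ 2) => hU.shiftDensity_sphGradDot k hi hj
  have a := fun (i j : ℕ) (hi : i ≤ 2) (hj : j ≤ 2) => hU.shiftDensity_sphLaplacian k hi hj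
  exact ((((((((((((((m 3 2 (by norm_num) (by norm_num)).const_mul _).add
    ((m 3 1 (by norm_num) (by norm_num)).const_mul _)).add
    ((m 2 2 (by norm_num) (by norm_num)).const_mul _)).add
    ((m 2 1 (by norm_num) (by norm_num)).const_mul _)).add
    ((m 1 1 (by norm_num) (by norm_num)).const_mul _)).add
    ((m 0 1 (by norm_num) (by norm_num)).const_mul _)).add
    ((m 0 0 (by norm_num) (by norm_num)).const_mul _)).add
    ((g 2 1 (by norm_num) (by norm_num)).const_mul _)).add
    ((g 1 1 (by norm_num) (by norm_num)).const_mul _)).add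
    ((g 0 1 (by norm_num) (by norm_num)).const_mul _)).add
    ((g 0 0 (by norm_num) (by norm_num)).const_mul _)).add
    ((a 0 1 (by norm_num) (by norm_num)).const_mul _)).add
    ((a 0 0 (by norm_num) (by norm_num)).const_mul _))

lemma smooth_scaledBilap : SmoothUpper 2 (scaledBilap b U) :=
  hU.generated_scaledBilap.smooth hU.regular (by norm_num)

lemma extends_scaledBilap : ExtendsContinuously (scaledBilap b U) :=
  hU.generated_scaledBilap.extendsContinuously hU.regular (by norm_num)

lemma extends_eulerShift_scaledBilap (c : ℝ) : ExtendsContinuously (eulerShift c (scaledBilap b U)) :=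
  (hU.generated_scaledBilap.eulerShift hU.neg_one_lt hU.lt_one hU.regular (by norm_num)
    c).extendsContinuously hU.regular (by norm_num)

lemma extends_eulerShift_scaledLap (c : ℝ) : ExtendsContinuously (eulerShift c (scaledLap b U)) :=
  (hU.level_scaledLap.gen.eulerShift hU.neg_one_lt hU.lt_one hU.regular (by norm_num)
    c).extendsContinuously hU.regular (by norm_num)

lemma shiftDensity_scaledLap :
    ShiftDensity b k (fun X => scaledLap b U X * scaledLap b U X)
      (fun X => eulerShift k (scaledLap b U) X * scaledLap b U X
        + scaledLap b U X * eulerShift k (scaledLap b U) X) :=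
  .mul (hU.smooth_scaledLap.mono (by norm_num)) (hU.smooth_scaledLap.mono (by norm_num))
    hU.admissible_scaledLap.extends_self (hU.extends_eulerShift_scaledLap k)
    hU.admissible_scaledLap.extends_self (hU.extends_eulerShift_scaledLap k)
    (fun _ _ => rfl) (fun _ _ => rfl)

lemma shiftDensity_scaledBilap :
    ShiftDensity b k (fun X => scaleDeriv k U 1 X * scaledBilap b U X)
      (fun X => scaleDeriv k U 2 X * scaledBilap b U X
        + scaleDeriv k U 1 X * eulerShift k (scaledBilap b U) X) :=
  .mul (hU.smooth_scaleDeriv k (by norm_num) (by norm_num)) (hU.smooth_scaledBilap.mono (by norm_num))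
    (hU.extends_scaleDeriv k (by norm_num)) (hU.extends_scaleDeriv k (by norm_num))
    hU.extends_scaledBilap (hU.extends_eulerShift_scaledBilap k)
    (fun X _ => by rw [scaleDeriv_succ k U 1]) (fun _ _ => rfl)

lemma nullOnSphere_scaleDeriv {i j : ℕ} (hi : i ≤ 3) (hj : j ≤ 3) {l : ℝ} (hl : 0 < l) :
    NullOnSphere b l (fun X => scaleDeriv k U i X * sphLaplacian b (scaleDeriv k U j) X
      + sphGradDot (scaleDeriv k U i) (scaleDeriv k U j) X) :=
  nullOnSphere_integration_by_parts hU.neg_one_lt hU.lt_one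
    (hU.admissible_scaleDeriv k hi).toAdmissible (hU.admissible_scaleDeriv k hj) hl

/-- The spherical Laplacian is symmetric. -/
lemma nullOnSphere_scaledLap {i : ℕ} (hi : i ≤ 3) {l : ℝ} (hl : 0 < l) :
    NullOnSphere b l (fun X => scaleDeriv k U i X * sphLaplacian b (scaledLap b U) X
      - scaledLap b U X * sphLaplacian b (scaleDeriv k U i) X) := by
  have h1 := nullOnSphere_integration_by_parts hU.neg_one_lt hU.lt_one
    (hU.admissible_scaleDeriv k hi).toAdmissible hU.admissible_scaledLap hl
  have h2 := nullOnSphere_integration_by_parts hU.neg_one_lt hU.lt_one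
    hU.admissible_scaledLap.toAdmissible (hU.admissible_scaleDeriv k hi) hl
  have h := h1.sub h2
  rw [sphGradDot_comm (scaledLap b U)] at h
  simpa only [add_sub_add_right_eq_sub] using h

end

lemma tame_mul (hU : NeumannPair b U) {i j : ℕ} (hi : i ≤ 5) (hj : j ≤ 5) :
    Tame |b| (fun X => height X ^ b * (scaleDeriv k U i X * scaleDeriv k U j X)) :=
  tame_weight_mul ((hU.extends_scaleDeriv k hi).mul (hU.extends_scaleDeriv k hj))

lemma tame_sphGradDot (hU : NeumannPair b U) {i j : ℕ} (hi : i ≤ 3) (hj : j ≤ 3) :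
    Tame |b| (fun X => height X ^ b * sphGradDot (scaleDeriv k U i) (scaleDeriv k U j) X) :=
  (hU.admissible_scaleDeriv k hi).toAdmissible.tame_sphGradDot hU.lt_one
    (hU.admissible_scaleDeriv k hj).toAdmissible

lemma tame_sphLaplacian (hU : NeumannPair b U) {i j : ℕ} (hi : i ≤ 3) (hj : j ≤ 3) :
    Tame |b| (fun X => height X ^ b *
      (sphLaplacian b (scaleDeriv k U i) X * sphLaplacian b (scaleDeriv k U j) X)) :=
  tame_weight_mul ((hU.extends_sphLaplacian k hi).mul (hU.extends_sphLaplacian k hj))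

lemma tame_dissipation (hU : NeumannPair b U) (α β α' β' : ℝ) :
    Tame |b| (fun X => height X ^ b * dissipationDensity α β α' β' b (scaleDeriv k U) X) :=
  ((((((hU.tame_mul k (i := 3) (j := 3) (by norm_num) (by norm_num)).smul_weight 3).add_weight
    ((hU.tame_mul k (i := 2) (j := 2) (by norm_num) (by norm_num)).smul_weight _)).add_weight
    ((hU.tame_mul k (i := 1) (j := 1) (by norm_num) (by norm_num)).smul_weight _)).add_weight
    ((hU.tame_sphGradDot k (i := 2) (j := 2) (by norm_num) (by norm_num)).smul_weight 6)).add_weight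
    ((hU.tame_sphGradDot k (i := 1) (j := 1) (by norm_num) (by norm_num)).smul_weight _)).add_weight
    ((hU.tame_sphLaplacian k (i := 1) (j := 1) (by norm_num) (by norm_num)).smul_weight 3)

/-- The boundary terms of the energy as an integral of `Δ_b² U`. -/
theorem boundaryForm_energyDensity (hU : NeumannPair b U) {l : ℝ} (hl : 0 < l) :
    boundaryForm b k (energyDensity (linCoef (n + b - 1) k) (constCoef (n + b - 1) k)
        (linCoef (n + b - 1) (k + 2)) (constCoef (n + b - 1) (k + 2)) b (scaleDeriv k U)) l
      = -(boundaryForm b k (fun X => scaleDeriv k U 1 X * scaledBilap b U X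
        + correctionDensity (linCoef (n + b - 1) k) (constCoef (n + b - 1) k)
          (linCoef (n + b - 1) (k + 2)) (constCoef (n + b - 1) (k + 2)) b (scaleDeriv k U) X) l) := by
  set α := linCoef (n + b - 1) k with hα
  set β := constCoef (n + b - 1) k with hβ
  set α' := linCoef (n + b - 1) (k + 2) with hα'
  set β' := constCoef (n + b - 1) (k + 2) with hβ'
  have N := fun (i j : ℕ) (hi : i ≤ 3) (hj : j ≤ 3) => hU.nullOnSphere_scaleDeriv k hi hj hl
  -- Write T for `scaledLap` and fᵢ = Dⁱ U. In f₁ times the polar expansion of |X|⁴ Δ_b² U, symmetry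
  -- replaces f₁ Δ_S T by T Δ_S f₁; every remaining fᵢ Δ_S fⱼ is traded for -∇_S fᵢ · ∇_S fⱼ. The
  -- multipliers are the coefficients with which these products occur.
  have hN := (((((hU.nullOnSphere_scaledLap k (i := 1) (by norm_num) hl).add
    (N 2 1 (by norm_num) (by norm_num))).add
    ((N 1 1 (by norm_num) (by norm_num)).const_mul (α + α'))).add
    ((N 0 1 (by norm_num) (by norm_num)).const_mul β)).add
    (N 1 2 (by norm_num) (by norm_num))).add
    ((N 1 0 (by norm_num) (by norm_num)).const_mul β')
  have hT := ((hU.shiftDensity_scaledBilap k).density.add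
    (hU.shiftDensity_correction k α β α' β').density).tame
  rw [neg_eq_neg_one_mul, ← boundaryForm_const_mul]
  refine boundaryForm_eq_of_null hU.neg_one_lt hU.lt_one k hl (hT.smul_weight (-1)) hN
    fun X hX => ?_
  rw [hU.scaledBilap_eq k hX, hU.eulerShift_eulerShift_scaledLap k hX,
    hU.eulerShift_scaledLap k hX, hU.scaledLap_eq k hX, ← hα, ← hβ, ← hα', ← hβ']
  simp only [energyDensity, correctionDensity,
    sphGradDot_comm (scaleDeriv k U 1) (scaleDeriv k U 2),
    sphGradDot_comm (scaleDeriv k U 1) (scaleDeriv k U 0)]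
  ring

/-- The algebraic heart of the monotonicity formula. -/
theorem boundaryForm_dissipation (hU : NeumannPair b U) {l : ℝ} (hl : 0 < l) :
    boundaryForm b k (fun X => eulerShift k (scaledLap b U) X * eulerShift k (scaledLap b U) X
        - scaledBilap b U X * scaleDeriv k U 2 X
        + scaleDeriv k U 1 X * eulerShift k (scaledBilap b U) X
        - 4 * (scaleDeriv k U 1 X * scaledBilap b U X)) l
      = boundaryForm b k (fun X => scaleDeriv k U 2 X * scaledBilap b U X
          + scaleDeriv k U 1 X * eulerShift k (scaledBilap b U) X
          + correctionShift (linCoef (n + b - 1) k) (constCoef (n + b - 1) k)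
          (linCoef (n + b - 1) (k + 2)) (constCoef (n + b - 1) (k + 2)) b (scaleDeriv k U) X) l
        + boundaryForm b k (dissipationDensity (linCoef (n + b - 1) k) (constCoef (n + b - 1) k)
          (linCoef (n + b - 1) (k + 2)) (constCoef (n + b - 1) (k + 2)) b (scaleDeriv k U)) l := by
  set α := linCoef (n + b - 1) k with hα
  set β := constCoef (n + b - 1) k with hβ
  set α' := linCoef (n + b - 1) (k + 2) with hα'
  set β' := constCoef (n + b - 1) (k + 2) with hβ'
  have N := fun (i j : ℕ) (hi : i ≤ 3) (hj : j ≤ 3) => hU.nullOnSphere_scaleDeriv k hi hj hl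
  -- Write T for `scaledLap`, B for `scaledBilap` and fᵢ = Dⁱ U. The fifth-order product f₁ D B
  -- occurs on both sides and drops out, leaving (D T)² - 2 f₂ B - 4 f₁ B. This explains the
  -- multipliers -2 and -4 for the symmetry of Δ_S; the others are the coefficients of fᵢ Δ_S fⱼ in
  -- the expansion.
  have hN := (((((((((((hU.nullOnSphere_scaledLap k (i := 2) (by norm_num) hl).const_mul (-2)).add
    ((hU.nullOnSphere_scaledLap k (i := 1) (by norm_num) hl).const_mul (-4))).add
    ((N 3 1 (by norm_num) (by norm_num)).const_mul 2)).add
    ((N 2 1 (by norm_num) (by norm_num)).const_mul (2 * α - 2 * α' - 4))).add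
    ((N 1 1 (by norm_num) (by norm_num)).const_mul (2 * β - 4 * (α + α')))).add
    ((N 2 2 (by norm_num) (by norm_num)).const_mul (-4))).add
    ((N 1 2 (by norm_num) (by norm_num)).const_mul (-2 * α - 4))).add
    ((N 0 2 (by norm_num) (by norm_num)).const_mul (-2 * β))).add
    ((N 2 0 (by norm_num) (by norm_num)).const_mul (-2 * β'))).add
    ((N 0 1 (by norm_num) (by norm_num)).const_mul (-4 * β))).add
    ((N 1 0 (by norm_num) (by norm_num)).const_mul (-4 * β'))
  have hT1 := ((hU.shiftDensity_scaledBilap k).add (hU.shiftDensity_correction k α β α' β')).tame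
  have hT2 := hU.tame_dissipation k α β α' β'
  rw [← boundaryForm_add hU.neg_one_lt hU.lt_one k hl hT1 hT2]
  refine boundaryForm_eq_of_null hU.neg_one_lt hU.lt_one k hl (hT1.add_weight hT2) hN
    fun X hX => ?_
  rw [hU.scaledBilap_eq k hX, hU.eulerShift_eulerShift_scaledLap k hX,
    hU.eulerShift_scaledLap k hX, hU.scaledLap_eq k hX, ← hα, ← hβ, ← hα', ← hβ']
  simp only [correctionShift, dissipationDensity, dissipationCoef₂, dissipationCoef₁,
    dissipationCoefGrad, sphGradDot_comm (scaleDeriv k U 1) (scaleDeriv k U 2),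
    sphGradDot_comm (scaleDeriv k U 1) (scaleDeriv k U 0),
    sphGradDot_comm (scaleDeriv k U 0) (scaleDeriv k U 2)]
  ring

end NeumannPair

end LaneEmden
end

/-! ### Derivatives of the bulk energy and of the potential energy. -/

noncomputable section

namespace LaneEmden

open Set Filter Topology MeasureTheory
open scoped Pointwise

variable {n : ℕ}

lemma measurableSet_upperBall : MeasurableSet (upperBall n) :=
  isOpen_upperHalf.measurableSet.inter Metric.isOpen_ball.measurableSet

lemma smul_upperBall {l : ℝ} (hl : 0 < l) :
    l • upperBall n = upperHalf n ∩ Metric.ball 0 l := by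
  ext X
  rw [Set.mem_smul_set_iff_inv_smul_mem₀ hl.ne']
  simp only [upperBall, upperHalf, mem_inter_iff, mem_ofPred_eq, height_smul, mem_ball_zero_iff,
    norm_smul, norm_inv, Real.norm_eq_abs, abs_of_pos hl, inv_pos.2 hl, mul_pos_iff_of_pos_left]
  rw [inv_mul_lt_iff₀ hl, mul_one]

lemma setIntegral_upperBall_smul (G : Space n → ℝ) {l : ℝ} (hl : 0 < l) :
    ∫ X in upperBall n, G (l • X) = (l ^ (n + 1))⁻¹ * ∫ X in upperHalf n ∩ Metric.ball 0 l, G X := by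
  rw [Measure.setIntegral_comp_smul_of_pos volume G _ hl, smul_upperBall hl, smul_eq_mul,
    finrank_euclideanSpace_fin]

lemma setIntegral_ball_smul (G : EuclideanSpace ℝ (Fin n) → ℝ) {l : ℝ} (hl : 0 < l) :
    ∫ x in Metric.ball (0 : EuclideanSpace ℝ (Fin n)) 1, G (l • x)
      = (l ^ n)⁻¹ * ∫ x in Metric.ball (0 : EuclideanSpace ℝ (Fin n)) l, G x := by
  rw [Measure.setIntegral_comp_smul_of_pos volume G _ hl, smul_unitBall_of_pos hl, smul_eq_mul,
    finrank_euclideanSpace_fin]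

lemma ae_upperBall : ∀ᵐ X ∂(volume.restrict (upperBall n)), X ∈ upperBall n :=
  ae_restrict_mem measurableSet_upperBall

lemma integrable_upperBall_height_rpow {β : ℝ} (hβ : β < 1) :
    Integrable (fun X : Space n => height X ^ (-β)) (volume.restrict (upperBall n)) :=
  (integrableOn_height_rpow hβ 1).mono_set
    (inter_subset_inter_right _ Metric.ball_subset_closedBall)

lemma Tame.integrable_upperBall {β : ℝ} (hβ0 : 0 ≤ β) (hβ : β < 1) {F : Space n → ℝ}
    (hF : Tame β F) {l : ℝ} (hl : 0 < l) :
    IntegrableOn (fun X => F (l • X)) (upperBall n) :=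
  hF.integrable_dilation hβ0 measurable_id (ae_upperBall.mono fun _ h => h.1)
    (ae_upperBall.mono fun _ h => (mem_ball_zero_iff.1 h.2).le)
    (integrable_upperBall_height_rpow hβ) hl

lemma hasDerivAt_integral_upperBall {β : ℝ} (hβ0 : 0 ≤ β) (hβ : β < 1) {F : Space n → ℝ}
    (hs : SmoothUpper 1 F) (hF : Tame β F) (hF' : Tame β (euler F)) {l : ℝ} (hl : 0 < l) :
    HasDerivAt (fun r => ∫ X in upperBall n, F (r • X))
      ((∫ X in upperBall n, euler F (l • X)) / l) l :=
  hasDerivAt_integral_dilation hβ0 measurable_id (ae_upperBall.mono fun _ h => h.1)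
    (ae_upperBall.mono fun _ h => (mem_ball_zero_iff.1 h.2).le)
    (integrable_upperBall_height_rpow hβ) hs hF hF' hl

lemma ContinuousOn.comp_point {F : Space n → ℝ} (hF : ContinuousOn F (closedUpperHalf n)) :
    Continuous fun x : EuclideanSpace ℝ (Fin n) => F (point x 0) :=
  hF.comp_continuous (continuous_point.comp (by fun_prop :
    Continuous fun x : EuclideanSpace ℝ (Fin n) => (x, (0 : ℝ))))
    fun x => point_mem_closedUpperHalf x le_rfl

/-- Differentiation of integrals of dilated functions over the unit ball. -/
lemma hasDerivAt_integral_ball {Ψ Θ : EuclideanSpace ℝ (Fin n) → ℝ} (hΨ : Continuous Ψ)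
    (hΘ : Continuous Θ)
    (h : ∀ x, ∀ t, 0 < t → HasDerivAt (fun τ : ℝ => Ψ (τ • x)) (Θ (t • x) / t) t) {l : ℝ}
    (hl : 0 < l) :
    HasDerivAt (fun r : ℝ => ∫ x in Metric.ball (0 : EuclideanSpace ℝ (Fin n)) 1, Ψ (r • x))
      ((∫ x in Metric.ball (0 : EuclideanSpace ℝ (Fin n)) 1, Θ (l • x)) / l) l := by
  have hint : ∀ {G : EuclideanSpace ℝ (Fin n) → ℝ}, Continuous G →
      IntegrableOn G (Metric.ball (0 : EuclideanSpace ℝ (Fin n)) 1) := fun hG =>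
    (hG.continuousOn.integrableOn_compact (isCompact_closedBall 0 1)).mono_set
      Metric.ball_subset_closedBall
  have hsm : ∀ {G : EuclideanSpace ℝ (Fin n) → ℝ} (r : ℝ), Continuous G →
      Continuous fun x => G (r • x) := fun r hG => hG.comp (continuous_const_smul r)
  obtain ⟨C, hC⟩ := (isCompact_closedBall (0 : EuclideanSpace ℝ (Fin n))
    (2 * l)).exists_bound_of_continuousOn hΘ.continuousOn
  have hnhds : Ioo (l / 2) (2 * l) ∈ 𝓝 l := Ioo_mem_nhds (by linarith) (by linarith)
  have hd := hasDerivAt_integral_of_dominated_loc_of_deriv_le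
    (μ := volume.restrict (Metric.ball (0 : EuclideanSpace ℝ (Fin n)) 1))
    (F := fun r x => Ψ (r • x)) (F' := fun r x => Θ (r • x) / r)
    (bound := fun _ => C * (l / 2)⁻¹) hnhds
    (.of_forall fun r => (hint (hsm r hΨ)).aestronglyMeasurable) (hint (hsm l hΨ))
    (((hint (hsm l hΘ)).div_const l).aestronglyMeasurable) ?_ (hint continuous_const) ?_
  · rw [← integral_div]
    exact hd.2
  · filter_upwards [ae_restrict_mem Metric.isOpen_ball.measurableSet] with x hx r hr
    have hr0 : 0 < r := by linarith [hr.1]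
    rw [mem_ball_zero_iff] at hx
    have h2 := hC (r • x) (by
      rw [mem_closedBall_zero_iff, norm_smul, Real.norm_eq_abs, abs_of_pos hr0]
      nlinarith [hr.2, norm_nonneg x])
    rw [norm_div, Real.norm_eq_abs r, abs_of_pos hr0, div_eq_mul_inv]
    exact mul_le_mul h2 ((inv_le_inv₀ hr0 (by linarith)).2 hr.1.le) (by positivity)
      ((norm_nonneg _).trans h2)
  · exact .of_forall fun x r hr => h x r (by linarith [hr.1])

/-- The bulk energy of the rescaling of `U`. -/
def bulkEnergy (b k : ℝ) (U : Space n → ℝ) (l : ℝ) : ℝ :=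
  l ^ (2 * k + 6 - b) * (1 / 2 * ∫ X in upperBall n, height (l • X) ^ b *
    gradDot (weightedLaplacian b U) (weightedLaplacian b U) (l • X))

/-- The potential energy of the rescaling of `U`. -/
def potentialEnergy (k p : ℝ) (U : Space n → ℝ) (l : ℝ) : ℝ :=
  l ^ (k * (p + 1)) * ∫ x in Metric.ball (0 : EuclideanSpace ℝ (Fin n)) 1,
    |U (point (l • x) 0)| ^ (p + 1)

/-- V extends D U to the boundary, and `hasDerivAt_trace` makes it the derivative of the trace of U
in the scale. The derivative of the prefactor supplies the k U contained in D U; the remaining power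
of l comes from rescaling the unit ball to radius l. -/
lemma hasDerivAt_potentialEnergy {k p : ℝ} (hp : 1 < p) {U V : Space n → ℝ} (hs : SmoothUpper 1 U)
    (hU : ContinuousOn U (closedUpperHalf n)) (hV : ContinuousOn V (closedUpperHalf n))
    (hUV : EqOn V (eulerShift k U) (upperHalf n)) {l : ℝ} (hl : 0 < l) :
    HasDerivAt (potentialEnergy k p U)
      ((p + 1) * (l ^ (k * (p + 1) - 1 - n) * ∫ x in Metric.ball (0 : EuclideanSpace ℝ (Fin n)) l,
        V (point x 0) * (|U (point x 0)| ^ (p - 1) * U (point x 0)))) l := by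
  have hUc : Continuous fun x : EuclideanSpace ℝ (Fin n) => U (point x 0) := ContinuousOn.comp_point hU
  have hVc : Continuous fun x : EuclideanSpace ℝ (Fin n) => V (point x 0) := ContinuousOn.comp_point hV
  have hpc : Continuous fun x : EuclideanSpace ℝ (Fin n) =>
      |U (point x 0)| ^ (p - 1) * U (point x 0) :=
    (hUc.abs.rpow_const fun _ => Or.inr (by linarith)).mul hUc
  have hd : ∀ (x : EuclideanSpace ℝ (Fin n)) (t : ℝ), 0 < t →
      HasDerivAt (fun τ : ℝ => |U (point (τ • x) 0)| ^ (p + 1))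
        ((p + 1) * ((V (point (t • x) 0) - k * U (point (t • x) 0)) *
          (|U (point (t • x) 0)| ^ (p - 1) * U (point (t • x) 0))) / t) t := by
    intro x t ht
    have h1 := hasDerivAt_trace (G := fun X => V X - k * U X) hs hU (fun _ _ => rfl)
      (hV.sub (hU.const_mul k)) (fun X hX => by simp only [hUV hX, eulerShift]; ring) x ht
    have h2 := (hasDerivAt_abs_rpow (U (point (t • x) 0)) (p := p + 1) (by linarith)).comp t h1
    refine h2.congr_deriv ?_
    rw [show p + 1 - 2 = p - 1 by ring]
    ring
  have hVP : Continuous fun x : EuclideanSpace ℝ (Fin n) =>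
      V (point x 0) * (|U (point x 0)| ^ (p - 1) * U (point x 0)) := hVc.mul hpc
  have hUP : Continuous fun x : EuclideanSpace ℝ (Fin n) => |U (point x 0)| ^ (p + 1) :=
    hUc.abs.rpow_const fun _ => Or.inr (by linarith)
  have hΘ : Continuous fun x : EuclideanSpace ℝ (Fin n) =>
      (p + 1) * ((V (point x 0) - k * U (point x 0)) *
        (|U (point x 0)| ^ (p - 1) * U (point x 0))) :=
    continuous_const.mul ((hVc.sub (continuous_const.mul hUc)).mul hpc)
  have h := hasDerivAt_integral_ball hUP hΘ hd hl
  have hr := Real.hasDerivAt_rpow_const (x := l) (p := k * (p + 1)) (Or.inl hl.ne')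
  refine (hr.mul h).congr_deriv ?_
  have e1 : ∀ z : ℝ, |z| ^ (p + 1) = z * (|z| ^ (p - 1) * z) := by
    intro z
    rw [mul_left_comm, ← sq, ← sq_abs z, ← Real.rpow_natCast, ← Real.rpow_add_of_nonneg
      (abs_nonneg z) (by linarith) (by norm_num)]
    congr 1
    push_cast
    ring
  have hint : ∀ {G : EuclideanSpace ℝ (Fin n) → ℝ}, Continuous G →
      IntegrableOn (fun x => G (l • x)) (Metric.ball (0 : EuclideanSpace ℝ (Fin n)) 1) := fun hG =>
    ((hG.comp (continuous_const_smul l)).continuousOn.integrableOn_compact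
      (isCompact_closedBall 0 1)).mono_set Metric.ball_subset_closedBall
  have e2 : ∫ x in Metric.ball (0 : EuclideanSpace ℝ (Fin n)) 1,
        (p + 1) * ((V (point (l • x) 0) - k * U (point (l • x) 0)) *
          (|U (point (l • x) 0)| ^ (p - 1) * U (point (l • x) 0)))
      = (p + 1) * ((∫ x in Metric.ball (0 : EuclideanSpace ℝ (Fin n)) 1,
          V (point (l • x) 0) * (|U (point (l • x) 0)| ^ (p - 1) * U (point (l • x) 0)))
        - k * ∫ x in Metric.ball (0 : EuclideanSpace ℝ (Fin n)) 1, |U (point (l • x) 0)| ^ (p + 1)) := by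
    rw [integral_const_mul, ← integral_const_mul k, ← integral_sub (hint hVP)
      ((hint hUP).const_mul k)]
    congr 2
    ext x
    rw [e1]
    ring
  have e3 := setIntegral_ball_smul (fun x : EuclideanSpace ℝ (Fin n) =>
    V (point x 0) * (|U (point x 0)| ^ (p - 1) * U (point x 0))) hl
  rw [e2, e3, Real.rpow_sub_natCast hl.ne', Real.rpow_sub_one hl.ne']
  field_simp
  ring

section Bulk

variable {b : ℝ} {U : Space n → ℝ} (k : ℝ) (hU : NeumannPair b U)
include hU

namespace NeumannPair

lemma admissible_laplacian : NeumannAdmissible b (weightedLaplacian b U) :=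
  hU.level_one.admissible hU.neg_one_lt hU.lt_one hU.regular (by norm_num)

lemma admissible_eulerShift_laplacian (c : ℝ) :
    NeumannAdmissible b (eulerShift c (weightedLaplacian b U)) :=
  (hU.level_one.eulerShift hU.neg_one_lt hU.lt_one hU.regular (by norm_num) c).admissible
    hU.neg_one_lt hU.lt_one hU.regular (by norm_num)

lemma smooth_laplacian : SmoothUpper 4 (weightedLaplacian b U) :=
  hU.level_one.gen.smooth hU.regular (by norm_num)

lemma tame_bulk : Tame |b| (fun X => height X ^ b *
    gradDot (weightedLaplacian b U) (weightedLaplacian b U) X) :=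
  hU.admissible_laplacian.toAdmissible.tame_gradDot hU.admissible_laplacian.toAdmissible

lemma gradDot_eulerShift_laplacian (c : ℝ) {X : Space n} (hX : X ∈ upperHalf n) :
    gradDot (eulerShift c (weightedLaplacian b U)) (weightedLaplacian b U) X
      = gradDot (euler (weightedLaplacian b U)) (weightedLaplacian b U) X
        + c * gradDot (weightedLaplacian b U) (weightedLaplacian b U) X := by
  have hs := hU.smooth_laplacian
  have d0 := hs.differentiableAt (by norm_num) hX
  have d1 := (SmoothUpper.euler (m := 3) hs).differentiableAt (by norm_num) hX
  refine (gradDot_add_left d1 (d0.const_mul c)).trans ?_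
  rw [gradDot_const_mul_left d0]

/-- The multiple -(2k + 6 - b) is what the derivative of the prefactor l^{2k+6-b} in `bulkEnergy`
cancels, leaving only the gradient of (D + 2) Δ_b U against that of Δ_b U. -/
lemma euler_bulk {X : Space n} (hX : X ∈ upperHalf n) :
    euler (fun X => height X ^ b * gradDot (weightedLaplacian b U) (weightedLaplacian b U) X) X
      = 2 * (height X ^ b * gradDot (eulerShift (k + 2) (weightedLaplacian b U))
          (weightedLaplacian b U) X)
        + (-(2 * k + 6 - b)) * (height X ^ b *
          gradDot (weightedLaplacian b U) (weightedLaplacian b U) X) := by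
  have hs := hU.smooth_laplacian
  have hg : SmoothUpper 3 (gradDot (weightedLaplacian b U) (weightedLaplacian b U)) :=
    smoothUpper_gradDot hs hs
  rw [euler_mul ((smoothUpper_height_rpow 1 b).differentiableAt le_rfl hX)
    (hg.differentiableAt (by norm_num) hX), euler_height_rpow b hX,
    euler_gradDot (hs.mono (by norm_num)) (hs.mono (by norm_num)) hX,
    hU.gradDot_eulerShift_laplacian (k + 2) hX,
    gradDot_comm (weightedLaplacian b U) (euler (weightedLaplacian b U))]
  ring

lemma hasDerivAt_bulkEnergy {l : ℝ} (hl : 0 < l) :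
    HasDerivAt (bulkEnergy b k U)
      (l ^ (2 * k + 6 - b - 1 - (n + 1 : ℕ)) * ∫ X in upperHalf n ∩ Metric.ball 0 l,
        height X ^ b * gradDot (eulerShift (k + 2) (weightedLaplacian b U))
          (weightedLaplacian b U) X) l := by
  have hs := hU.smooth_laplacian
  have hg : SmoothUpper 3 (gradDot (weightedLaplacian b U) (weightedLaplacian b U)) :=
    smoothUpper_gradDot hs hs
  have hT1 := hU.tame_bulk
  have hT2 : Tame |b| (fun X => height X ^ b *
      gradDot (eulerShift (k + 2) (weightedLaplacian b U)) (weightedLaplacian b U) X) :=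
    (hU.admissible_eulerShift_laplacian (k + 2)).toAdmissible.tame_gradDot
      hU.admissible_laplacian.toAdmissible
  have hb := abs_lt_one_of_mem hU.neg_one_lt hU.lt_one
  have hI := hasDerivAt_integral_upperBall (abs_nonneg b) hb
    (SmoothUpper.mul (smoothUpper_height_rpow 1 b) (hg.mono (by norm_num))) hT1
    (((hT2.const_mul 2).add (hT1.const_mul (-(2 * k + 6 - b)))).congr fun X hX =>
      hU.euler_bulk k hX) hl
  have hr := Real.hasDerivAt_rpow_const (x := l) (p := 2 * k + 6 - b) (Or.inl hl.ne')
  refine (hr.mul (hI.const_mul (1 / 2))).congr_deriv ?_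
  have e1 : ∫ X in upperBall n, euler (fun X => height X ^ b *
        gradDot (weightedLaplacian b U) (weightedLaplacian b U) X) (l • X)
      = 2 * (∫ X in upperBall n, height (l • X) ^ b *
          gradDot (eulerShift (k + 2) (weightedLaplacian b U)) (weightedLaplacian b U) (l • X))
        + (-(2 * k + 6 - b)) * ∫ X in upperBall n, height (l • X) ^ b *
          gradDot (weightedLaplacian b U) (weightedLaplacian b U) (l • X) := by
    rw [← integral_const_mul, ← integral_const_mul, ← integral_add
      ((hT2.integrable_upperBall (abs_nonneg b) hb hl).const_mul _)
      ((hT1.integrable_upperBall (abs_nonneg b) hb hl).const_mul _)]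
    refine setIntegral_congr_fun measurableSet_upperBall fun X hX => ?_
    exact hU.euler_bulk k (smul_mem_upperHalf hl hX.1)
  have e2 := setIntegral_upperBall_smul (fun X => height X ^ b *
    gradDot (eulerShift (k + 2) (weightedLaplacian b U)) (weightedLaplacian b U) X) hl
  rw [e1, e2, Real.rpow_sub_natCast hl.ne', Real.rpow_sub_one hl.ne']
  field_simp
  ring

end NeumannPair

end Bulk

end LaneEmden
end

/-! ### The derivative of the energy. -/

noncomputable section

namespace LaneEmden

open Set Filter Topology MeasureTheory

variable {n : ℕ}

lemma sphereMean_normSq_mul (b : ℝ) (q : Space n → ℝ) {l : ℝ} (hl : 0 < l) :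
    sphereMean (fun X => height X ^ b * (‖X‖ ^ 2 * q X)) l
      = l ^ 2 * sphereMean (fun X => height X ^ b * q X) l := by
  simp only [sphereMean, norm_smul, norm_sphere, Real.norm_eq_abs, abs_of_pos hl, mul_one,
    mul_left_comm _ (l ^ 2)]
  rw [integral_const_mul]

/-- The energy in terms of the Euler operator. -/
def eulerEnergy (b k p κ : ℝ) (U : Space n → ℝ) (l : ℝ) : ℝ :=
  bulkEnergy b k U l - κ / (p + 1) * potentialEnergy k p U l
    + boundaryForm b k (energyDensity (linCoef (n + b - 1) k) (constCoef (n + b - 1) k)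
        (linCoef (n + b - 1) (k + 2)) (constCoef (n + b - 1) (k + 2)) b (scaleDeriv k U)) l
    + (k / 2 + 1) * boundaryForm b k (fun X => scaledLap b U X * scaledLap b U X) l

/-- The boundary flux in the derivative of the bulk energy, made homogeneous. -/
lemma NeumannPair.flux_eq {b : ℝ} {U : Space n → ℝ} (k : ℝ) (hU : NeumannPair b U) {X : Space n}
    (hX : X ∈ upperHalf n) :
    ‖X‖ ^ 2 * (‖X‖ ^ 2 * (eulerShift (k + 2) (weightedLaplacian b U) X
          * euler (weightedLaplacian b U) X
        + (-1) * (weightedLaplacian b (weightedLaplacian b U) X * euler (scaleDeriv k U 1) X)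
        + scaleDeriv k U 1 X * euler (weightedLaplacian b (weightedLaplacian b U)) X))
      = (eulerShift k (scaledLap b U) X * eulerShift k (scaledLap b U) X
        - scaledBilap b U X * scaleDeriv k U 2 X
        + scaleDeriv k U 1 X * eulerShift k (scaledBilap b U) X
        - 4 * (scaleDeriv k U 1 X * scaledBilap b U X))
        + (-(k / 2 + 1)) * (eulerShift k (scaledLap b U) X * scaledLap b U X
          + scaledLap b U X * eulerShift k (scaledLap b U) X) := by
  have hg : SmoothUpper 4 (weightedLaplacian b U) := hU.smooth_laplacian
  have hh : SmoothUpper 2 (weightedLaplacian b (weightedLaplacian b U)) :=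
    hU.level_two.gen.smooth hU.regular (by norm_num)
  have h1 : eulerShift k (scaledLap b U) X
      = ‖X‖ ^ 2 * eulerShift (k + 2) (weightedLaplacian b U) X :=
    eulerShift_normSq_mul k (hg.mono (by norm_num)) hX
  have h2 : eulerShift k (scaledBilap b U) X
      = ‖X‖ ^ 2 * (‖X‖ ^ 2 * eulerShift (k + 2 + 2)
          (weightedLaplacian b (weightedLaplacian b U)) X) := by
    have hs : SmoothUpper 1 (fun Y : Space n => ‖Y‖ ^ 2 *
        weightedLaplacian b (weightedLaplacian b U) Y) :=
      .mul (smoothUpper_normSq 1) (hh.mono (by norm_num))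
    have := eulerShift_normSq_mul k hs hX
    simp only at this
    rw [eulerShift_normSq_mul (k + 2) (hh.mono (by norm_num)) hX] at this
    exact this
  -- With all Euler derivatives expressed through D, and T for `scaledLap`, the lower-order
  -- remainders add up to -(k + 2) T · D T. This is an exact derivative, compensated by the term
  -- (k/2 + 1) ∫ T² of the energy.
  rw [euler_scaleDeriv, h1, h2]
  simp only [eulerShift, scaledLap, scaledBilap]
  ring

/-- The monotonicity formula. -/
theorem IsExtensionSolution.hasDerivAt_eulerEnergy {s p κ : ℝ} {U : Space n → ℝ} (hs₂ : 2 < s)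
    (hs₃ : s < 3) (hp : 1 < p) (hU : IsExtensionSolution s p κ U) {k : ℝ}
    (hk : k = 2 * s / (p - 1)) {l : ℝ} (hl : 0 < l) :
    HasDerivAt (eulerEnergy (5 - 2 * s) k p κ U)
      (boundaryForm (5 - 2 * s) k (dissipationDensity (linCoef (n + (5 - 2 * s) - 1) k)
        (constCoef (n + (5 - 2 * s) - 1) k) (linCoef (n + (5 - 2 * s) - 1) (k + 2))
        (constCoef (n + (5 - 2 * s) - 1) (k + 2)) (5 - 2 * s) (scaleDeriv k U)) l / l) l := by
  have hN : NeumannPair (5 - 2 * s) U := hU.neumannPair hs₂ hs₃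
  -- The choice k (p - 1) = 2s is what makes the powers of l in the bulk and potential derivatives
  -- agree.
  have hkp : k * (p + 1) = 2 * k + 2 * s := by
    have : p - 1 ≠ 0 := by linarith
    have h2 : k * (p - 1) = 2 * s := by rw [hk]; field_simp
    linarith
  set b := 5 - 2 * s with hb
  obtain ⟨V, hV, hVv⟩ := hN.extends_scaleDeriv k (i := 1) (by norm_num)
  have hVe : EqOn V (eulerShift k U) (upperHalf n) := hVv
  have hP := hasDerivAt_potentialEnergy (U := U) hp (hN.smooth_scaleDeriv k (i := 0) (m := 1) (by norm_num)
    (by norm_num)) hU.continuousOn hV hVe hl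
  have hB := hN.hasDerivAt_bulkEnergy k hl
  have hK : ∀ x, Tendsto (fun y : ℝ => LaneEmden.conormal b
      (weightedLaplacian b (weightedLaplacian b U)) (point x y)) (𝓝[>] 0)
      (𝓝 (-κ * (|U (point x 0)| ^ (p - 1) * U (point x 0)))) := fun x =>
    (hU.boundary_two x).congr fun y => by
      simp only [LaneEmden.conormal, height_point]
      rfl
  have hG := integral_gradDot_halfBall hN.neg_one_lt hN.lt_one hN.admissible_laplacian
    (hN.admissible_scaleDeriv k (i := 1) (by norm_num))
    (hN.level_two.admissible hN.regular (by norm_num))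
    (hN.level_two.gen.smooth hN.regular (by norm_num))
    (hN.admissible_eulerShift_laplacian (k + 2)).toAdmissible (fun _ _ => rfl)
    (weightedLaplacian_eulerShift b k
      (hN.smooth_scaleDeriv k (i := 0) (m := 3) (by norm_num) (by norm_num)))
    hU.equation (K := fun X => -κ * (|U X| ^ (p - 1) * U X)) hV hVv hK hl
  have hW := (hN.shiftDensity_scaledLap k).hasDerivAt hN.neg_one_lt hN.lt_one hl
  have hC := ((hN.shiftDensity_scaledBilap k).add (hN.shiftDensity_correction k
    (linCoef (n + b - 1) k) (constCoef (n + b - 1) k)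
    (linCoef (n + b - 1) (k + 2)) (constCoef (n + b - 1) (k + 2)))).hasDerivAt
    hN.neg_one_lt hN.lt_one hl
  -- The spherical terms are differentiated through their equivalent form containing Δ_b² U, since
  -- that derivative is the one occurring in `boundaryForm_dissipation`.
  have hE := hC.neg.congr_of_eventuallyEq (f₁ := boundaryForm b k (energyDensity
    (linCoef (n + b - 1) k) (constCoef (n + b - 1) k)
    (linCoef (n + b - 1) (k + 2)) (constCoef (n + b - 1) (k + 2)) b (scaleDeriv k U))) (by
      filter_upwards [Ioi_mem_nhds hl] with r hr using hN.boundaryForm_energyDensity k hr)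
  -- Two factors l² = |X|² are absorbed into the density, which makes the flux a boundary form of
  -- degree 2k.
  have hflux : l ^ (2 * k - b) * (l ^ 2 * (l ^ 2 * sphereMean (fun X => height X ^ b *
        (eulerShift (k + 2) (weightedLaplacian b U) X * euler (weightedLaplacian b U) X
        + (-1) * (weightedLaplacian b (weightedLaplacian b U) X * euler (scaleDeriv k U 1) X)
        + scaleDeriv k U 1 X * euler (weightedLaplacian b (weightedLaplacian b U)) X)) l))
      = boundaryForm b k (fun X => eulerShift k (scaledLap b U) X * eulerShift k (scaledLap b U) X
        - scaledBilap b U X * scaleDeriv k U 2 X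
        + scaleDeriv k U 1 X * eulerShift k (scaledBilap b U) X
        - 4 * (scaleDeriv k U 1 X * scaledBilap b U X)) l
        + (-(k / 2 + 1)) * boundaryForm b k
          (fun X => eulerShift k (scaledLap b U) X * scaledLap b U X
          + scaledLap b U X * eulerShift k (scaledLap b U) X) l := by
    rw [← sphereMean_normSq_mul b _ hl, ← sphereMean_normSq_mul b _ hl,
      ← boundaryForm_const_mul, ← boundaryForm_add hN.neg_one_lt hN.lt_one k hl ?_
        ((hN.shiftDensity_scaledLap k).tame.smul_weight _)]
    · exact boundaryForm_congr b k (fun X hX => hN.flux_eq k hX) hl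
    · have e1 := hN.extends_eulerShift_scaledLap k
      have e2 := hN.extends_scaledBilap
      have e3 := hN.extends_eulerShift_scaledBilap k
      have e4 := hN.extends_scaleDeriv k (i := 1) (by norm_num)
      have e5 := hN.extends_scaleDeriv k (i := 2) (by norm_num)
      refine tame_weight_mul (((((e1.mul e1).add ((e2.mul e5).const_mul (-1))).add
        (e4.mul e3)).add ((e4.mul e2).const_mul (-4))).congr fun X _ => ?_)
      ring
  have hdis := hN.boundaryForm_dissipation k hl
  refine (((hB.sub (hP.const_mul (κ / (p + 1)))).add hE).add
    (hW.const_mul (k / 2 + 1))).congr_deriv ?_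
  have hVK : ∫ x in Metric.ball (0 : EuclideanSpace ℝ (Fin n)) l,
        V (point x 0) * (-κ * (|U (point x 0)| ^ (p - 1) * U (point x 0)))
      = -κ * ∫ x in Metric.ball (0 : EuclideanSpace ℝ (Fin n)) l,
        V (point x 0) * (|U (point x 0)| ^ (p - 1) * U (point x 0)) := by
    rw [← integral_const_mul]
    congr 1
    ext x
    ring
  have hexp1 : l ^ (2 * k + 6 - b - 1 - ((n + 1 : ℕ) : ℝ)) = l ^ (2 * k - b) * l ^ 4 / l ^ n := by
    rw [show 2 * k + 6 - b - 1 - ((n + 1 : ℕ) : ℝ) = 2 * k - b + (4 : ℕ) - (n : ℕ) by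
      push_cast; ring, Real.rpow_sub_natCast hl.ne', Real.rpow_add_natCast hl.ne']
  have hexp2 : l ^ (k * (p + 1) - 1 - n) = l ^ (2 * k - b) * l ^ 4 / l ^ n := by
    rw [show k * (p + 1) - 1 - n = 2 * k - b + (4 : ℕ) - (n : ℕ) by
      rw [hkp, hb]; push_cast; ring, Real.rpow_sub_natCast hl.ne', Real.rpow_add_natCast hl.ne']
  have hp1 : p + 1 ≠ 0 := by linarith
  -- S is the spherical flux and I the flat one. I cancels against the potential energy, B against
  -- the spherical terms and W against the term in (Δ_b U)², so that only the dissipation D remains.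
  have halg : ∀ S I B D W : ℝ,
      l ^ (2 * k - b) * (l ^ 2 * (l ^ 2 * S)) = B + D + (-(k / 2 + 1)) * W →
      l ^ (2 * k - b) * l ^ 4 / l ^ n * (l ^ n * S / l - -κ * I)
        - κ / (p + 1) * ((p + 1) * (l ^ (2 * k - b) * l ^ 4 / l ^ n * I))
        + -(B / l) + (k / 2 + 1) * (W / l) = D / l := by
    intro S I B D W h
    field_simp at h ⊢
    linear_combination l ^ n * h
  rw [hG, hVK, hexp1, hexp2]
  rw [hdis] at hflux
  exact halg _ _ _ _ _ hflux

end LaneEmden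
end

/-! ### Signs of the dissipation coefficients and the range of exponents. -/

noncomputable section

namespace LaneEmden

open Set Filter Topology MeasureTheory

variable {n : ℕ}

section Positivity

variable {m k : ℝ}

/-- Under these bounds both constant coefficients are negative and both linear ones positive, so no
summand of `dissipationCoef₁` is negative. With m = n - 2s + 4 the bound 2k + 4 < m is
supercriticality. -/
lemma dissipationCoef₁_pos (hk : 0 < k) (hkm : 2 * k + 4 < m) :
    0 < dissipationCoef₁ (linCoef m k) (constCoef m k) (linCoef m (k + 2)) (constCoef m (k + 2)) := by
  have h1 : constCoef m k < 0 := mul_neg_of_pos_of_neg hk (by linarith)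
  have h2 : constCoef m (k + 2) < 0 := mul_neg_of_pos_of_neg (by linarith) (by linarith)
  have h3 : 0 < linCoef m k := by unfold linCoef; linarith
  have h4 : 0 < linCoef m (k + 2) := by unfold linCoef; linarith
  have h5 := mul_pos_of_neg_of_neg h1 h2
  have h6 := mul_neg_of_pos_of_neg h3 h2
  have h7 := mul_neg_of_pos_of_neg h4 h1
  have h8 := sq_nonneg (constCoef m k)
  unfold dissipationCoef₁
  linarith

lemma dissipationCoefGrad_nonneg (hk : 0 < k) (hkm : 2 * k + 4 < m) :
    0 ≤ dissipationCoefGrad (linCoef m k) (constCoef m k) (linCoef m (k + 2))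
      (constCoef m (k + 2)) := by
  have h : dissipationCoefGrad (linCoef m k) (constCoef m k) (linCoef m (k + 2))
      (constCoef m (k + 2)) = 6 * ((k + 2) * (m - k - 2)) := by
    unfold dissipationCoefGrad linCoef constCoef
    ring
  rw [h]
  exact mul_nonneg (by norm_num) (mul_nonneg (by linarith) (by linarith))

/-- Twice the coefficient equals 3 m² + 32 - 5 (m - 4 - 2k)². The constant 26 in the hypothesis,
which comes from p_m(n), is thus stronger than what the sign requires. -/
lemma dissipationCoef₂_nonneg (h : 5 * (m - 4 - 2 * k) ^ 2 < 3 * m ^ 2 + 26) :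
    0 ≤ dissipationCoef₂ (linCoef m k) (constCoef m k) (linCoef m (k + 2)) (constCoef m (k + 2)) := by
  unfold dissipationCoef₂ linCoef constCoef
  linarith

end Positivity

/-- With N = n - 2s the lower bound on p says N (p - 1) > 4s, which is 2k < N for k = 2s/(p-1). -/
lemma exponent_lt_of_supercritical {s p N : ℝ} (hs : 0 < s) (hN : 0 < N)
    (hp : (N + 4 * s) / N < p) : 1 < p ∧ 0 < 2 * s / (p - 1) ∧ 2 * (2 * s / (p - 1)) < N := by
  rw [div_lt_iff₀ hN] at hp
  have hp1 : 0 < p - 1 := by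
    by_contra! h
    nlinarith
  refine ⟨by linarith, by positivity, ?_⟩
  rw [mul_div_assoc', div_lt_iff₀ hp1]
  nlinarith

/-- With N = n - 2s the radicand in p_m(n) is 5 (3 (N + 4)² + 26), and p < p_m(n) rearranges to 5 (N
- 2k) < √(radicand) when p_m(n) is finite. For N ≤ 6 + √73 one has 5 N² ≤ 3 (N + 4)² + 26, so 0 < 2k
< N suffices. -/
lemma sq_lt_of_lt_upperExponent {s p k : ℝ} (hs : 0 < s) (hp : 1 < p)
    (hk : k = 2 * s / (p - 1)) (hkN : 2 * k < n - 2 * s)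
    (hpm : (p : EReal) < upperExponent n s) :
    5 * (((n : ℝ) - 2 * s) - 2 * k) ^ 2 < 3 * ((n : ℝ) - 2 * s + 4) ^ 2 + 26 := by
  have hp1 : 0 < p - 1 := by linarith
  have hk0 : 0 < k := by rw [hk]; positivity
  have h73 : √73 ^ 2 = 73 := Real.sq_sqrt (by norm_num)
  have h73' : 0 ≤ √73 := Real.sqrt_nonneg _
  set N : ℝ := n - 2 * s with hN
  by_cases hn : (n : ℝ) ≤ 2 * s + 6 + √73
  · have h1 : N - 6 ≤ √73 := by linarith
    -- The larger root of N² - 12 N - 37 is 6 + √73.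
    have h2 : N ^ 2 ≤ 12 * N + 37 := by
      by_cases h6 : N ≤ 6
      · nlinarith
      · nlinarith
    have h3 : (N - 2 * k) ^ 2 < N ^ 2 := by nlinarith
    nlinarith
  · rw [upperExponent, if_neg hn, EReal.coe_lt_coe_iff] at hpm
    push Not at hn
    rw [← hN] at hpm
    have h1 : √73 < N - 6 := by linarith
    have h2 : 12 * N + 37 < N ^ 2 := by nlinarith
    set T := √(15 * N ^ 2 + 120 * N + 370) with hT
    have hT2 : T ^ 2 = 15 * N ^ 2 + 120 * N + 370 := Real.sq_sqrt (by nlinarith)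
    have hT0 : 0 ≤ T := Real.sqrt_nonneg _
    -- T² < 25 N² is again N² > 12 N + 37: beyond the threshold the denominator of p_m(n) is
    -- positive.
    have h3 : T < 5 * N := by nlinarith
    have h4 : 0 < 5 * (n : ℝ) - 10 * s - T := by linarith
    rw [lt_div_iff₀ h4] at hpm
    have h5 : k * (p - 1) = 2 * s := by rw [hk]; field_simp
    -- The numerator of p_m(n) exceeds the denominator by 20 s = 10 k (p - 1).
    have h6 : (p - 1) * (5 * N - T) < (p - 1) * (10 * k) := by
      have : 5 * (n : ℝ) - 10 * s = 5 * N := by rw [hN]; ring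
      nlinarith
    have h7 : 5 * N - T < 10 * k := lt_of_mul_lt_mul_left h6 hp1.le
    have h8 : 5 * (N - 2 * k) < T := by linarith
    have h9 : (5 * (N - 2 * k)) ^ 2 < T ^ 2 := by nlinarith
    nlinarith

lemma NeumannPair.dissipation_ge {b : ℝ} {U : Space n → ℝ} (k : ℝ) (hU : NeumannPair b U)
    {α β α' β' : ℝ} (h2 : 0 ≤ dissipationCoef₂ α β α' β')
    (hg : 0 ≤ dissipationCoefGrad α β α' β') {l : ℝ} (hl : 0 < l) :
    dissipationCoef₁ α β α' β' * boundaryForm b k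
        (fun X => scaleDeriv k U 1 X * scaleDeriv k U 1 X) l
      ≤ boundaryForm b k (dissipationDensity α β α' β' b (scaleDeriv k U)) l := by
  rw [← boundaryForm_const_mul]
  refine boundaryForm_mono hU.neg_one_lt hU.lt_one k hl
    ((hU.tame_mul k (by norm_num) (by norm_num)).smul_weight _)
    (hU.tame_dissipation k α β α' β') fun X _ => ?_
  have e1 := mul_self_nonneg (scaleDeriv k U 3 X)
  have e2 := mul_nonneg h2 (mul_self_nonneg (scaleDeriv k U 2 X))
  have e3 := sphGradDot_self_nonneg (scaleDeriv k U 2) X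
  have e4 := mul_nonneg hg (sphGradDot_self_nonneg (scaleDeriv k U 1) X)
  have e5 := mul_self_nonneg (sphLaplacian b (scaleDeriv k U 1) X)
  unfold dissipationDensity
  linarith

end LaneEmden
end

/-! ### Dilations, operators on the unit sphere, and derivatives in λ. -/

noncomputable section

namespace LaneEmden

open Set Filter Topology MeasureTheory

variable {n : ℕ}

section Dilation

variable {l : ℝ} (hl : 0 < l)

lemma dir_dilate (v : Space n) (f : Space n → ℝ) (l : ℝ) (X : Space n) :
    dir v (fun Y => f (l • Y)) X = l * dir v f (l • X) := by
  rw [dir, fderiv_comp_smul]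
  rfl

lemma euler_dilate (f : Space n → ℝ) (l : ℝ) (X : Space n) :
    euler (fun Y => f (l • Y)) X = euler f (l • X) := by
  rw [euler, fderiv_comp_smul, euler, map_smul]
  rfl

include hl

lemma SmoothUpper.dilate {m : ℕ} {f : Space n → ℝ} (hf : SmoothUpper m f) :
    SmoothUpper m (fun X => f (l • X)) :=
  ContDiffOn.comp hf (contDiff_const_smul l).contDiffOn fun _ hX => smul_mem_upperHalf hl hX

lemma weightedLaplacian_dilate (b : ℝ) {f : Space n → ℝ} (hf : SmoothUpper 2 f) {X : Space n}
    (hX : X ∈ upperHalf n) :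
    weightedLaplacian b (fun Y => f (l • Y)) X = l ^ 2 * weightedLaplacian b f (l • X) := by
  have hlX := smul_mem_upperHalf hl hX
  have h0 : height X ≠ 0 := ne_of_gt hX
  have h2 : ∀ i, dir (basisVec i) (dir (basisVec i) fun Y => f (l • Y)) X
      = l ^ 2 * dir (basisVec i) (dir (basisVec i) f) (l • X) := by
    intro i
    have hd := ((SmoothUpper.dir hf (basisVec i)).dilate hl).differentiableAt le_rfl hX
    rw [dir_congr (fun Y _ => dir_dilate (basisVec i) f l Y) _ hX, dir_const_mul hd, dir_dilate]
    ring
  rw [weightedLaplacian_eq b (hf.dilate hl) hX, weightedLaplacian_eq b hf hlX]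
  simp only [h2, dir_dilate, height_smul, ← Finset.mul_sum]
  field_simp

/-- The factor |X|² makes the spherical operators homogeneous of degree zero, so dilation produces
no power of l. -/
lemma sphGradDot_dilate {f g : Space n → ℝ} (hf : SmoothUpper 1 f) (hg : SmoothUpper 1 g) (c d : ℝ)
    {X : Space n} (hX : X ∈ upperHalf n) :
    sphGradDot (fun Y => c * f (l • Y)) (fun Y => d * g (l • Y)) X
      = c * d * sphGradDot f g (l • X) := by
  have df := (hf.dilate hl).differentiableAt le_rfl hX
  have dg := (hg.dilate hl).differentiableAt le_rfl hX
  simp only [sphGradDot, gradDot, dir_const_mul df, dir_const_mul dg, euler_const_mul df,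
    euler_const_mul dg, dir_dilate, euler_dilate, norm_smul, Real.norm_eq_abs, abs_of_pos hl,
    Finset.mul_sum, mul_sub]
  congr 1
  · exact Finset.sum_congr rfl fun i _ => by ring
  · ring

lemma sphLaplacian_dilate (b : ℝ) {f : Space n → ℝ} (hf : SmoothUpper 2 f) (c : ℝ)
    {X : Space n} (hX : X ∈ upperHalf n) :
    sphLaplacian b (fun Y => c * f (l • Y)) X = c * sphLaplacian b f (l • X) := by
  have df : ∀ Y ∈ upperHalf n, DifferentiableAt ℝ (fun Z => f (l • Z)) Y := fun Y hY =>
    (hf.dilate hl).differentiableAt (by norm_num) hY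
  have de := ((SmoothUpper.euler (m := 1) hf).dilate hl).differentiableAt le_rfl hX
  have h1 : EqOn (euler fun Y => c * f (l • Y)) (fun Y => c * euler f (l • Y)) (upperHalf n) :=
    fun Y hY => by
      rw [euler_const_mul (df Y hY)]
      simp only [euler_dilate]
  rw [sphLaplacian, sphLaplacian, weightedLaplacian_const_mul b c (hf.dilate hl) hX, h1 hX,
    euler_congr h1 hX, euler_const_mul de, euler_dilate (euler f)]
  simp only [weightedLaplacian_dilate hl b hf hX, norm_smul, Real.norm_eq_abs, abs_of_pos hl]
  ring

end Dilation

section Sphere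

lemma gradient_apply_eq (f : Space n → ℝ) (X : Space n) (i : Fin (n + 1)) :
    gradient f X i = dir (basisVec i) f X := by
  have h : inner ℝ (gradient f X) (basisVec i) = fderiv ℝ f X (basisVec i) := inner_gradient_left
  rw [EuclideanSpace.inner_single_right, one_mul] at h
  exact h

lemma inner_gradient_eq_gradDot (f g : Space n → ℝ) (X : Space n) :
    inner ℝ (gradient f X) (gradient g X) = gradDot f g X := by
  rw [PiLp.inner_apply, gradDot]
  refine Finset.sum_congr rfl fun i _ => ?_
  rw [gradient_apply_eq, gradient_apply_eq, RCLike.inner_apply, conj_trivial, mul_comm]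

lemma norm_gradient_sq (f : Space n → ℝ) (X : Space n) : ‖gradient f X‖ ^ 2 = gradDot f f X := by
  rw [← inner_gradient_eq_gradDot, real_inner_self_eq_norm_sq]

lemma inner_gradient_self_eq_euler (f : Space n → ℝ) (X : Space n) :
    inner ℝ (gradient f X) X = euler f X := inner_gradient_left

lemma inner_sphereGradient (f g : Space n → ℝ) {X : Space n} (hX : ‖X‖ = 1) :
    inner ℝ (sphereGradient f X) (sphereGradient g X) = sphGradDot f g X := by
  have h1 : inner ℝ X X = (1 : ℝ) := by rw [real_inner_self_eq_norm_sq, hX, one_pow]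
  have h2 : inner ℝ X (gradient g X) = euler g X := by
    rw [real_inner_comm, inner_gradient_self_eq_euler]
  simp only [sphereGradient, inner_sub_left, inner_sub_right, real_inner_smul_left,
    real_inner_smul_right, inner_gradient_eq_gradDot, inner_gradient_self_eq_euler, h1, h2,
    sphGradDot, hX]
  ring

/-- At r = 1 the second derivative of f (r X) is (X · ∇)² f - X · ∇ f, which turns the coefficient n
+ b into n + b - 1. -/
lemma sphereLaplacian_eq (b : ℝ) {f : Space n → ℝ} (hf : SmoothUpper 2 f) {X : Space n}
    (hX : X ∈ upperHalf n) (hX1 : ‖X‖ = 1) : sphereLaplacian b f X = sphLaplacian b f X := by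
  have he : SmoothUpper 1 (euler f) := SmoothUpper.euler hf
  have h1 : ∀ t : ℝ, 0 < t → HasDerivAt (fun r : ℝ => f (r • X)) (euler f (t • X) / t) t :=
    fun t ht => hasDerivAt_ray ht.ne'
      (hf.differentiableAt (by norm_num) (smul_mem_upperHalf ht hX))
  have h2 : deriv (fun r : ℝ => f (r • X)) 1 = euler f X := by
    rw [(h1 1 one_pos).deriv, one_smul, div_one]
  have h3 : iteratedDeriv 2 (fun r : ℝ => f (r • X)) 1 = euler (euler f) X - euler f X := by
    rw [iteratedDeriv_succ, iteratedDeriv_one]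
    have hev : deriv (fun r : ℝ => f (r • X)) =ᶠ[𝓝 1] fun t => euler f (t • X) / t := by
      filter_upwards [Ioi_mem_nhds one_pos] with t ht using (h1 t ht).deriv
    have hd := (hasDerivAt_ray one_ne_zero
      (he.differentiableAt le_rfl (smul_mem_upperHalf one_pos hX))).div (hasDerivAt_id (1 : ℝ))
      one_ne_zero
    rw [hev.deriv_eq]
    refine hd.deriv.trans ?_
    simp
  rw [sphereLaplacian, sphLaplacian, h2, h3, hX1]
  ring

lemma gradDot_congr {f f' g g' : Space n → ℝ} (hf : EqOn f f' (upperHalf n))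
    (hg : EqOn g g' (upperHalf n)) : EqOn (gradDot f g) (gradDot f' g') (upperHalf n) :=
  fun X hX => Finset.sum_congr rfl fun i _ => by rw [dir_congr hf _ hX, dir_congr hg _ hX]

lemma sphGradDot_congr {f f' g g' : Space n → ℝ} (hf : EqOn f f' (upperHalf n))
    (hg : EqOn g g' (upperHalf n)) : EqOn (sphGradDot f g) (sphGradDot f' g') (upperHalf n) :=
  fun X hX => by
    rw [sphGradDot, sphGradDot, gradDot_congr hf hg hX, euler_congr hf hX, euler_congr hg hX]

end Sphere

/-- The functions `D (D - 1) ⋯ (D - i + 1) U`, where `D = X · ∇ + k`. -/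
def fallingDeriv (k : ℝ) (U : Space n → ℝ) : ℕ → Space n → ℝ
  | 0 => U
  | i + 1 => eulerShift (k - i) (fallingDeriv k U i)

/-- The recursion of the Stirling numbers of the second kind: they express the powers of D through
λ^i d^i/dλ^i and appear as 1, 3, 1 and 1, 6, 7, 1 in `scaleDeriv_three` and `scaleDeriv_four`. -/
lemma eulerShift_fallingDeriv (k : ℝ) (U : Space n → ℝ) (i : ℕ) (X : Space n) :
    eulerShift k (fallingDeriv k U i) X
      = fallingDeriv k U (i + 1) X + i * fallingDeriv k U i X := by
  simp only [fallingDeriv, eulerShift]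
  ring

namespace NeumannPair

variable {b : ℝ} {U : Space n → ℝ} (k : ℝ) (hU : NeumannPair b U)
include hU

lemma generated_fallingDeriv : ∀ {i : ℕ}, i ≤ 5 → Generated b U i (fallingDeriv k U i)
  | 0, _ => hU.level_zero.gen
  | i + 1, hi => (generated_fallingDeriv (i := i) (by omega)).eulerShift hU.neg_one_lt hU.lt_one
      hU.regular (by omega) _

lemma level_fallingDeriv : ∀ {i : ℕ}, i ≤ 3 → NeumannLevel b U i (fallingDeriv k U i)
  | 0, _ => hU.level_zero
  | i + 1, hi => (level_fallingDeriv (i := i) (by omega)).eulerShift hU.neg_one_lt hU.lt_one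
      hU.regular (by omega) _

lemma admissible_fallingDeriv {i : ℕ} (hi : i ≤ 3) : NeumannAdmissible b (fallingDeriv k U i) :=
  (hU.level_fallingDeriv k hi).admissible hU.neg_one_lt hU.lt_one hU.regular hi

lemma smooth_fallingDeriv {i m : ℕ} (h : i + m ≤ 6) (hi : i ≤ 5) :
    SmoothUpper m (fallingDeriv k U i) :=
  ((hU.generated_fallingDeriv k hi).smooth hU.regular hi).mono (by omega)

end NeumannPair

lemma eulerShift_add (c : ℝ) {f g : Space n → ℝ} (hf : SmoothUpper 1 f) (hg : SmoothUpper 1 g) :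
    EqOn (eulerShift c fun X => f X + g X) (fun X => eulerShift c f X + eulerShift c g X)
      (upperHalf n) := fun X hX => by
  simp only [eulerShift, euler_add (hf.differentiableAt le_rfl hX) (hg.differentiableAt le_rfl hX)]
  ring

lemma eulerShift_const_mul (c a : ℝ) {f : Space n → ℝ} (hf : SmoothUpper 1 f) :
    EqOn (eulerShift c fun X => a * f X) (fun X => a * eulerShift c f X) (upperHalf n) :=
  fun X hX => by
    simp only [eulerShift, euler_const_mul (hf.differentiableAt le_rfl hX)]
    ring

namespace NeumannPair

variable {b : ℝ} {U : Space n → ℝ} (k : ℝ)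

lemma scaleDeriv_one : scaleDeriv k U 1 = fallingDeriv k U 1 := by
  ext X
  simp only [scaleDeriv, fallingDeriv, Function.iterate_one, Nat.cast_zero, sub_zero]

lemma scaleDeriv_two (X : Space n) :
    scaleDeriv k U 2 X = fallingDeriv k U 2 X + fallingDeriv k U 1 X := by
  rw [scaleDeriv_succ, scaleDeriv_one, eulerShift_fallingDeriv, Nat.cast_one, one_mul]

variable (hU : NeumannPair b U)
include hU

lemma scaleDeriv_three {X : Space n} (hX : X ∈ upperHalf n) :
    scaleDeriv k U 3 X
      = fallingDeriv k U 3 X + 3 * fallingDeriv k U 2 X + fallingDeriv k U 1 X := by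
  rw [scaleDeriv_succ, eulerShift_congr k (fun Y _ => scaleDeriv_two k Y) hX,
    eulerShift_add k (hU.smooth_fallingDeriv k (by norm_num) (by norm_num))
      (hU.smooth_fallingDeriv k (by norm_num) (by norm_num)) hX]
  simp only [eulerShift_fallingDeriv]
  push_cast
  ring

lemma scaleDeriv_four {X : Space n} (hX : X ∈ upperHalf n) :
    scaleDeriv k U 4 X = fallingDeriv k U 4 X + 6 * fallingDeriv k U 3 X
      + 7 * fallingDeriv k U 2 X + fallingDeriv k U 1 X := by
  have s1 : ∀ i, i ≤ 5 → SmoothUpper 1 (fallingDeriv k U i) := fun i hi =>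
    hU.smooth_fallingDeriv k (by omega) hi
  have s2 : SmoothUpper 1 fun Y => 3 * fallingDeriv k U 2 Y := .const_mul 3 (s1 2 (by norm_num))
  have s3 : SmoothUpper 1 fun Y => fallingDeriv k U 3 Y + 3 * fallingDeriv k U 2 Y :=
    .add (s1 3 (by norm_num)) s2
  rw [scaleDeriv_succ, eulerShift_congr k (fun Y hY => hU.scaleDeriv_three k hY) hX,
    eulerShift_add k s3 (s1 1 (by norm_num)) hX]
  simp only
  rw [eulerShift_add k (s1 3 (by norm_num)) s2 hX]
  simp only
  rw [eulerShift_const_mul k 3 (s1 2 (by norm_num)) hX]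
  simp only [eulerShift_fallingDeriv]
  push_cast
  ring

end NeumannPair

end LaneEmden
end

/-! ### The integrals of the energy as boundary forms. -/

noncomputable section

namespace LaneEmden

open Set Filter Topology MeasureTheory

variable {n : ℕ}

/-- The boundary integral of `q` over the half sphere of radius `l` converges to `v`. -/
structure HasBoundaryForm (b k l : ℝ) (q : Space n → ℝ) (v : ℝ) : Prop where
  tame : Tame |b| (fun X => height X ^ b * q X)
  eq : boundaryForm b k q l = v

lemma HasBoundaryForm.const_mul {b k l : ℝ} {q : Space n → ℝ} {v : ℝ} (c : ℝ)
    (hq : HasBoundaryForm b k l q v) : HasBoundaryForm b k l (fun X => c * q X) (c * v) :=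
  ⟨hq.tame.smul_weight c, by rw [boundaryForm_const_mul, hq.eq]⟩

section

variable {b : ℝ} (hb : -1 < b) (hb' : b < 1)
include hb hb'

lemma HasBoundaryForm.add {k l : ℝ} (hl : 0 < l) {q q' : Space n → ℝ} {v v' : ℝ}
    (hq : HasBoundaryForm b k l q v) (hq' : HasBoundaryForm b k l q' v') :
    HasBoundaryForm b k l (fun X => q X + q' X) (v + v') :=
  ⟨hq.tame.add_weight hq'.tame, by
    rw [boundaryForm_add hb hb' k hl hq.tame hq'.tame, hq.eq, hq'.eq]⟩

lemma integrable_and_hasBoundaryForm {k l : ℝ} (hl : 0 < l) {q : Space n → ℝ}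
    (hq : Tame |b| (fun X => height X ^ b * q X)) {T : Space n → ℝ}
    (hT : ∀ X ∈ upperHalf n, ‖X‖ = 1 → T X = l ^ (2 * k) * (height X ^ b * q (l • X))) :
    Integrable (fun ω : Metric.sphere (0 : Space n) 1 => T ω) (upperSphereMeasure n) ∧
      HasBoundaryForm b k l q (∫ ω, T ω ∂(upperSphereMeasure n)) := by
  have hae : (fun ω : Metric.sphere (0 : Space n) 1 => T ω) =ᵐ[upperSphereMeasure n]
      fun ω => l ^ (2 * k) * (height (ω : Space n) ^ b * q (l • (ω : Space n))) := by
    filter_upwards [ae_upperSphere] with ω hω using hT _ hω (norm_sphere ω)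
  refine ⟨((integrable_weight_sphere hb hb' hq hl).const_mul _).congr hae.symm, hq, ?_⟩
  rw [integral_congr_ae hae, boundaryForm_eq_integral b k q hl, integral_const_mul]

end

/-- The factor λ^{i+j} in the energy offsets the i + j derivatives in λ, so these products carry the
same power λ^{2k} for all i and j. -/
lemma rpow_mul_rpow_sub {l : ℝ} (hl : 0 < l) (k : ℝ) (i j : ℕ) (z : ℝ) :
    l ^ (i + j) * (l ^ (k - i) * l ^ (k - j) * z) = l ^ (2 * k) * z := by
  rw [two_mul, Real.rpow_add hl, Real.rpow_sub_natCast hl.ne', Real.rpow_sub_natCast hl.ne',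
    pow_add]
  field_simp

section Rescaling

variable {s p : ℝ} {x₀ : EuclideanSpace ℝ (Fin n)} {u : Space n → ℝ}

lemma rescale_eq (s p : ℝ) (x₀ : EuclideanSpace ℝ (Fin n)) (u : Space n → ℝ) (l : ℝ) :
    rescale s p x₀ u l = fun X => l ^ (2 * s / (p - 1)) * translate (point x₀ 0) u (l • X) := rfl

variable (hU : NeumannPair (5 - 2 * s) (translate (point x₀ 0) u))
include hU

/-- Differentiating λ^{k-i} F(λX) gives λ^{k-i-1} times the dilate of (X · ∇ + k - i) F; iteration
builds the falling factorials of D. -/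
lemma rescaleDeriv_eq : ∀ {i : ℕ}, i ≤ 5 → ∀ {l : ℝ}, 0 < l →
    EqOn (rescaleDeriv s p x₀ u i l) (fun X => l ^ (2 * s / (p - 1) - i) *
      fallingDeriv (2 * s / (p - 1)) (translate (point x₀ 0) u) i (l • X)) (upperHalf n)
  | 0, _, l, _, X, _ => by
    rw [rescaleDeriv, iteratedDeriv_zero, rescale_eq, Nat.cast_zero, sub_zero]
    rfl
  | i + 1, hi, l, hl, X, hX => by
    have hev : iteratedDeriv i (fun t => rescale s p x₀ u t X) =ᶠ[𝓝 l] fun t =>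
        t ^ (2 * s / (p - 1) - i) *
          fallingDeriv (2 * s / (p - 1)) (translate (point x₀ 0) u) i (t • X) := by
      filter_upwards [Ioi_mem_nhds hl] with t ht
        using rescaleDeriv_eq (i := i) (by omega) ht hX
    have hs := hU.smooth_fallingDeriv (2 * s / (p - 1)) (i := i) (m := 1) (by omega) (by omega)
    have hd := (Real.hasDerivAt_rpow_const (p := 2 * s / (p - 1) - i) (Or.inl hl.ne')).mul
      (hasDerivAt_ray hl.ne' (hs.differentiableAt le_rfl (smul_mem_upperHalf hl hX)))
    rw [rescaleDeriv, iteratedDeriv_succ, hev.deriv_eq]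
    refine hd.deriv.trans ?_
    simp only [fallingDeriv, eulerShift]
    rw [Nat.cast_add_one, ← sub_sub, Real.rpow_sub_one hl.ne']
    ring

lemma term₁_eq {i j : ℕ} (hi : i ≤ 5) (hj : j ≤ 5) {l : ℝ} (hl : 0 < l) :
    Integrable (fun ω : Metric.sphere (0 : Space n) 1 => term₁ s p x₀ u l i j ω)
        (upperSphereMeasure n) ∧
      HasBoundaryForm (5 - 2 * s) (2 * s / (p - 1)) l
        (fun X => fallingDeriv (2 * s / (p - 1)) (translate (point x₀ 0) u) i X
          * fallingDeriv (2 * s / (p - 1)) (translate (point x₀ 0) u) j X)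
        (∫ ω, term₁ s p x₀ u l i j ω ∂(upperSphereMeasure n)) := by
  refine integrable_and_hasBoundaryForm hU.neg_one_lt hU.lt_one hl (tame_weight_mul
    (((hU.generated_fallingDeriv _ hi).extendsContinuously hU.regular hi).mul
      ((hU.generated_fallingDeriv _ hj).extendsContinuously hU.regular hj))) fun X hX _ => ?_
  rw [term₁, rescaleDeriv_eq hU hi hl hX, rescaleDeriv_eq hU hj hl hX, mul_mul_mul_comm,
    rpow_mul_rpow_sub hl, mul_left_comm]

lemma term₂_eq {i j : ℕ} (hi : i ≤ 3) (hj : j ≤ 3) {l : ℝ} (hl : 0 < l) :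
    Integrable (fun ω : Metric.sphere (0 : Space n) 1 => term₂ s p x₀ u l i j ω)
        (upperSphereMeasure n) ∧
      HasBoundaryForm (5 - 2 * s) (2 * s / (p - 1)) l
        (sphGradDot (fallingDeriv (2 * s / (p - 1)) (translate (point x₀ 0) u) i)
          (fallingDeriv (2 * s / (p - 1)) (translate (point x₀ 0) u) j))
        (∫ ω, term₂ s p x₀ u l i j ω ∂(upperSphereMeasure n)) := by
  refine integrable_and_hasBoundaryForm hU.neg_one_lt hU.lt_one hl
    ((hU.admissible_fallingDeriv _ hi).toAdmissible.tame_sphGradDot hU.lt_one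
      (hU.admissible_fallingDeriv _ hj).toAdmissible) fun X hX hX1 => ?_
  rw [term₂, inner_sphereGradient _ _ hX1, sphGradDot_congr (rescaleDeriv_eq hU (by omega) hl)
    (rescaleDeriv_eq hU (by omega) hl) hX,
    sphGradDot_dilate hl (hU.smooth_fallingDeriv _ (by omega) (by omega))
      (hU.smooth_fallingDeriv _ (by omega) (by omega)) _ _ hX, rpow_mul_rpow_sub hl,
    mul_left_comm]

lemma term₃_eq {i j : ℕ} (hi : i ≤ 3) (hj : j ≤ 3) {l : ℝ} (hl : 0 < l) :
    Integrable (fun ω : Metric.sphere (0 : Space n) 1 => term₃ s p x₀ u l i j ω)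
        (upperSphereMeasure n) ∧
      HasBoundaryForm (5 - 2 * s) (2 * s / (p - 1)) l
        (fun X => sphLaplacian (5 - 2 * s)
            (fallingDeriv (2 * s / (p - 1)) (translate (point x₀ 0) u) i) X
          * sphLaplacian (5 - 2 * s)
            (fallingDeriv (2 * s / (p - 1)) (translate (point x₀ 0) u) j) X)
        (∫ ω, term₃ s p x₀ u l i j ω ∂(upperSphereMeasure n)) := by
  have key : ∀ i, i ≤ 3 → ∀ X ∈ upperHalf n, ‖X‖ = 1 →
      sphereLaplacian (5 - 2 * s) (rescaleDeriv s p x₀ u i l) X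
        = l ^ (2 * s / (p - 1) - i) * sphLaplacian (5 - 2 * s)
            (fallingDeriv (2 * s / (p - 1)) (translate (point x₀ 0) u) i) (l • X) := by
    intro i hi X hX hX1
    have hs := hU.smooth_fallingDeriv (2 * s / (p - 1)) (i := i) (m := 2) (by omega) (by omega)
    have he := rescaleDeriv_eq (p := p) hU (i := i) (by omega) hl
    rw [sphereLaplacian_eq _ (SmoothUpper.congr (.const_mul _ (hs.dilate hl)) he) hX hX1,
      sphLaplacian_congr _ he hX, sphLaplacian_dilate hl _ hs _ hX]
  refine integrable_and_hasBoundaryForm hU.neg_one_lt hU.lt_one hl (tame_weight_mul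
    (((hU.admissible_fallingDeriv _ hi).extends_sphLaplacian hU.lt_one).mul
      ((hU.admissible_fallingDeriv _ hj).extends_sphLaplacian hU.lt_one))) fun X hX hX1 => ?_
  rw [term₃, key i hi X hX hX1, key j hj X hX hX1, mul_mul_mul_comm, rpow_mul_rpow_sub hl,
    mul_left_comm]

lemma weightedLaplacian_rescale {l : ℝ} (hl : 0 < l) :
    EqOn (weightedLaplacian (5 - 2 * s) (rescale s p x₀ u l))
      (fun X => l ^ (2 * s / (p - 1) + 2) *
        weightedLaplacian (5 - 2 * s) (translate (point x₀ 0) u) (l • X)) (upperHalf n) := by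
  intro X hX
  have hs : SmoothUpper 2 (translate (point x₀ 0) u) :=
    hU.smooth_fallingDeriv 0 (i := 0) (by norm_num) (by norm_num)
  rw [rescale_eq, weightedLaplacian_const_mul _ _ (hs.dilate hl) hX]
  simp only [weightedLaplacian_dilate hl _ hs hX]
  rw [show (2 : ℝ) = (2 : ℕ) by norm_num, Real.rpow_add_natCast hl.ne']
  ring

lemma term₄_eq {l : ℝ} (hl : 0 < l) :
    Integrable (fun ω : Metric.sphere (0 : Space n) 1 => term₄ s p x₀ u l ω)
        (upperSphereMeasure n) ∧
      HasBoundaryForm (5 - 2 * s) (2 * s / (p - 1)) l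
        (fun X => scaledLap (5 - 2 * s) (translate (point x₀ 0) u) X
          * scaledLap (5 - 2 * s) (translate (point x₀ 0) u) X)
        (∫ ω, term₄ s p x₀ u l ω ∂(upperSphereMeasure n)) := by
  refine integrable_and_hasBoundaryForm hU.neg_one_lt hU.lt_one hl (tame_weight_mul
    (hU.admissible_scaledLap.extends_self.mul hU.admissible_scaledLap.extends_self))
    fun X hX hX1 => ?_
  rw [term₄, weightedLaplacian_rescale hU hl hX]
  simp only [scaledLap, norm_smul, Real.norm_eq_abs, abs_of_pos hl, hX1, mul_one]
  rw [two_mul (2 * s / (p - 1)), Real.rpow_add hl, Real.rpow_add hl, Real.rpow_two]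
  ring

lemma bulkDensity_eq {l : ℝ} (hl : 0 < l) :
    EqOn (bulkDensity s p x₀ u l) (fun X => l ^ (2 * (2 * s / (p - 1)) + 6 - (5 - 2 * s)) *
      (1 / 2 * (height (l • X) ^ (5 - 2 * s) *
        gradDot (weightedLaplacian (5 - 2 * s) (translate (point x₀ 0) u))
          (weightedLaplacian (5 - 2 * s) (translate (point x₀ 0) u)) (l • X)))) (upperHalf n) := by
  intro X hX
  have hs : SmoothUpper 1 (weightedLaplacian (5 - 2 * s) (translate (point x₀ 0) u)) :=
    hU.smooth_laplacian.mono (by norm_num)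
  have hd := (hs.dilate hl).differentiableAt le_rfl hX
  have he := weightedLaplacian_rescale (p := p) hU hl
  rw [bulkDensity, norm_gradient_sq, gradDot_congr he he hX]
  have hg : gradDot (fun X => l ^ (2 * s / (p - 1) + 2) *
        weightedLaplacian (5 - 2 * s) (translate (point x₀ 0) u) (l • X))
      (fun X => l ^ (2 * s / (p - 1) + 2) *
        weightedLaplacian (5 - 2 * s) (translate (point x₀ 0) u) (l • X)) X
      = (l ^ (2 * s / (p - 1) + 2) * l ^ (2 * s / (p - 1) + 2) * l ^ 2) *
        gradDot (weightedLaplacian (5 - 2 * s) (translate (point x₀ 0) u))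
          (weightedLaplacian (5 - 2 * s) (translate (point x₀ 0) u)) (l • X) := by
    simp only [gradDot, dir_const_mul hd, dir_dilate, Finset.mul_sum]
    exact Finset.sum_congr rfl fun i _ => by ring
  have hexp : l ^ (2 * s / (p - 1) + 2) * l ^ (2 * s / (p - 1) + 2) * l ^ 2
      = l ^ (2 * (2 * s / (p - 1)) + 6 - (5 - 2 * s)) * l ^ (5 - 2 * s) := by
    rw [← Real.rpow_add hl, ← Real.rpow_natCast l 2, ← Real.rpow_add hl, ← Real.rpow_add hl]
    congr 1
    push_cast
    ring
  simp only [hg, hexp, height_rpow_smul _ hl hX]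
  ring

end Rescaling

end LaneEmden
end

/-! ### The coefficients of the energy and the proof of the theorem. -/

noncomputable section

namespace LaneEmden

open Set Filter Topology MeasureTheory

variable {n : ℕ}

section Coefficients

variable (α β α' β' : ℝ)

/-- The coefficients `C¹` of the energy. -/
def energyCoef₁ : ℕ → ℕ → ℝ
  | 4, 1 => -1
  | 3, 1 => -(α + α')
  | 3, 2 => 2
  | 2, 2 => α' + 4
  | 2, 1 => 9 - 3 * α - α' + (4 * (α + α') - 2 * β - (α * α' + β + β'))
  | 1, 1 => 3 - α + (4 * (α + α') - 2 * β - (α * α' + β + β'))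
      + (2 * (α * α' + β + β') - α * β)
  | 0, 1 => β * β'
  | 0, 0 => 2 * (β * β')
  | _, _ => 0

/-- The coefficients `C²` of the energy. -/
def energyCoef₂ : ℕ → ℕ → ℝ
  | 2, 1 => 4
  | 1, 1 => α
  | 0, 1 => -(β + β')
  | 0, 0 => -(2 * (β + β'))
  | _, _ => 0

/-- The coefficients `C³` of the energy. -/
def energyCoef₃ : ℕ → ℕ → ℝ
  | 0, 1 => 1
  | 0, 0 => 2
  | _, _ => 0

end Coefficients

lemma NeumannPair.sphGradDot_two_one {b : ℝ} {U : Space n → ℝ} (k : ℝ) (hU : NeumannPair b U)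
    {X : Space n} (hX : X ∈ upperHalf n) :
    sphGradDot (scaleDeriv k U 2) (scaleDeriv k U 1) X
      = sphGradDot (fallingDeriv k U 2) (fallingDeriv k U 1) X
        + sphGradDot (fallingDeriv k U 1) (fallingDeriv k U 1) X := by
  have s1 : ∀ i, i ≤ 5 → DifferentiableAt ℝ (fallingDeriv k U i) X := fun i hi =>
    (hU.smooth_fallingDeriv k (m := 1) (by omega) hi).differentiableAt le_rfl hX
  rw [funext (scaleDeriv_two (U := U) k), scaleDeriv_one,
    sphGradDot_add_left (s1 2 (by norm_num)) (s1 1 (by norm_num))]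

/-- The boundary density of the energy in terms of derivatives in the dilation parameter. -/
lemma NeumannPair.energyDensity_eq {b : ℝ} {U : Space n → ℝ} (k : ℝ) (hU : NeumannPair b U)
    (α β α' β' : ℝ) {F : ℕ → Space n → ℝ} (hF : F = fallingDeriv k U) {X : Space n}
    (hX : X ∈ upperHalf n) :
    energyCoef₁ α β α' β' 4 1 * (F 4 X * F 1 X) + energyCoef₁ α β α' β' 3 1 * (F 3 X * F 1 X)
        + energyCoef₁ α β α' β' 3 2 * (F 3 X * F 2 X) + energyCoef₁ α β α' β' 2 2 * (F 2 X * F 2 X)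
        + energyCoef₁ α β α' β' 2 1 * (F 2 X * F 1 X) + energyCoef₁ α β α' β' 1 1 * (F 1 X * F 1 X)
        + energyCoef₁ α β α' β' 0 1 * (F 0 X * F 1 X) + energyCoef₁ α β α' β' 0 0 * (F 0 X * F 0 X)
        + energyCoef₂ α β β' 2 1 * sphGradDot (F 2) (F 1) X
        + energyCoef₂ α β β' 1 1 * sphGradDot (F 1) (F 1) X
        + energyCoef₂ α β β' 0 1 * sphGradDot (F 0) (F 1) X
        + energyCoef₂ α β β' 0 0 * sphGradDot (F 0) (F 0) X
        + energyCoef₃ 0 1 * (sphLaplacian b (F 0) X * sphLaplacian b (F 1) X)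
        + energyCoef₃ 0 0 * (sphLaplacian b (F 0) X * sphLaplacian b (F 0) X)
      = energyDensity α β α' β' b (scaleDeriv k U) X := by
  have h0 : scaleDeriv k U 0 = F 0 := by rw [hF]; rfl
  -- The energy coefficients are those of `energyDensity` after D² U, D³ U and D⁴ U are expanded in
  -- falling factorials; for instance the gradient coefficient α arises as (α - 4) + 4.
  rw [energyDensity, hU.sphGradDot_two_one k hX, hU.scaleDeriv_four k hX, hU.scaleDeriv_three k hX,
    scaleDeriv_two, scaleDeriv_one, h0, ← hF]
  simp only [energyCoef₁, energyCoef₂, energyCoef₃]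
  ring

section Energy

variable {s p : ℝ} {x₀ : EuclideanSpace ℝ (Fin n)} {u : Space n → ℝ}

/-- The double sums collapse to fourteen entries. `HasBoundaryForm` carries convergence along with
the value, since additivity of the integral needs both. -/
lemma boundary_energy_eq (hU : NeumannPair (5 - 2 * s) (translate (point x₀ 0) u))
    (α β α' β' : ℝ) {l : ℝ} (hl : 0 < l) :
    (∑ i ∈ Finset.range 5, ∑ j ∈ Finset.range 5, if i + j ≤ 5 then
        energyCoef₁ α β α' β' i j * ∫ ω, term₁ s p x₀ u l i j ω ∂(upperSphereMeasure n) else 0)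
      + (∑ i ∈ Finset.range 3, ∑ j ∈ Finset.range 3, if i + j ≤ 3 then
        energyCoef₂ α β β' i j * ∫ ω, term₂ s p x₀ u l i j ω ∂(upperSphereMeasure n) else 0)
      + (∑ i ∈ Finset.range 2, ∑ j ∈ Finset.range 2, if i + j ≤ 1 then
        energyCoef₃ i j * ∫ ω, term₃ s p x₀ u l i j ω ∂(upperSphereMeasure n) else 0)
      = boundaryForm (5 - 2 * s) (2 * s / (p - 1)) (energyDensity α β α' β' (5 - 2 * s)
          (scaleDeriv (2 * s / (p - 1)) (translate (point x₀ 0) u))) l := by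
  set b := 5 - 2 * s with hb
  set k := 2 * s / (p - 1) with hk
  set U := translate (point x₀ 0) u with hUdef
  have t1 := fun (i j : ℕ) (hi : i ≤ 5) (hj : j ≤ 5) => (term₁_eq (p := p) hU hi hj hl).2.const_mul
    (energyCoef₁ α β α' β' i j)
  have t2 := fun (i j : ℕ) (hi : i ≤ 3) (hj : j ≤ 3) => (term₂_eq (p := p) hU hi hj hl).2.const_mul
    (energyCoef₂ α β β' i j)
  have t3 := fun (i j : ℕ) (hi : i ≤ 3) (hj : j ≤ 3) => (term₃_eq (p := p) hU hi hj hl).2.const_mul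
    (energyCoef₃ i j)
  have add := fun {q q' : Space n → ℝ} {v v' : ℝ} (h : HasBoundaryForm b k l q v)
    (h' : HasBoundaryForm b k l q' v') => h.add hU.neg_one_lt hU.lt_one hl h'
  have h := add (add (add (add (add (add (add (add (add (add (add (add (add
    (t1 4 1 (by norm_num) (by norm_num)) (t1 3 1 (by norm_num) (by norm_num)))
    (t1 3 2 (by norm_num) (by norm_num))) (t1 2 2 (by norm_num) (by norm_num)))
    (t1 2 1 (by norm_num) (by norm_num))) (t1 1 1 (by norm_num) (by norm_num)))
    (t1 0 1 (by norm_num) (by norm_num))) (t1 0 0 (by norm_num) (by norm_num)))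
    (t2 2 1 (by norm_num) (by norm_num))) (t2 1 1 (by norm_num) (by norm_num)))
    (t2 0 1 (by norm_num) (by norm_num))) (t2 0 0 (by norm_num) (by norm_num)))
    (t3 0 1 (by norm_num) (by norm_num))) (t3 0 0 (by norm_num) (by norm_num))
  have hsum := h.eq
  rw [boundaryForm_congr b k (q' := energyDensity α β α' β' b (scaleDeriv k U)) ?_ hl] at hsum
  · rw [hsum]
    simp only [Finset.sum_range_succ, Finset.sum_range_zero, energyCoef₁, energyCoef₂, energyCoef₃]
    norm_num
    ring
  · exact fun X hX => hU.energyDensity_eq k α β α' β' rfl hX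

lemma integral_bulkDensity (hU : NeumannPair (5 - 2 * s) (translate (point x₀ 0) u)) {l : ℝ}
    (hl : 0 < l) :
    IntegrableOn (bulkDensity s p x₀ u l) (upperBall n) ∧
      ∫ X in upperBall n, bulkDensity s p x₀ u l X
        = bulkEnergy (5 - 2 * s) (2 * s / (p - 1)) (translate (point x₀ 0) u) l := by
  have he : EqOn (bulkDensity s p x₀ u l) _ (upperBall n) := fun X hX => bulkDensity_eq hU hl hX.1
  have hb := abs_lt_one_of_mem hU.neg_one_lt hU.lt_one
  refine ⟨IntegrableOn.congr_fun (((hU.tame_bulk.integrable_upperBall (abs_nonneg _) hb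
    hl).const_mul _).const_mul _) he.symm measurableSet_upperBall, ?_⟩
  rw [setIntegral_congr_fun measurableSet_upperBall he, integral_const_mul, integral_const_mul,
    bulkEnergy]

lemma potentialDensity_eq (s : ℝ) (p : ℝ) (x₀ : EuclideanSpace ℝ (Fin n)) (u : Space n → ℝ) {l : ℝ}
    (hl : 0 < l) (x : EuclideanSpace ℝ (Fin n)) :
    potentialDensity s p x₀ u l x = l ^ (2 * s / (p - 1) * (p + 1)) *
      |translate (point x₀ 0) u (point (l • x) 0)| ^ (p + 1) := by
  rw [potentialDensity, rescale_eq, abs_mul, abs_of_pos (Real.rpow_pos_of_pos hl _), smul_point,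
    mul_zero, Real.mul_rpow (Real.rpow_nonneg hl.le _) (abs_nonneg _), ← Real.rpow_mul hl.le]

lemma integral_potentialDensity (hp : 1 < p)
    (hU : ContinuousOn (translate (point x₀ 0) u) (closedUpperHalf n)) {l : ℝ} (hl : 0 < l) :
    IntegrableOn (potentialDensity s p x₀ u l) (Metric.ball 0 1) ∧
      ∫ x in Metric.ball 0 1, potentialDensity s p x₀ u l x
        = potentialEnergy (2 * s / (p - 1)) p (translate (point x₀ 0) u) l := by
  have he := funext (potentialDensity_eq s p x₀ u hl)
  have hc : Continuous fun x : EuclideanSpace ℝ (Fin n) =>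
      translate (point x₀ 0) u (point (l • x) 0) :=
    (ContinuousOn.comp_point hU).comp (continuous_const_smul l)
  rw [he]
  refine ⟨((continuous_const.mul (hc.abs.rpow_const fun _ => Or.inr
    (by linarith))).continuousOn.integrableOn_compact (isCompact_closedBall 0 1)).mono_set
    Metric.ball_subset_closedBall, ?_⟩
  rw [integral_const_mul, potentialEnergy]

lemma energyConverges_of_neumannPair (hp : 1 < p)
    (hU : NeumannPair (5 - 2 * s) (translate (point x₀ 0) u))
    (hUc : ContinuousOn (translate (point x₀ 0) u) (closedUpperHalf n)) {l : ℝ} (hl : 0 < l) :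
    EnergyConverges s p x₀ u l :=
  ⟨(integral_bulkDensity hU hl).1, (integral_potentialDensity hp hUc hl).1,
    fun _ _ hi hj _ => (term₁_eq hU (by omega) (by omega) hl).1,
    fun _ _ hi hj _ => (term₂_eq hU (by omega) (by omega) hl).1,
    fun _ _ hi hj _ => (term₃_eq hU (by omega) (by omega) hl).1, (term₄_eq hU hl).1⟩

lemma energy_eq_eulerEnergy (κ : ℝ) (hp : 1 < p)
    (hU : NeumannPair (5 - 2 * s) (translate (point x₀ 0) u))
    (hUc : ContinuousOn (translate (point x₀ 0) u) (closedUpperHalf n)) {m : ℝ}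
    (hm : m = n + (5 - 2 * s) - 1) {k : ℝ} (hk : k = 2 * s / (p - 1)) {l : ℝ} (hl : 0 < l) :
    energy s p κ (energyCoef₁ (linCoef m k) (constCoef m k) (linCoef m (k + 2))
        (constCoef m (k + 2))) (energyCoef₂ (linCoef m k) (constCoef m k) (constCoef m (k + 2)))
        energyCoef₃ x₀ u l
      = eulerEnergy (5 - 2 * s) k p κ (translate (point x₀ 0) u) l := by
  subst hm hk
  have h := boundary_energy_eq (p := p) hU (linCoef (n + (5 - 2 * s) - 1) (2 * s / (p - 1)))
    (constCoef (n + (5 - 2 * s) - 1) (2 * s / (p - 1)))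
    (linCoef (n + (5 - 2 * s) - 1) (2 * s / (p - 1) + 2))
    (constCoef (n + (5 - 2 * s) - 1) (2 * s / (p - 1) + 2)) hl
  rw [energy, eulerEnergy, ← h, (integral_bulkDensity hU hl).2,
    (integral_potentialDensity hp hUc hl).2, (term₄_eq hU hl).2.eq]
  ring

/-- At distance l from (x₀, 0) the operator l ∂_r is the Euler operator of the translate, so the
defect is y^b (D U)². -/
lemma defect_eq (s p : ℝ) (x₀ : EuclideanSpace ℝ (Fin n)) (u : Space n → ℝ) {l : ℝ} (hl : 0 < l)
    {X : Space n} (hX1 : ‖X‖ = 1) :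
    defect s p x₀ u l (point x₀ 0 + l • X) = height (l • X) ^ (5 - 2 * s) *
      (scaleDeriv (2 * s / (p - 1)) (translate (point x₀ 0) u) 1 (l • X)
        * scaleDeriv (2 * s / (p - 1)) (translate (point x₀ 0) u) 1 (l • X)) := by
  have hr : l * radialDeriv x₀ u (point x₀ 0 + l • X)
      = euler (translate (point x₀ 0) u) (l • X) := by
    have he : euler (translate (point x₀ 0) u) (l • X)
        = fderiv ℝ u (point x₀ 0 + l • X) (l • X) :=
      congrFun (dir_translate (point x₀ 0) (l • X) u) (l • X)
    rw [he, radialDeriv, add_sub_cancel_left, norm_smul, hX1, mul_one, Real.norm_eq_abs,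
      abs_of_pos hl, map_smul, smul_eq_mul, mul_inv_cancel_left₀ hl.ne']
  rw [defect, hr, height_add, height_point, zero_add]
  simp only [scaleDeriv, Function.iterate_one, eulerShift, translate]
  ring

lemma halfSphereIntegral_defect (hU : NeumannPair (5 - 2 * s) (translate (point x₀ 0) u)) {l : ℝ}
    (hl : 0 < l) :
    HalfSphereIntegrable x₀ l (defect s p x₀ u l) ∧
      halfSphereIntegral x₀ l (defect s p x₀ u l)
        = l ^ n * sphereMean (fun X => height X ^ (5 - 2 * s) *
          (scaleDeriv (2 * s / (p - 1)) (translate (point x₀ 0) u) 1 X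
          * scaleDeriv (2 * s / (p - 1)) (translate (point x₀ 0) u) 1 X)) l := by
  have hae : (fun ω : Metric.sphere (0 : Space n) 1 =>
        defect s p x₀ u l (point x₀ 0 + l • (ω : Space n))) =ᵐ[upperSphereMeasure n] _ :=
    .of_forall fun ω => defect_eq s p x₀ u hl (norm_sphere ω)
  refine ⟨((hU.tame_mul (2 * s / (p - 1)) (i := 1) (j := 1) (by norm_num)
    (by norm_num)).integrable_sphere (abs_nonneg _) (abs_lt_one_of_mem hU.neg_one_lt hU.lt_one)
    hl).congr hae.symm, ?_⟩
  rw [halfSphereIntegral, integral_congr_ae hae, sphereMean]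

end Energy

end LaneEmden
end

theorem theorem2p3 (n : ℕ) (s p : ℝ) (hs₂ : 2 < s) (hs₃ : s < 3) (hn : 2 * s < n)
    (hp : ((n : ℝ) + 2 * s) / ((n : ℝ) - 2 * s) < p)
    (hpm : (p : EReal) < LaneEmden.upperExponent n s) :
    ∃ (c₁ c₂ c₃ : ℕ → ℕ → ℝ) (C : ℝ), 0 < C ∧
      ∀ (κ : ℝ), 0 < κ → ∀ (u : LaneEmden.Space n → ℝ),
        LaneEmden.IsExtensionSolution s p κ u →
        ∀ x₀ : EuclideanSpace ℝ (Fin n),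
          MonotoneOn (LaneEmden.energy s p κ c₁ c₂ c₃ x₀ u) (Set.Ioi 0) ∧
          ∀ l : ℝ, 0 < l →
            LaneEmden.EnergyConverges s p x₀ u l ∧
            LaneEmden.HalfSphereIntegrable x₀ l (LaneEmden.defect s p x₀ u l) ∧
            ∃ D : ℝ, HasDerivAt (LaneEmden.energy s p κ c₁ c₂ c₃ x₀ u) D l ∧
              C * l ^ (2 * s * ((p + 1) / (p - 1)) - 6 - n) *
                LaneEmden.halfSphereIntegral x₀ l (LaneEmden.defect s p x₀ u l) ≤ D := by
  obtain ⟨hp1, hk0, hkN⟩ := LaneEmden.exponent_lt_of_supercritical (s := s) (p := p)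
    (N := n - 2 * s) (by linarith) (by linarith)
    (by rwa [show (n : ℝ) - 2 * s + 4 * s = n + 2 * s by ring])
  have hsq := LaneEmden.sq_lt_of_lt_upperExponent (by linarith : 0 < s) hp1 rfl hkN hpm
  obtain ⟨k, hk⟩ : ∃ k, k = 2 * s / (p - 1) := ⟨_, rfl⟩
  obtain ⟨m, hm⟩ : ∃ m : ℝ, m = n + (5 - 2 * s) - 1 := ⟨_, rfl⟩
  rw [← hk] at hk0 hkN hsq
  have hkm : 2 * k + 4 < m := by linarith
  -- This coefficient of |D U|² is the constant C(n, s, p) of the theorem.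
  have hC := LaneEmden.dissipationCoef₁_pos hk0 hkm
  have hG := LaneEmden.dissipationCoefGrad_nonneg hk0 hkm
  have hA : 0 ≤ LaneEmden.dissipationCoef₂ (LaneEmden.linCoef m k) (LaneEmden.constCoef m k)
      (LaneEmden.linCoef m (k + 2)) (LaneEmden.constCoef m (k + 2)) := by
    refine LaneEmden.dissipationCoef₂_nonneg ?_
    rw [hm]
    convert hsq using 3 <;> ring
  refine ⟨LaneEmden.energyCoef₁ (LaneEmden.linCoef m k) (LaneEmden.constCoef m k)
        (LaneEmden.linCoef m (k + 2)) (LaneEmden.constCoef m (k + 2)),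
      LaneEmden.energyCoef₂ (LaneEmden.linCoef m k) (LaneEmden.constCoef m k)
        (LaneEmden.constCoef m (k + 2)), LaneEmden.energyCoef₃, _, hC, fun κ _ u hu x₀ => ?_⟩
  have hU := hu.translate x₀
  have hN := hU.neumannPair hs₂ hs₃
  have hder : ∀ l : ℝ, 0 < l → HasDerivAt (LaneEmden.energy s p κ
      (LaneEmden.energyCoef₁ (LaneEmden.linCoef m k) (LaneEmden.constCoef m k)
        (LaneEmden.linCoef m (k + 2)) (LaneEmden.constCoef m (k + 2)))
      (LaneEmden.energyCoef₂ (LaneEmden.linCoef m k) (LaneEmden.constCoef m k)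
        (LaneEmden.constCoef m (k + 2))) LaneEmden.energyCoef₃ x₀ u) _ l := fun l hl =>
    (hm ▸ hU.hasDerivAt_eulerEnergy hs₂ hs₃ hp1 hk hl).congr_of_eventuallyEq (by
      filter_upwards [Ioi_mem_nhds hl] with r hr
        using LaneEmden.energy_eq_eulerEnergy κ hp1 hN hU.continuousOn hm hk hr)
  have hlow : ∀ l : ℝ, 0 < l → _ := fun l hl => hN.dissipation_ge k hA hG hl
  have hpos : ∀ l : ℝ, 0 < l → 0 ≤ LaneEmden.boundaryForm (5 - 2 * s) k
      (fun X => LaneEmden.scaleDeriv k (LaneEmden.translate (LaneEmden.point x₀ 0) u) 1 X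
        * LaneEmden.scaleDeriv k (LaneEmden.translate (LaneEmden.point x₀ 0) u) 1 X) l :=
    fun l hl => LaneEmden.boundaryForm_mono_zero k hl fun X _ => mul_self_nonneg _
  refine ⟨?_, fun l hl => ⟨LaneEmden.energyConverges_of_neumannPair hp1 hN hU.continuousOn hl,
    (LaneEmden.halfSphereIntegral_defect hN hl).1, _, hder l hl, ?_⟩⟩
  · refine monotoneOn_of_deriv_nonneg (convex_Ioi 0)
      (fun l hl => (hder l hl).continuousAt.continuousWithinAt)
      (fun l hl => ?_) (fun l hl => ?_)
    · rw [interior_Ioi] at hl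
      exact (hder l hl).differentiableAt.differentiableWithinAt
    · rw [interior_Ioi] at hl
      rw [(hder l hl).deriv]
      exact div_nonneg ((mul_nonneg hC.le (hpos l hl)).trans (hlow l hl)) (le_of_lt hl)
  · rw [(LaneEmden.halfSphereIntegral_defect hN hl).2, ← hk, le_div_iff₀ hl]
    refine le_trans (le_of_eq ?_) (hlow l hl)
    have hp1' : p - 1 ≠ 0 := by linarith
    -- The boundary form contributes l^{2k-b} with b = 5 - 2s, the derivative of the energy a factor
    -- 1/l, and the surface measure of the half sphere of radius l the remaining l^n.
    have hexp : 2 * s * ((p + 1) / (p - 1)) - 6 - n = 2 * k - (5 - 2 * s) - (1 : ℕ) - (n : ℕ) := by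
      rw [hk]
      field_simp
      push_cast
      ring
    rw [hexp, Real.rpow_sub_natCast hl.ne', Real.rpow_sub_natCast hl.ne', LaneEmden.boundaryForm]
    field_simp
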